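/- **Setting.** Fix an integer $d\ge 2$. For each $n$ let $G_n$ be the random $d$-regular multigraph on vertices $1,\dots,n$ given by the configuration model: vertex $i$ carries $D_i$ half-edges, and the half-edges are paired by a uniformly random perfect matching (self-loops and multiple edges are allowed). Here $D_i=d$ for all $i$ if $nd$ is even; if $nd$ is odd, one (arbitrary) $D_i$ equals $d+1$ and all others equal $d$. Let $\mathbb{E}$ be expectation over $G_n$, and let $k_{i,j}$ be the number of edges between $i$ and $j$ (for $i=j$, the number of self-loops at $i$). For $\sigma\in\Omega_n=\{-1,1\}^n$, $\beta\ge 0$, $B\in\mathbb{R}$ put $$H(\sigma)=-\beta\sum_{i\le j}k_{i,j}\sigma_i\sigma_j-B\sum_{i=1}^n\sigma_i,\qquad Z_n(\beta,B)=\sum_{\sigma\in\Omega_n}e^{-H(\sigma)},\qquad \mu_n(\sigma)=\frac{\mathbb{E}(e^{-H(\sigma)})}{\mathbb{E}(Z_n(\beta,B))},$$ and, with $S_n=\sigma_1+\dots+\sigma_n$, $$\psi_n(\beta,B)=\frac1n\log\mathbb{E}(Z_n(\beta,B)),\qquad M_n(\beta,B)=\mathbb{E}_{\mu_n}\Big(\frac{S_n}{n}\Big),\qquad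 \chi_n(\beta,B)=\mathrm{Var}_{\mu_n}\Big(\frac{S_n}{\sqrt n}\Big).$$ Write $\mathcal{M}(\beta,B)=\lim_n M_n(\beta,B)$ when this limit exists, and let $\mathcal{M}(\beta,0^+)=\lim_{B\searrow0}\mathcal{M}(\beta,B)$ be the spontaneous magnetization. Define $\beta_c=\inf\{\beta>0:\mathcal{M}(\beta,0^+)>0\}\in[0,\infty]$ (with $\inf\emptyset=\infty$) and $$\mathcal{U}=\{(\beta,B):\ \beta\ge0,\ B\ne0\}\cup\{(\beta,0):\ 0<\beta<\beta_c\}.$$ **Theorem 1.1 (thermodynamic limits).** (i) For all $\beta\ge0$ and $B\in\mathbb{R}$, $$\lim_{n\to\infty}\psi_n(\beta,B)=\psi(\beta,B):=\frac{\beta d}{2}-B+\max_{0\le t\le1}\Big[(t-1)\log(1-t)-t\log t+2Bt+d\,F(t)\Big]$$ (with $0\log 0=0$; the maximum is attained), where $$F(t)=\int_0^{\min\{t,1-t\}}\log f(s)\,ds,\qquad f(s)=\frac{e^{-2\beta}(1-2s)+\sqrt{1+(e^{-4\beta}-1)(1-2s)^2}}{2(1-s)}.$$ (ii) For all $(\beta,B)\in\mathcal{U}$,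 the function $\psi(\beta,\cdot)$ is differentiable at $B$ and $$\lim_{n\to\infty}M_n(\beta,B)=\mathcal{M}(\beta,B)=\frac{\partial}{\partial B}\psi(\beta,B).$$ Moreover, the spontaneous magnetization $\mathcal{M}(\beta,0^+)$ exists for every $\beta>0$, and the critical inverse temperature is $$\beta_c=\operatorname{atanh}\Big(\frac1{d-1}\Big)=\frac12\log\Big(\frac{d}{d-2}\Big)\ \text{ if } d\ge3,\qquad \beta_c=\infty\ \text{ if } d=2.$$ (iii) For all $(\beta,B)\in\mathcal{U}$, the function $\psi(\beta,\cdot)$ is twice differentiable at $B$ and $$\lim_{n\to\infty}\chi_n(\beta,B)=\chi(\beta,B)=\frac{\partial^2}{\partial B^2}\psi(\beta,B).$$ -/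

import Mathlib

open Filter Topology Set

noncomputable section

namespace AnnealedIsing

/-! ### The configuration model -/

/-- The set of half-edges when vertex `i` carries `D i` half-edges. -/
abbrev HalfEdge {n : ℕ} (D : Fin n → ℕ) : Type := Σ i : Fin n, Fin (D i)

/-- A perfect matching of the half-edges, encoded as the fixed-point free involution sending every
half-edge to its partner. -/
abbrev Matching {n : ℕ} (D : Fin n → ℕ) : Type :=
  {π : Equiv.Perm (HalfEdge D) // ∀ h, π (π h) = h ∧ π h ≠ h}

/-- The edges of the multigraph, as unordered pairs of matched half-edges. -/
def edges {n : ℕ} {D : Fin n → ℕ} (π : Matching D) : Finset (Sym2 (HalfEdge D)) :=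
  Finset.univ.image fun h => s(h, π.1 h)

/-- The number `k_{i,j}` of edges between the vertices `i` and `j` (for `i = j` the number of
self-loops at `i`). -/
def edgeCount {n : ℕ} {D : Fin n → ℕ} (π : Matching D) (i j : Fin n) : ℕ :=
  ((edges π).filter fun e => e.map Sigma.fst = s(i, j)).card

/-- Expectation with respect to the configuration model: the half-edges are paired by a uniformly
random perfect matching. -/
def graphExpect {n : ℕ} (D : Fin n → ℕ) (X : Matching D → ℝ) : ℝ :=
  (∑ π : Matching D, X π) / (Fintype.card (Matching D) : ℝ)

/-- The degree sequences of the random `d`-regular graph on `n` vertices: all degrees are `d`,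
except that one degree is increased by one when `n * d` is odd. -/
def IsRegularDegrees (d n : ℕ) (D : Fin n → ℕ) : Prop :=
  (Even (n * d) → ∀ i, D i = d) ∧
    (Odd (n * d) → ∃ v, D v = d + 1 ∧ ∀ i, i ≠ v → D i = d)

/-! ### The annealed Ising model -/

/-- Spin configurations; `ℤˣ = {1, -1}`. -/
abbrev Spins (n : ℕ) : Type := Fin n → ℤˣ

/-- The real value `±1` of the spin at `i`. -/
def spin {n : ℕ} (σ : Spins n) (i : Fin n) : ℝ := ((σ i : ℤ) : ℝ)

/-- The total spin `S_n`. -/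
def totalSpin {n : ℕ} (σ : Spins n) : ℝ := ∑ i, spin σ i

/-- The Hamiltonian `H(σ) = -β ∑_{i ≤ j} k_{i,j} σ_i σ_j - B ∑_i σ_i`. -/
def hamiltonian {n : ℕ} {D : Fin n → ℕ} (β B : ℝ) (π : Matching D) (σ : Spins n) : ℝ :=
  -β * (∑ i, ∑ j ∈ Finset.Ici i, (edgeCount π i j : ℝ) * spin σ i * spin σ j)
    - B * ∑ i, spin σ i

/-- The partition function of a realization of the graph. -/
def partitionFunction {n : ℕ} {D : Fin n → ℕ} (β B : ℝ) (π : Matching D) : ℝ :=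
  ∑ σ : Spins n, Real.exp (-hamiltonian β B π σ)

/-- The annealed measure `μ_n(σ) = E[exp(-H(σ))] / E[Z_n]`. -/
def annealedWeight {n : ℕ} (D : Fin n → ℕ) (β B : ℝ) (σ : Spins n) : ℝ :=
  graphExpect D (fun π => Real.exp (-hamiltonian β B π σ)) /
    graphExpect D (fun π => partitionFunction β B π)

/-- Expectation under the annealed measure. -/
def annealedExpect {n : ℕ} (D : Fin n → ℕ) (β B : ℝ) (X : Spins n → ℝ) : ℝ :=
  ∑ σ : Spins n, annealedWeight D β B σ * X σ

/-- Variance under the annealed measure. -/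
def annealedVar {n : ℕ} (D : Fin n → ℕ) (β B : ℝ) (X : Spins n → ℝ) : ℝ :=
  annealedExpect D β B fun σ => (X σ - annealedExpect D β B X) ^ 2

/-- The annealed pressure `ψ_n(β, B) = (1/n) log E[Z_n(β, B)]`. -/
def pressure {n : ℕ} (D : Fin n → ℕ) (β B : ℝ) : ℝ :=
  1 / (n : ℝ) * Real.log (graphExpect D fun π => partitionFunction β B π)

/-- The annealed magnetization `M_n(β, B) = E_{μ_n}[S_n / n]`. -/
def magnetization {n : ℕ} (D : Fin n → ℕ) (β B : ℝ) : ℝ :=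
  annealedExpect D β B fun σ => totalSpin σ / (n : ℝ)

/-- The annealed susceptibility `χ_n(β, B) = Var_{μ_n}(S_n / √n)`. -/
def susceptibility {n : ℕ} (D : Fin n → ℕ) (β B : ℝ) : ℝ :=
  annealedVar D β B fun σ => totalSpin σ / Real.sqrt (n : ℝ)

/-! ### Spontaneous magnetization, critical value and uniqueness region

Here `D n` is the degree sequence of the graph on `n` vertices. -/

/-- `m` is the spontaneous magnetization `lim_{B ↘ 0} lim_n M_n(β, B)`, all the limits existing. -/
def IsSpontaneousMagnetization (D : (n : ℕ) → Fin n → ℕ) (β m : ℝ) : Prop :=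
  ∃ M : ℝ → ℝ,
    (∀ B, 0 < B → Tendsto (fun n => magnetization (D n) β B) atTop (𝓝 (M B))) ∧
      Tendsto M (𝓝[>] 0) (𝓝 m)

/-- The critical inverse temperature, the infimum of the `β > 0` with positive spontaneous
magnetization (`⊤` if there are none). -/
def criticalBeta (D : (n : ℕ) → Fin n → ℕ) : EReal :=
  sInf ((fun β : ℝ => (β : EReal)) ''
    {β : ℝ | 0 < β ∧ ∃ m, IsSpontaneousMagnetization D β m ∧ 0 < m})

/-- The region `𝒰` of the pairs `(β, B)`. -/
def region (D : (n : ℕ) → Fin n → ℕ) : Set (ℝ × ℝ) :=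
  {p | (0 ≤ p.1 ∧ p.2 ≠ 0) ∨ (0 < p.1 ∧ (p.1 : EReal) < criticalBeta D ∧ p.2 = 0)}

/-! ### The limiting pressure -/

/-- The function `f`. -/
def fFun (β s : ℝ) : ℝ :=
  (Real.exp (-2 * β) * (1 - 2 * s) +
      Real.sqrt (1 + (Real.exp (-4 * β) - 1) * (1 - 2 * s) ^ 2)) / (2 * (1 - s))

/-- The function `F(t) = ∫_0^{min(t, 1 - t)} log f(s) ds`. -/
def FFun (β t : ℝ) : ℝ :=
  ∫ s in (0 : ℝ)..(min t (1 - t)), Real.log (fFun β s)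

/-- The function to be maximized over `t ∈ [0, 1]`. -/
def objective (d : ℕ) (β B t : ℝ) : ℝ :=
  (t - 1) * Real.log (1 - t) - t * Real.log t + 2 * B * t + (d : ℝ) * FFun β t

/-- The limiting pressure `ψ(β, B)`. -/
def limitPressure (d : ℕ) (β B : ℝ) : ℝ :=
  β * (d : ℝ) / 2 - B + sSup (objective d β B '' Icc 0 1)

end AnnealedIsing

end

/-!
Apart from a factor `exp (B * S_n)`, the expected weight `𝔼 exp (-H(σ))` is the average, over all
perfect matchings of the half-edges, of the product of `exp (± β)` over the matched pairs. By
symmetry it depends only on the number `k` of half-edges attached to plus spins. Resolving the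
partner of one half-edge gives a three-term recursion in `k`, with `c = exp (-2 * β)`. The same
recursion is satisfied by the moments `∫ x ^ k / (x ^ 2 - 2 * c * x + 1) ^ (r + 1)`, where `2 * r`
is the number of half-edges: it is integration by parts. Hence the two agree up to a constant
(`matchWeight_signOf_eq`, `momentIntegral_recursion`). Under the integral sign the spins are now
independent, with weight `exp B * x ^ D i` for a plus spin and `exp (-B)` for a minus spin. So every
annealed expectation is a quotient of one-dimensional integrals (`annealedExpect_eq_integral`),
whose integrand is essentially the `n`-th power of `siteRatio c B d x`.

Laplace's method applies at a point `x` where `siteRatio c B d` has a unique, nondegenerate maximum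
(`IsRegularMax`). It shows that the pressure converges to the logarithm of the maximal value, up to
explicit constants, the magnetization to the mean `siteMean B d x` of one spin, and the
susceptibility to the sum of the variance `1 - siteMean B d x ^ 2` of one spin and the contribution
of the Gaussian fluctuations around `x`.

The critical points solve `critFun c d x = 2 * B`. To the right of `1`, the function `x * critSlope
c d x` of `x` increases, so that `critFun` increases once its slope is nonnegative. This yields a
regular maximum for every `B > 0`, for `B < 0` by the spin flip `x ↦ x⁻¹`, and for `B = 0` if
`critSlope c d 1 > 0`, that is, `d - 2 < d * c`.

The variational formula for `ψ` has the same value: `F(s)` is the maximum over `x` of `s * log x -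
log (x ^ 2 - 2 * c * x + 1) / 2`, up to a constant, and is attained at `x = f(s)` (`FFun_eq`); the
maximum over `t` is then the Gibbs variational principle for two states (`limitPressure_eq`). The
first derivative of `ψ` in `B` is `siteMean` at the maximizer, because the integrand is stationary
there, and the second derivative comes from implicit differentiation of the critical equation; both
agree with the limits found by Laplace's method. At zero field the pressure converges because all
pressures are `1`-Lipschitz in `B`. As `B` decreases to `0` the maximizer tends to a limit that
exceeds `1` exactly if `critSlope c d 1 < 0`, which identifies the critical inverse temperature. For
`β = 0`, where `c = 1` and the moment integrals diverge, the spins are independent.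
-/

namespace AnnealedIsing

noncomputable section

/-! ### Weighted perfect matchings -/

section Matchings

variable {α : Type*} [Fintype α] [DecidableEq α]

/-- Perfect matchings of a finite type, as fixed-point free involutions. -/
abbrev PerfectMatching (α : Type*) : Type _ :=
  {π : Equiv.Perm α // ∀ h, π (π h) = h ∧ π h ≠ h}

/-- The sum over all perfect matchings of the product of `exp (β * r a * r b)` over the matched
pairs `{a, b}`. The factor `1 / 2` appears because every pair is visited twice. -/
def matchWeight (β : ℝ) (r : α → ℝ) : ℝ :=
  ∑ π : PerfectMatching α, Real.exp (β / 2 * ∑ k, r k * r (π.1 k))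

/-- The part of `matchWeight β r` that comes from the matchings pairing `h` with `p`. -/
def pairedWeight (β : ℝ) (h p : α) (r : α → ℝ) : ℝ :=
  ∑ π : PerfectMatching α, if π.1 h = p then Real.exp (β / 2 * ∑ k, r k * r (π.1 k)) else 0

/-- The function `r` with its values at `h` and `p` replaced by `0`. -/
def mask (r : α → ℝ) (h p : α) (k : α) : ℝ := if k = h ∨ k = p then 0 else r k

/-- The `±1`-valued function that is `1` exactly on `P`. -/
def signOf (P : Finset α) (k : α) : ℝ := if k ∈ P then 1 else -1

/-- If `h` and `p` are matched, the pair `{h, p}` contributes `2 * (r h * r p)` to the sum. -/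
lemma sum_mul_eq_mask (r : α → ℝ) {h p : α} (hp : p ≠ h) (π : PerfectMatching α)
    (hπ : π.1 h = p) :
    ∑ k, r k * r (π.1 k) = 2 * (r h * r p) + ∑ k, mask r h p k * mask r h p (π.1 k) := by
  have hπ' : π.1 p = h := by rw [← hπ]; exact (π.2 h).1
  have key : ∀ k, r k * r (π.1 k) = ((if k = h then r h * r p else 0) +
      (if k = p then r h * r p else 0)) + mask r h p k * mask r h p (π.1 k) := by
    intro k
    by_cases h1 : k = h
    · subst h1; simp [mask, hπ, hp.symm]
    by_cases h2 : k = p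
    · subst h2; simp [mask, hπ', hp, mul_comm]
    have h3 : π.1 k ≠ h := fun hk => h2 (by rw [← hπ, ← hk, (π.2 k).1])
    have h4 : π.1 k ≠ p := fun hk => h1 (π.1.injective (hk.trans hπ.symm))
    simp [mask, h1, h2, h3, h4]
  rw [Finset.sum_congr rfl fun k _ => key k, Finset.sum_add_distrib, Finset.sum_add_distrib]
  simp; ring

/-- Splitting a sum over matchings according to the partner of `h`. -/
lemma matchWeight_eq_sum (β : ℝ) (r : α → ℝ) (h : α) :
    matchWeight β r = ∑ p ∈ Finset.univ.erase h,
      Real.exp (β * (r h * r p)) * pairedWeight β h p (mask r h p) := by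
  have h1 : matchWeight β r = ∑ p, pairedWeight β h p r := by
    unfold matchWeight pairedWeight
    rw [Finset.sum_comm]
    simp
  have h2 : pairedWeight β h h r = 0 := by
    unfold pairedWeight
    exact Finset.sum_eq_zero fun π _ => by simp [(π.2 h).2]
  rw [h1, ← Finset.add_sum_erase _ _ (Finset.mem_univ h), h2, zero_add]
  refine Finset.sum_congr rfl fun p hp => ?_
  unfold pairedWeight
  rw [Finset.mul_sum]
  refine Finset.sum_congr rfl fun π _ => ?_
  split_ifs with hπ
  · rw [sum_mul_eq_mask r (Finset.ne_of_mem_erase hp) π hπ, ← Real.exp_add]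
    ring_nf
  · simp

/-- Conjugation of perfect matchings by a permutation. -/
def conjMatching (τ : Equiv.Perm α) : PerfectMatching α ≃ PerfectMatching α where
  toFun π := ⟨τ * π.1 * τ⁻¹, fun h => by
    refine ⟨by simp [(π.2 _).1], fun hh => (π.2 (τ⁻¹ h)).2 ?_⟩
    simpa using congrArg (⇑τ⁻¹) hh⟩
  invFun π := ⟨τ⁻¹ * π.1 * τ, fun h => by
    refine ⟨by simp [(π.2 _).1], fun hh => (π.2 (τ h)).2 ?_⟩
    simpa using congrArg (⇑τ) hh⟩
  left_inv π := by ext; simp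
  right_inv π := by ext; simp

lemma pairedWeight_comp (β : ℝ) (h p : α) (r : α → ℝ) (τ : Equiv.Perm α) :
    pairedWeight β (τ h) (τ p) r = pairedWeight β h p (r ∘ τ) := by
  unfold pairedWeight
  symm
  refine Fintype.sum_equiv (conjMatching τ) _ _ fun π => ?_
  have : ∑ k, r k * r ((conjMatching τ π).1 k) = ∑ k, (r ∘ τ) k * (r ∘ τ) (π.1 k) := by
    symm
    exact Fintype.sum_equiv τ _ _ fun k => by simp [conjMatching]
  rw [this]
  simp [conjMatching]

/-- All partners of `h` outside `P` contribute equally, by the symmetry that exchanges them. -/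
lemma pairedWeight_eq_of_notMem (β : ℝ) {P : Finset α} {h p q : α} (hp : p ∉ P) (hq : q ∉ P)
    (hph : p ≠ h) (hqh : q ≠ h) :
    pairedWeight β h q (mask (signOf P) h q) = pairedWeight β h p (mask (signOf P) h p) := by
  have := pairedWeight_comp β h p (mask (signOf P) h q) (Equiv.swap p q)
  rw [Equiv.swap_apply_of_ne_of_ne hph.symm hqh.symm, Equiv.swap_apply_left] at this
  rw [this]
  congr 1
  ext k
  simp only [Function.comp, mask, signOf]
  by_cases h1 : k = p
  · subst h1; simp
  by_cases h2 : k = q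
  · subst h2; simp [hp, hq, hph, h1, hqh, Ne.symm h1]
  rw [Equiv.swap_apply_of_ne_of_ne h1 h2]
  simp [h1, h2]

/-- Removing `h` and some plus sign `q` from the pattern `insert p P` leaves, up to a permutation,
the same signs as removing `h` and `p` from the pattern `P`. -/
lemma pairedWeight_insert_eq (β : ℝ) {P : Finset α} {h p q : α} (hp : p ∉ P)
    (hph : p ≠ h) (hq : q ∈ insert p P) (hqh : q ≠ h) :
    pairedWeight β h q (mask (signOf (insert p P)) h q) =
      pairedWeight β h p (mask (signOf P) h p) := by
  have := pairedWeight_comp β h p (mask (signOf (insert p P)) h q) (Equiv.swap p q)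
  rw [Equiv.swap_apply_of_ne_of_ne hph.symm hqh.symm, Equiv.swap_apply_left] at this
  rw [this]
  congr 1
  ext k
  simp only [Function.comp, mask, signOf]
  by_cases h1 : k = p
  · subst h1; simp
  by_cases h2 : k = q
  · subst h2
    have : k ∈ P := by simpa [h1] using hq
    simp [hph, h1, this, hqh, Ne.symm h1]
  rw [Equiv.swap_apply_of_ne_of_ne h1 h2]
  simp [h1, h2]

lemma matchWeight_signOf (β : ℝ) {P : Finset α} {h : α} (hh : h ∉ P) :
    matchWeight β (signOf P) = ∑ p ∈ Finset.univ.erase h,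
      Real.exp (-(β * signOf P p)) * pairedWeight β h p (mask (signOf P) h p) := by
  rw [matchWeight_eq_sum β _ h]
  refine Finset.sum_congr rfl fun p _ => ?_
  have : signOf P h = -1 := by simp [signOf, hh]
  rw [this]; ring_nf

lemma matchWeight_signOf_insert (β : ℝ) {P : Finset α} {h : α} :
    matchWeight β (signOf (insert h P)) = ∑ p ∈ Finset.univ.erase h,
      Real.exp (β * signOf P p) * pairedWeight β h p (mask (signOf P) h p) := by
  rw [matchWeight_eq_sum β _ h]
  refine Finset.sum_congr rfl fun p hp => ?_
  have hp' := Finset.ne_of_mem_erase hp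
  have h1 : signOf (insert h P) h = 1 := by simp [signOf]
  have h2 : signOf (insert h P) p = signOf P p := by simp [signOf, hp']
  have h3 : mask (signOf (insert h P)) h p = mask (signOf P) h p := by
    ext k
    by_cases hk : k = h <;> simp [mask, signOf, hk]
  rw [h1, h2, h3, one_mul]

/-- The combination in which the partners of `h` with a minus sign cancel. -/
lemma matchWeight_insert_sub (β : ℝ) {P : Finset α} {h : α} (hh : h ∉ P) :
    matchWeight β (signOf (insert h P)) - Real.exp (-2 * β) * matchWeight β (signOf P) =
      ∑ p ∈ P, (Real.exp β - Real.exp (-3 * β)) * pairedWeight β h p (mask (signOf P) h p) := by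
  rw [matchWeight_signOf β hh, matchWeight_signOf_insert, Finset.mul_sum, ← Finset.sum_sub_distrib]
  have hsub : P ⊆ Finset.univ.erase h := fun p hp =>
    Finset.mem_erase.2 ⟨fun e => hh (e ▸ hp), Finset.mem_univ _⟩
  rw [← Finset.sum_subset hsub]
  · refine Finset.sum_congr rfl fun p hp => ?_
    simp only [signOf, hp, if_true]
    rw [← mul_assoc, ← Real.exp_add]
    ring_nf
  · intro p _ hp
    simp only [signOf, hp, if_false]
    rw [← mul_assoc, ← Real.exp_add]
    ring_nf

/-- The combination in which the partners of `h` with a plus sign cancel. -/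
lemma matchWeight_sub_insert (β : ℝ) {P : Finset α} {h : α} (hh : h ∉ P) :
    matchWeight β (signOf P) - Real.exp (-2 * β) * matchWeight β (signOf (insert h P)) =
      ∑ p ∈ (insert h P)ᶜ,
        (Real.exp β - Real.exp (-3 * β)) * pairedWeight β h p (mask (signOf P) h p) := by
  rw [matchWeight_signOf β hh, matchWeight_signOf_insert, Finset.mul_sum, ← Finset.sum_sub_distrib]
  have hsub : (insert h P)ᶜ ⊆ Finset.univ.erase h := fun p hp => by
    simp at hp ⊢; tauto
  rw [← Finset.sum_subset hsub]
  · refine Finset.sum_congr rfl fun p hp => ?_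
    have : p ∉ P := by simp at hp; tauto
    simp only [signOf, this, if_false]
    rw [← mul_assoc, ← Real.exp_add]
    ring_nf
  · intro p hp1 hp
    have : p ∈ P := by simp at hp hp1; tauto
    simp only [signOf, this, if_true]
    rw [← mul_assoc, ← Real.exp_add]
    ring_nf

/-- The weight of a sign pattern only depends on the number of plus signs, through any solution `J`
of a three-term recursion. Let `A` be the weight as a function of the set of plus signs. For `h ≠ p`
outside `P`, the difference `A (insert h (insert p P)) - exp (-2 * β) * A (insert p P)` is
`P.card + 1` times some `w`, and `A P - exp (-2 * β) * A (insert h P)` is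
`Fintype.card α - (P.card + 1)` times the same `w`. Eliminating `w` gives the recursion for `A`. -/
lemma matchWeight_signOf_eq (β : ℝ) (J : ℕ → ℝ)
    (h0 : 0 < Fintype.card α → J 1 = Real.exp (-2 * β) * J 0)
    (hJ : ∀ k : ℕ, 1 ≤ k → k < Fintype.card α →
      k * (J (k - 1) - Real.exp (-2 * β) * J k) =
        ((Fintype.card α : ℝ) - k) * (J (k + 1) - Real.exp (-2 * β) * J k)) (P : Finset α) :
    matchWeight β (signOf P) * J 0 = matchWeight β (signOf (∅ : Finset α)) * J P.card := by
  induction hn : P.card using Nat.strong_induction_on generalizing P with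
  | _ n ih =>
  rcases Finset.eq_empty_or_nonempty P with rfl | ⟨h, hh⟩
  · simp at hn; subst hn; rfl
  obtain ⟨P, hhP, rfl⟩ : ∃ P', h ∉ P' ∧ P = insert h P' :=
    ⟨P.erase h, Finset.notMem_erase _ _, (Finset.insert_erase hh).symm⟩
  rw [Finset.card_insert_of_notMem hhP] at hn
  have hcard : P.card < Fintype.card α := Finset.card_lt_univ_of_notMem hhP
  have hA := matchWeight_insert_sub β hhP
  rcases Finset.eq_empty_or_nonempty P with rfl | ⟨p, hp⟩
  · simp at hn hcard
    subst hn
    have hpos : 0 < Fintype.card α := Fintype.card_pos_iff.2 ⟨h⟩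
    rw [Finset.sum_empty, sub_eq_zero] at hA
    rw [hA, h0 hpos]; ring
  obtain ⟨P, hpP, rfl⟩ : ∃ P', p ∉ P' ∧ P = insert p P' :=
    ⟨P.erase p, Finset.notMem_erase _ _, (Finset.insert_erase hp).symm⟩
  have hph : p ≠ h := fun e => hhP (e ▸ hp)
  have hhP' : h ∉ P := fun e => hhP (Finset.mem_insert_of_mem e)
  rw [Finset.card_insert_of_notMem hpP] at hn hcard
  have hB := matchWeight_sub_insert β hhP'
  rw [Finset.sum_congr rfl (g := fun _ => (Real.exp β - Real.exp (-3 * β)) *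
    pairedWeight β h p (mask (signOf P) h p)) (fun q hq => by
      rw [pairedWeight_insert_eq β hpP hph hq (fun e => hhP (e ▸ hq))]),
    Finset.sum_const, Finset.card_insert_of_notMem hpP] at hA
  rw [Finset.sum_congr rfl (g := fun _ => (Real.exp β - Real.exp (-3 * β)) *
    pairedWeight β h p (mask (signOf P) h p)) (fun q hq => by
      simp at hq
      rw [pairedWeight_eq_of_notMem β hpP hq.2 hph hq.1]),
    Finset.sum_const, Finset.card_compl, Finset.card_insert_of_notMem hhP'] at hB
  have e1 := ih _ (by omega) P rfl
  have e2 := ih (P.card + 1) (by omega) _ (Finset.card_insert_of_notMem hhP')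
  have e3 := ih (P.card + 1) (by omega) _ (Finset.card_insert_of_notMem hpP)
  have hJ' := hJ (P.card + 1) (by omega) hcard
  subst hn
  rw [nsmul_eq_mul] at hA hB
  push_cast [Nat.cast_sub hcard.le] at hA hB hJ'
  have hne : ((Fintype.card α : ℝ) - (P.card + 1)) ≠ 0 := by
    have : ((P.card + 1 : ℕ) : ℝ) < Fintype.card α := by exact_mod_cast hcard
    push_cast at this; linarith
  apply mul_left_cancel₀ hne
  linear_combination (((Fintype.card α : ℝ) - (P.card + 1)) * J 0) * hA
    - (P.card + 1) * J 0 * hB + (P.card + 1 : ℝ) * e1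
    - (P.card + 1 : ℝ) * Real.exp (-2 * β) * e2
    + ((Fintype.card α : ℝ) - (P.card + 1)) * Real.exp (-2 * β) * e3
    + matchWeight β (signOf (∅ : Finset α)) * hJ'

lemma matchWeight_signOf_empty (β : ℝ) :
    matchWeight β (signOf (∅ : Finset α)) =
      Fintype.card (PerfectMatching α) * Real.exp (β / 2 * Fintype.card α) := by
  simp [matchWeight, signOf]

lemma nonempty_perfectMatching {γ : Type*} [Fintype γ] (h : Even (Fintype.card γ)) :
    Nonempty (PerfectMatching γ) := by
  obtain ⟨k, hk⟩ := h
  have e : γ ≃ Fin k ⊕ Fin k := Fintype.equivOfCardEq (by simp [hk])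
  refine ⟨⟨(e.trans (Equiv.sumComm _ _)).trans e.symm, fun h => ⟨by simp, fun hh => ?_⟩⟩⟩
  have : (e h).swap = e h := by simpa [Equiv.symm_apply_eq] using hh
  generalize e h = z at this
  rcases z with x | x <;> simp at this

end Matchings

/-! ### The moment integrals -/

/-- The quadratic form `x ^ 2 - 2 c x + 1`. -/
def quad (c x : ℝ) : ℝ := x ^ 2 - 2 * c * x + 1

/-- The integral `∫ x ^ k / (x ^ 2 - 2 c x + 1) ^ (r + 1) dx` over the real line. It
converges for `k ≤ 2 * r` and `0 ≤ c < 1`. -/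
def momentIntegral (c : ℝ) (r k : ℕ) : ℝ := ∫ x : ℝ, x ^ k / quad c x ^ (r + 1)

lemma quad_ge {c : ℝ} (h0 : 0 ≤ c) (x : ℝ) : (1 - c) * (1 + x ^ 2) ≤ quad c x := by
  unfold quad; nlinarith [mul_nonneg h0 (sq_nonneg (x - 1))]

lemma quad_pos {c : ℝ} (h0 : 0 ≤ c) (h1 : c < 1) (x : ℝ) : 0 < quad c x :=
  lt_of_lt_of_le (mul_pos (by linarith) (by positivity)) (quad_ge h0 x)

lemma continuous_quad (c : ℝ) : Continuous (quad c) := by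
  unfold quad; fun_prop

lemma hasDerivAt_quad (c x : ℝ) : HasDerivAt (quad c) (2 * (x - c)) x := by
  unfold quad
  have := (((hasDerivAt_pow 2 x).sub ((hasDerivAt_id' x).const_mul (2 * c))).add_const 1)
  refine this.congr_deriv ?_
  push_cast; ring

lemma integrable_inv_quad {c : ℝ} (h0 : 0 ≤ c) (h1 : c < 1) :
    MeasureTheory.Integrable fun x => 1 / quad c x := by
  refine (integrable_inv_one_add_sq.const_mul (1 / (1 - c))).mono'
    (Continuous.aestronglyMeasurable ?_) (.of_forall fun x => ?_)
  · exact continuous_const.div (continuous_quad c) fun x => (quad_pos h0 h1 x).ne'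
  · have hq := quad_pos h0 h1 x
    rw [Real.norm_of_nonneg (by positivity), ← one_div, one_div_mul_one_div]
    have : 0 < 1 - c := by linarith
    exact one_div_le_one_div_of_le (by positivity) (quad_ge h0 x)

lemma continuous_moment {c : ℝ} (h0 : 0 ≤ c) (h1 : c < 1) (r k : ℕ) :
    Continuous fun x : ℝ => x ^ k / quad c x ^ (r + 1) :=
  (continuous_pow k).div ((continuous_quad c).pow _) fun x => (pow_pos (quad_pos h0 h1 x) _).ne'

lemma abs_pow_le {k r : ℕ} (hk : k ≤ 2 * r) (x : ℝ) : |x| ^ k ≤ (1 + x ^ 2) ^ r := by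
  have h1 : |x| ≤ √(1 + x ^ 2) := Real.abs_le_sqrt (by linarith)
  have h2 : 1 ≤ √(1 + x ^ 2) := by rw [Real.one_le_sqrt]; nlinarith
  calc |x| ^ k ≤ √(1 + x ^ 2) ^ k := by gcongr
    _ ≤ √(1 + x ^ 2) ^ (2 * r) := pow_le_pow_right₀ h2 hk
    _ = (1 + x ^ 2) ^ r := by rw [pow_mul, Real.sq_sqrt (by positivity)]

lemma norm_moment_le {c : ℝ} (h0 : 0 ≤ c) (h1 : c < 1) {r k : ℕ} (hk : k ≤ 2 * r) (x : ℝ) :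
    ‖x ^ k / quad c x ^ r‖ ≤ (1 / (1 - c)) ^ r := by
  have hq := quad_pos h0 h1 x
  have hc : 0 < 1 - c := by linarith
  rw [norm_div, norm_pow, norm_pow, Real.norm_eq_abs, Real.norm_of_nonneg hq.le,
    div_le_iff₀ (by positivity), ← mul_pow]
  refine (abs_pow_le hk x).trans ?_
  gcongr
  rw [one_div, ← div_eq_inv_mul, le_div_iff₀ hc, mul_comm]
  exact quad_ge h0 x

lemma integrable_moment {c : ℝ} (h0 : 0 ≤ c) (h1 : c < 1) {r k : ℕ} (hk : k ≤ 2 * r) :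
    MeasureTheory.Integrable fun x : ℝ => x ^ k / quad c x ^ (r + 1) := by
  refine ((integrable_inv_quad h0 h1).const_mul ((1 / (1 - c)) ^ r)).mono'
    (continuous_moment h0 h1 r k).aestronglyMeasurable (.of_forall fun x => ?_)
  have hq := quad_pos h0 h1 x
  rw [pow_succ, ← div_div, norm_div, Real.norm_of_nonneg hq.le, div_eq_mul_one_div]
  gcongr
  exact norm_moment_le h0 h1 hk x

lemma tendsto_moment {c : ℝ} (h0 : 0 ≤ c) (h1 : c < 1) {r k : ℕ} (hk : k < 2 * r) :
    Tendsto (fun x : ℝ => x ^ k / quad c x ^ r) (cocompact ℝ) (𝓝 0) := by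
  have hc : 0 < 1 - c := by linarith
  have hb : ∀ x : ℝ, x ≠ 0 → ‖x ^ k / quad c x ^ r‖ ≤ (1 / (1 - c)) ^ r * ‖x‖⁻¹ := by
    intro x hx
    have := norm_moment_le h0 h1 (Nat.succ_le_of_lt hk) x
    rw [Nat.succ_eq_add_one, pow_succ, mul_div_right_comm, norm_mul] at this
    rwa [← div_eq_mul_inv, le_div_iff₀ (norm_pos_iff.2 hx)]
  refine squeeze_zero_norm' (a := fun x : ℝ => (1 / (1 - c)) ^ r * ‖x‖⁻¹) ?_ ?_
  · filter_upwards [(isCompact_singleton (x := (0 : ℝ))).compl_mem_cocompact] with x hx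
    exact hb x hx
  · rw [show (0 : ℝ) = (1 / (1 - c)) ^ r * 0 by simp]
    exact (tendsto_inv_atTop_zero.comp (tendsto_norm_cocompact_atTop)).const_mul _

/-- Integration by parts: the derivative of `x ^ k / quad c x ^ r` integrates to zero. -/
lemma momentIntegral_recursion {c : ℝ} (h0 : 0 ≤ c) (h1 : c < 1) {r k : ℕ} (hk : 1 ≤ k)
    (hkr : k < 2 * r) :
    k * (momentIntegral c r (k - 1) - c * momentIntegral c r k) =
      (((2 * r : ℕ) : ℝ) - k) * (momentIntegral c r (k + 1) - c * momentIntegral c r k) := by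
  obtain ⟨k, rfl⟩ : ∃ j, k = j + 1 := ⟨k - 1, by omega⟩
  obtain ⟨r, rfl⟩ : ∃ j, r = j + 1 := ⟨r - 1, by omega⟩
  have hder : ∀ x : ℝ, HasDerivAt (fun x => x ^ (k + 1) / quad c x ^ (r + 1))
      (((k + 1 : ℕ) : ℝ) * (x ^ k / quad c x ^ (r + 1 + 1) -
          c * (x ^ (k + 1) / quad c x ^ (r + 1 + 1))) -
        (((2 * (r + 1) : ℕ) : ℝ) - (k + 1 : ℕ)) * (x ^ (k + 1 + 1) / quad c x ^ (r + 1 + 1) -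
          c * (x ^ (k + 1) / quad c x ^ (r + 1 + 1)))) x := by
    intro x
    have hq := (quad_pos h0 h1 x).ne'
    refine ((hasDerivAt_pow (k + 1) x).div ((hasDerivAt_quad c x).pow (r + 1))
      (pow_ne_zero _ hq)).congr_deriv ?_
    have hq' : quad c x = x ^ 2 - 2 * c * x + 1 := rfl
    refine sub_eq_zero.1 ?_
    simp only [Nat.add_sub_cancel, Pi.pow_apply]
    field_simp
    push_cast
    rw [hq']
    ring
  have i0 := integrable_moment h0 h1 (r := r + 1) (k := k) (by omega)
  have i1 := integrable_moment h0 h1 (r := r + 1) (k := k + 1) (by omega)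
  have i2 := integrable_moment h0 h1 (r := r + 1) (k := k + 1 + 1) (by omega)
  have j1 := i1.const_mul c
  have j0 := (i0.sub' j1).const_mul ((k + 1 : ℕ) : ℝ)
  have j2 := (i2.sub' j1).const_mul (((2 * (r + 1) : ℕ) : ℝ) - (k + 1 : ℕ))
  have ht := tendsto_moment h0 h1 hkr
  have := MeasureTheory.integral_of_hasDerivAt_of_tendsto hder (j0.sub' j2)
    (ht.mono_left atBot_le_cocompact) (ht.mono_left atTop_le_cocompact)
  rw [MeasureTheory.integral_sub j0 j2, MeasureTheory.integral_const_mul,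
    MeasureTheory.integral_const_mul, MeasureTheory.integral_sub i0 (i1.const_mul c),
    MeasureTheory.integral_sub i2 (i1.const_mul c), MeasureTheory.integral_const_mul] at this
  unfold momentIntegral
  simp only [Nat.add_sub_cancel]
  linarith

lemma momentIntegral_one {c : ℝ} (h0 : 0 ≤ c) (h1 : c < 1) {r : ℕ} (hr : 0 < r) :
    momentIntegral c r 1 = c * momentIntegral c r 0 := by
  obtain ⟨r, rfl⟩ : ∃ j, r = j + 1 := ⟨r - 1, by omega⟩
  have hder : ∀ x : ℝ, HasDerivAt (fun x => x ^ 0 / quad c x ^ (r + 1))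
      ((-(2 * (r + 1 : ℕ) : ℝ)) * (x ^ 1 / quad c x ^ (r + 1 + 1) -
          c * (x ^ 0 / quad c x ^ (r + 1 + 1)))) x := by
    intro x
    have hq := (quad_pos h0 h1 x).ne'
    refine ((hasDerivAt_pow 0 x).div ((hasDerivAt_quad c x).pow (r + 1))
      (pow_ne_zero _ hq)).congr_deriv ?_
    refine sub_eq_zero.1 ?_
    simp only [Nat.add_sub_cancel, Pi.pow_apply]
    field_simp
    push_cast
    ring
  have i0 := integrable_moment h0 h1 (r := r + 1) (k := 0) (by omega)
  have i1 := integrable_moment h0 h1 (r := r + 1) (k := 1) (by omega)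
  have ht := tendsto_moment h0 h1 (r := r + 1) (k := 0) (by omega)
  have := MeasureTheory.integral_of_hasDerivAt_of_tendsto hder
    ((i1.sub (i0.const_mul c)).const_mul _)
    (ht.mono_left atBot_le_cocompact) (ht.mono_left atTop_le_cocompact)
  rw [MeasureTheory.integral_const_mul, MeasureTheory.integral_sub i1 (i0.const_mul c),
    MeasureTheory.integral_const_mul, sub_zero, mul_eq_zero] at this
  rcases this with h | h
  · have : (0 : ℝ) < 2 * (r + 1 : ℕ) := by positivity
    linarith
  · unfold momentIntegral; linarith

lemma momentIntegral_zero_pos {c : ℝ} (h0 : 0 ≤ c) (h1 : c < 1) (r : ℕ) :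
    0 < momentIntegral c r 0 := by
  have hp : ∀ x : ℝ, 0 < x ^ 0 / quad c x ^ (r + 1) := fun x => by
    have := quad_pos h0 h1 x
    positivity
  unfold momentIntegral
  rw [MeasureTheory.integral_pos_iff_support_of_nonneg (fun x => (hp x).le)
    (integrable_moment h0 h1 (by omega))]
  have : Function.support (fun x : ℝ => x ^ 0 / quad c x ^ (r + 1)) = univ := by
    ext x; simp [(quad_pos h0 h1 x).ne']
  rw [this]; simp

/-! ### The annealed weights -/

section Hamiltonian

variable {n : ℕ} {D : Fin n → ℕ}

lemma sum_Ici_ite_eq (f : Fin n → ℝ) (z : Sym2 (Fin n)) {a b : Fin n} (hz : z = s(a, b)) :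
    ∑ i, ∑ j ∈ Finset.Ici i, (if z = s(i, j) then f i * f j else 0) = f a * f b := by
  wlog hab : a ≤ b generalizing a b
  · rw [this (hz.trans Sym2.eq_swap) (le_of_not_ge hab), mul_comm]
  rw [Finset.sum_eq_single a]
  · rw [Finset.sum_eq_single b]
    · simp [hz]
    · intro j _ hj
      rw [if_neg]
      intro h
      rcases Sym2.eq_iff.1 (hz.symm.trans h) with h | h
      · exact hj h.2.symm
      · exact hj (h.1 ▸ h.2 ▸ rfl)
    · intro h; exact absurd (Finset.mem_Ici.2 hab) h
  · intro i _ hi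
    refine Finset.sum_eq_zero fun j hj => if_neg ?_
    intro h
    rcases Sym2.eq_iff.1 (hz.symm.trans h) with h | h
    · exact hi h.1.symm
    · rw [Finset.mem_Ici, ← h.1, ← h.2] at hj
      exact hi (h.2 ▸ le_antisymm hj hab)
  · simp

lemma card_filter_edge_eq_two (π : Matching D) (h : HalfEdge D) :
    (Finset.univ.filter fun k => s(k, π.1 k) = s(h, π.1 h)).card = 2 := by
  have : (Finset.univ.filter fun k => s(k, π.1 k) = s(h, π.1 h)) = {h, π.1 h} := by
    ext k
    simp only [Finset.mem_filter, Finset.mem_univ, true_and, Finset.mem_insert,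
      Finset.mem_singleton, Sym2.eq_iff]
    constructor
    · tauto
    · rintro (rfl | rfl)
      · simp
      · simp [(π.2 h).1]
  rw [this, Finset.card_pair (π.2 h).2.symm]

/-- Summing over edges is half of summing over half-edges. -/
lemma two_mul_sum_edgeCount (π : Matching D) (f : Fin n → ℝ) :
    2 * ∑ i, ∑ j ∈ Finset.Ici i, (edgeCount π i j : ℝ) * f i * f j =
      ∑ h : HalfEdge D, f h.1 * f (π.1 h).1 := by
  have h1 : ∑ i, ∑ j ∈ Finset.Ici i, (edgeCount π i j : ℝ) * f i * f j =
      ∑ e ∈ edges π, ∑ i, ∑ j ∈ Finset.Ici i,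
        (if e.map Sigma.fst = s(i, j) then f i * f j else 0) := by
    rw [Finset.sum_comm]
    refine Finset.sum_congr rfl fun i _ => ?_
    rw [Finset.sum_comm]
    refine Finset.sum_congr rfl fun j _ => ?_
    rw [← Finset.sum_filter, Finset.sum_const, nsmul_eq_mul, edgeCount, mul_assoc]
  rw [h1]
  have h2 := Finset.sum_comp (s := Finset.univ) (fun e : Sym2 (HalfEdge D) => ∑ i,
    ∑ j ∈ Finset.Ici i, (if e.map Sigma.fst = s(i, j) then f i * f j else 0))
    (fun h : HalfEdge D => s(h, π.1 h))
  rw [Finset.mul_sum]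
  rw [← Finset.sum_congr rfl fun h _ => sum_Ici_ite_eq f (Sym2.map Sigma.fst s(h, π.1 h)) rfl, h2]
  refine Finset.sum_congr rfl fun e he => ?_
  obtain ⟨h, -, rfl⟩ := Finset.mem_image.1 he
  rw [card_filter_edge_eq_two]
  simp

lemma neg_hamiltonian_eq (β B : ℝ) (π : Matching D) (σ : Spins n) :
    -hamiltonian β B π σ = B * totalSpin σ +
      β / 2 * ∑ h : HalfEdge D, spin σ h.1 * spin σ (π.1 h).1 := by
  rw [← two_mul_sum_edgeCount, hamiltonian, totalSpin]
  ring

/-- The number of half-edges attached to plus spins. -/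
def plusDegree (D : Fin n → ℕ) (σ : Spins n) : ℕ := ∑ i, if σ i = 1 then D i else 0

lemma spin_eq (σ : Spins n) (i : Fin n) : spin σ i = if σ i = 1 then 1 else -1 := by
  rcases Int.units_eq_one_or (σ i) with h | h <;> simp [spin, h]

lemma spin_eq_signOf (σ : Spins n) (h : HalfEdge D) :
    spin σ h.1 = signOf (Finset.univ.filter fun h : HalfEdge D => σ h.1 = 1) h := by
  simp [spin_eq, signOf]

lemma card_filter_plus (σ : Spins n) :
    (Finset.univ.filter fun h : HalfEdge D => σ h.1 = 1).card = plusDegree D σ := by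
  rw [plusDegree, Finset.card_filter, Fintype.sum_sigma]
  refine Finset.sum_congr rfl fun i _ => ?_
  split_ifs with h <;> simp

lemma plusDegree_le (σ : Spins n) : plusDegree D σ ≤ ∑ i, D i :=
  Finset.sum_le_sum fun i _ => by split_ifs <;> simp

lemma sum_exp_neg_hamiltonian (β B : ℝ) (σ : Spins n) :
    ∑ π : Matching D, Real.exp (-hamiltonian β B π σ) = Real.exp (B * totalSpin σ) *
      matchWeight β (signOf (Finset.univ.filter fun h : HalfEdge D => σ h.1 = 1)) := by
  rw [matchWeight, Finset.mul_sum]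
  refine Finset.sum_congr rfl fun π _ => ?_
  rw [neg_hamiltonian_eq, Real.exp_add]
  simp only [spin_eq_signOf (D := D)]

/-- The annealed weight of a spin configuration only involves the moment integral of order
`plusDegree D σ`. -/
lemma graphExpect_exp_neg_hamiltonian {β : ℝ} (hβ : 0 < β) (B : ℝ) {r : ℕ}
    (hr : ∑ i, D i = 2 * r) (σ : Spins n) :
    graphExpect D (fun π => Real.exp (-hamiltonian β B π σ)) =
      Real.exp (β * r) / momentIntegral (Real.exp (-2 * β)) r 0 *
        (Real.exp (B * totalSpin σ) *
          momentIntegral (Real.exp (-2 * β)) r (plusDegree D σ)) := by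
  have hcard : Fintype.card (HalfEdge D) = 2 * r := by simp [hr]
  have hc0 : 0 ≤ Real.exp (-2 * β) := (Real.exp_pos _).le
  have hc1 : Real.exp (-2 * β) < 1 := by rw [Real.exp_lt_one_iff]; linarith
  have hM : (Fintype.card (Matching D) : ℝ) ≠ 0 := by
    have := nonempty_perfectMatching (γ := HalfEdge D) (by rw [hcard]; exact even_two_mul r)
    exact_mod_cast Fintype.card_ne_zero
  have key := matchWeight_signOf_eq β (momentIntegral (Real.exp (-2 * β)) r)
    (fun h => momentIntegral_one hc0 hc1 (by omega))
    (fun k hk hk' => by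
      rw [hcard] at hk' ⊢
      exact momentIntegral_recursion hc0 hc1 hk hk')
    (Finset.univ.filter fun h : HalfEdge D => σ h.1 = 1)
  rw [card_filter_plus, matchWeight_signOf_empty, hcard] at key
  have hJ := (momentIntegral_zero_pos hc0 hc1 r).ne'
  rw [graphExpect, sum_exp_neg_hamiltonian, eq_div_of_mul_eq hJ key]
  have : β / 2 * ((2 * r : ℕ) : ℝ) = β * r := by push_cast; ring
  rw [this]
  field_simp

lemma graphExpect_exp_neg_hamiltonian_zero (B : ℝ) (hD : Even (∑ i, D i)) (σ : Spins n) :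
    graphExpect D (fun π => Real.exp (-hamiltonian 0 B π σ)) = Real.exp (B * totalSpin σ) := by
  have hM : (Fintype.card (Matching D) : ℝ) ≠ 0 := by
    have := nonempty_perfectMatching (γ := HalfEdge D) (by simpa using hD)
    exact_mod_cast Fintype.card_ne_zero
  simp only [graphExpect, neg_hamiltonian_eq]
  simp [hM]

lemma graphExpect_partitionFunction (β B : ℝ) :
    graphExpect D (fun π => partitionFunction β B π) =
      ∑ σ : Spins n, graphExpect D (fun π => Real.exp (-hamiltonian β B π σ)) := by
  simp only [graphExpect, partitionFunction]
  rw [Finset.sum_comm, Finset.sum_div]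

/-- The sum over spin configurations of `X`, weighted by independent factors: `exp (± B)` for every
spin and `x ^ D i` for every plus spin. -/
def spinSum (D : Fin n → ℕ) (B : ℝ) (X : Spins n → ℝ) (x : ℝ) : ℝ :=
  ∑ σ : Spins n, X σ * (Real.exp (B * totalSpin σ) * x ^ plusDegree D σ)

/-- The total weight of one spin at a vertex of degree `D`. -/
def siteWeight (B : ℝ) (D : ℕ) (x : ℝ) : ℝ := Real.exp B * x ^ D + Real.exp (-B)

/-- The mean of one spin at a vertex of degree `D`. -/
def siteMean (B : ℝ) (D : ℕ) (x : ℝ) : ℝ :=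
  (Real.exp B * x ^ D - Real.exp (-B)) / siteWeight B D x

lemma spinSum_one (D : Fin n → ℕ) (B x : ℝ) :
    spinSum D B (fun _ => 1) x = ∏ i, siteWeight B (D i) x := by
  have h1 : ∀ i, siteWeight B (D i) x =
      ∑ s : ℤˣ, Real.exp (B * ((s : ℤ) : ℝ)) * x ^ (if s = 1 then D i else 0) := by
    intro i
    rw [UnitsInt.univ]
    simp [siteWeight]
  simp only [h1]
  rw [Finset.prod_univ_sum, Fintype.piFinset_univ, spinSum]
  refine Finset.sum_congr rfl fun σ _ => ?_
  rw [Finset.prod_mul_distrib, ← Real.exp_sum, Finset.prod_pow_eq_pow_sum, one_mul, totalSpin,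
    Finset.mul_sum, plusDegree]
  rfl

/-- Differentiating in the field inserts a factor of the total spin; this gives its moments from the
product formula for `spinSum D B (fun _ => 1)`. -/
lemma hasDerivAt_spinSum (D : Fin n → ℕ) (B : ℝ) (X : Spins n → ℝ) (x : ℝ) :
    HasDerivAt (fun B => spinSum D B X x) (spinSum D B (fun σ => X σ * totalSpin σ) x) B := by
  unfold spinSum
  refine HasDerivAt.fun_sum fun σ _ => ?_
  have := ((((hasDerivAt_id' B).mul_const (totalSpin σ)).exp).mul_const
    (x ^ plusDegree D σ)).const_mul (X σ)
  refine this.congr_deriv ?_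
  ring

lemma siteWeight_pos (B : ℝ) (D : ℕ) {x : ℝ} (hx : 0 ≤ x) : 0 < siteWeight B D x := by
  unfold siteWeight; positivity

lemma hasDerivAt_siteWeight (B : ℝ) (D : ℕ) {x : ℝ} (hx : 0 ≤ x) :
    HasDerivAt (fun B => siteWeight B D x) (siteWeight B D x * siteMean B D x) B := by
  have := ((Real.hasDerivAt_exp B).mul_const (x ^ D)).add (hasDerivAt_neg B).exp
  refine this.congr_deriv ?_
  rw [siteMean, mul_div_cancel₀ _ (siteWeight_pos B D hx).ne']
  ring

lemma hasDerivAt_siteMean (B : ℝ) (D : ℕ) {x : ℝ} (hx : 0 ≤ x) :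
    HasDerivAt (fun B => siteMean B D x) (1 - siteMean B D x ^ 2) B := by
  have h1 := ((Real.hasDerivAt_exp B).mul_const (x ^ D)).sub (hasDerivAt_neg B).exp
  have hw := (siteWeight_pos B D hx).ne'
  refine (h1.div (hasDerivAt_siteWeight B D hx) hw).congr_deriv ?_
  simp only [siteMean]
  field_simp
  simp only [siteWeight, Pi.sub_apply]
  ring

lemma spinSum_totalSpin (D : Fin n → ℕ) (B : ℝ) {x : ℝ} (hx : 0 ≤ x) :
    spinSum D B totalSpin x = (∏ i, siteWeight B (D i) x) * ∑ i, siteMean B (D i) x := by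
  have h1 := hasDerivAt_spinSum D B (fun _ => 1) x
  simp only [spinSum_one, one_mul] at h1
  have h2 := HasDerivAt.fun_finsetProd (u := Finset.univ)
    fun i (_ : i ∈ Finset.univ) => hasDerivAt_siteWeight B (D i) hx
  refine (h1.unique h2).trans ?_
  rw [Finset.mul_sum]
  refine Finset.sum_congr rfl fun i _ => ?_
  rw [smul_eq_mul, ← mul_assoc, Finset.prod_erase_mul _ _ (Finset.mem_univ i)]

lemma spinSum_totalSpin_sq (D : Fin n → ℕ) (B : ℝ) {x : ℝ} (hx : 0 ≤ x) :
    spinSum D B (fun σ => totalSpin σ * totalSpin σ) x = (∏ i, siteWeight B (D i) x) *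
      ((∑ i, siteMean B (D i) x) ^ 2 + ∑ i, (1 - siteMean B (D i) x ^ 2)) := by
  have h1 := hasDerivAt_spinSum D B totalSpin x
  have h0 := hasDerivAt_spinSum D B (fun _ => 1) x
  simp only [spinSum_totalSpin D _ hx, spinSum_one, one_mul] at h1 h0
  have h2 := HasDerivAt.fun_sum (u := Finset.univ)
    fun i (_ : i ∈ Finset.univ) => hasDerivAt_siteMean B (D i) hx
  refine (h1.unique (h0.mul h2)).trans ?_
  ring

lemma spinSum_sub (D : Fin n → ℕ) (B a : ℝ) {x : ℝ} (hx : 0 ≤ x) :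
    spinSum D B (fun σ => totalSpin σ - a) x =
      (∏ i, siteWeight B (D i) x) * (∑ i, siteMean B (D i) x - a) := by
  rw [mul_sub, ← spinSum_totalSpin D B hx, ← spinSum_one]
  simp only [spinSum, Finset.sum_mul, ← Finset.sum_sub_distrib]
  exact Finset.sum_congr rfl fun σ _ => by ring

lemma spinSum_sub_sq (D : Fin n → ℕ) (B a : ℝ) {x : ℝ} (hx : 0 ≤ x) :
    spinSum D B (fun σ => (totalSpin σ - a) ^ 2) x = (∏ i, siteWeight B (D i) x) *
      ((∑ i, siteMean B (D i) x - a) ^ 2 + ∑ i, (1 - siteMean B (D i) x ^ 2)) := by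
  have h : spinSum D B (fun σ => (totalSpin σ - a) ^ 2) x =
      spinSum D B (fun σ => totalSpin σ * totalSpin σ) x - 2 * a * spinSum D B totalSpin x +
        a ^ 2 * spinSum D B (fun _ => 1) x := by
    simp only [spinSum, Finset.mul_sum, ← Finset.sum_sub_distrib, ← Finset.sum_add_distrib]
    exact Finset.sum_congr rfl fun σ _ => by ring
  rw [h, spinSum_totalSpin_sq D B hx, spinSum_totalSpin D B hx, spinSum_one]
  ring

lemma abs_totalSpin_le (σ : Spins n) : |totalSpin σ| ≤ n := by
  refine (Finset.abs_sum_le_sum_abs _ _).trans ?_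
  have : ∀ i, |spin σ i| = 1 := fun i => by rw [spin_eq]; split_ifs <;> simp
  simp [this]

lemma abs_spinSum_le (D : Fin n → ℕ) (B : ℝ) {X : Spins n → ℝ} {K : ℝ} (hX : ∀ σ, |X σ| ≤ K)
    (x : ℝ) : |spinSum D B X x| ≤ K * ∏ i, siteWeight B (D i) |x| := by
  rw [← spinSum_one, spinSum, spinSum, Finset.mul_sum]
  refine (Finset.abs_sum_le_sum_abs _ _).trans (Finset.sum_le_sum fun σ _ => ?_)
  rw [abs_mul, abs_mul, abs_pow, Real.abs_exp, one_mul]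
  gcongr
  exact hX σ

lemma integral_spinSum {c : ℝ} (h0 : 0 ≤ c) (h1 : c < 1) {r : ℕ} (hr : ∑ i, D i = 2 * r) (B : ℝ)
    (X : Spins n → ℝ) :
    ∫ x : ℝ, spinSum D B X x / quad c x ^ (r + 1) =
      ∑ σ, X σ * (Real.exp (B * totalSpin σ) * momentIntegral c r (plusDegree D σ)) := by
  have : ∀ x : ℝ, spinSum D B X x / quad c x ^ (r + 1) =
      ∑ σ, X σ * Real.exp (B * totalSpin σ) * (x ^ plusDegree D σ / quad c x ^ (r + 1)) := by
    intro x
    rw [spinSum, Finset.sum_div]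
    exact Finset.sum_congr rfl fun σ _ => by ring
  simp only [this]
  rw [MeasureTheory.integral_finsetSum]
  · refine Finset.sum_congr rfl fun σ _ => ?_
    rw [MeasureTheory.integral_const_mul, momentIntegral, mul_assoc]
  · intro σ _
    exact (integrable_moment h0 h1 (hr ▸ plusDegree_le σ)).const_mul _

/-- The annealed partition function as a one-dimensional integral. -/
lemma graphExpect_partitionFunction_eq_integral {β : ℝ} (hβ : 0 < β) (B : ℝ) {r : ℕ}
    (hr : ∑ i, D i = 2 * r) :
    graphExpect D (fun π => partitionFunction β B π) =
      Real.exp (β * r) / momentIntegral (Real.exp (-2 * β)) r 0 *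
        ∫ x : ℝ, spinSum D B (fun _ => 1) x / quad (Real.exp (-2 * β)) x ^ (r + 1) := by
  have hc1 : Real.exp (-2 * β) < 1 := by rw [Real.exp_lt_one_iff]; linarith
  rw [graphExpect_partitionFunction, integral_spinSum (Real.exp_pos _).le hc1 hr, Finset.mul_sum]
  exact Finset.sum_congr rfl fun σ _ => by
    rw [graphExpect_exp_neg_hamiltonian hβ B hr, one_mul]

/-- Annealed expectations as quotients of one-dimensional integrals. -/
lemma annealedExpect_eq_integral {β : ℝ} (hβ : 0 < β) (B : ℝ) {r : ℕ}
    (hr : ∑ i, D i = 2 * r) (X : Spins n → ℝ) :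
    annealedExpect D β B X =
      (∫ x : ℝ, spinSum D B X x / quad (Real.exp (-2 * β)) x ^ (r + 1)) /
        ∫ x : ℝ, spinSum D B (fun _ => 1) x / quad (Real.exp (-2 * β)) x ^ (r + 1) := by
  have hc1 : Real.exp (-2 * β) < 1 := by rw [Real.exp_lt_one_iff]; linarith
  have hJ := momentIntegral_zero_pos (Real.exp_pos _).le hc1 r
  have hK : Real.exp (β * r) / momentIntegral (Real.exp (-2 * β)) r 0 ≠ 0 := by positivity
  rw [annealedExpect, integral_spinSum (Real.exp_pos _).le hc1 hr, Finset.sum_div]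
  refine Finset.sum_congr rfl fun σ _ => ?_
  rw [annealedWeight, graphExpect_partitionFunction_eq_integral hβ B hr,
    graphExpect_exp_neg_hamiltonian hβ B hr, mul_div_mul_left _ _ hK]
  ring

end Hamiltonian

/-! ### Laplace's method -/

open MeasureTheory in
/-- Laplace's method, by dominated convergence after rescaling around `x₀` by `√n`: the integrands
are dominated by a Gaussian near `x₀`, and contribute nothing in the limit away from `x₀`. -/
lemma tendsto_sqrt_mul_integral {P : ℕ → ℝ → ℝ} {A w : ℝ → ℝ} {E : ℕ → ℝ} {x₀ δ a C : ℝ}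
    (ha : 0 < a) (hint : ∀ᶠ n in atTop, Integrable (P n)) (hw : Integrable w)
    (hnear : ∀ᶠ n : ℕ in atTop, ∀ x, |x - x₀| < δ →
      |P n x| ≤ C * (1 + n * (x - x₀) ^ 2) * Real.exp (-(a * (n * (x - x₀) ^ 2))))
    (hfar : ∀ᶠ n in atTop, ∀ x, δ ≤ |x - x₀| → |P n x| ≤ E n * w x)
    (hE : Tendsto (fun n : ℕ => √n * E n) atTop (𝓝 0)) (hδ : 0 < δ)
    (hlim : ∀ y, Tendsto (fun n : ℕ => P n (x₀ + y / √n)) atTop (𝓝 (A y))) :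
    Tendsto (fun n : ℕ => √n * ∫ x, P n x) atTop (𝓝 (∫ y, A y)) := by
  set S : Set ℝ := {x | |x - x₀| < δ} with hS
  have hSm : MeasurableSet S := measurableSet_lt (by fun_prop) measurable_const
  have hfar0 : Tendsto (fun n : ℕ => √n * ∫ x in Sᶜ, P n x) atTop (𝓝 0) := by
    have hb : Tendsto (fun n : ℕ => |√n * E n| * ∫ x, |w x|) atTop (𝓝 0) := by
      simpa using hE.abs.mul_const (∫ x, |w x|)
    refine squeeze_zero_norm' ?_ hb
    filter_upwards [hfar, hint] with n hn hi
    rw [norm_mul, abs_mul, mul_assoc, Real.norm_eq_abs]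
    refine mul_le_mul_of_nonneg_left ?_ (abs_nonneg _)
    rw [← integral_const_mul]
    have hwi : Integrable fun x => |E n| * |w x| := hw.abs.const_mul _
    calc ‖∫ x in Sᶜ, P n x‖ ≤ ∫ x in Sᶜ, |E n| * |w x| := by
          refine norm_integral_le_of_norm_le hwi.integrableOn ?_
          filter_upwards [ae_restrict_mem hSm.compl] with x hx
          rw [← abs_mul]
          refine (hn x ?_).trans (le_abs_self _)
          simpa [hS] using hx
      _ ≤ ∫ x, |E n| * |w x| :=
          setIntegral_le_integral hwi (.of_forall fun x => by positivity)
  have hscale : ∀ᶠ n : ℕ in atTop, √n * ∫ x, P n x =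
      (∫ y, S.indicator (P n) (x₀ + y / √n)) + √n * ∫ x in Sᶜ, P n x := by
    filter_upwards [hint, eventually_gt_atTop 0] with n hi hn
    rw [← integral_add_compl hSm hi, mul_add, ← integral_indicator hSm]
    congr 1
    rw [Measure.integral_comp_div (fun y => S.indicator (P n) (x₀ + y)),
      integral_add_left_eq_self, abs_of_nonneg (Real.sqrt_nonneg _), smul_eq_mul]
  rw [← add_zero (∫ y, A y)]
  refine Tendsto.congr' (hscale.mono fun n h => h.symm) (Tendsto.add ?_ hfar0)
  have hsq : ∀ (n : ℕ) (y : ℝ), 0 < n → n * (y / √n) ^ 2 = y ^ 2 := by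
    intro n y hn
    have : (0 : ℝ) < n := by exact_mod_cast hn
    rw [div_pow, Real.sq_sqrt this.le]
    field_simp
  have hC : 0 ≤ C := by
    obtain ⟨n, hn⟩ := hnear.exists
    have := hn x₀ (by simpa using hδ)
    simp only [sub_self, ne_eq, OfNat.ofNat_ne_zero, not_false_eq_true, zero_pow, mul_zero,
      add_zero, mul_one, neg_zero, Real.exp_zero] at this
    exact (abs_nonneg _).trans this
  refine tendsto_integral_filter_of_dominated_convergence
    (fun y => C * (1 + y ^ 2) * Real.exp (-a * y ^ 2)) ?_ ?_ ?_ ?_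
  · filter_upwards [hint, eventually_gt_atTop 0] with n hi hn
    have hne : √(n : ℝ) ≠ 0 := by positivity
    have := (hi.indicator hSm).comp_add_left x₀
    exact (this.comp_div hne).aestronglyMeasurable
  · filter_upwards [hnear, eventually_gt_atTop 0] with n hn hn0
    refine .of_forall fun y => ?_
    by_cases hy : x₀ + y / √n ∈ S
    · rw [indicator_of_mem hy]
      have := hn _ hy
      rw [add_sub_cancel_left, hsq n y hn0] at this
      rwa [neg_mul]
    · rw [indicator_of_notMem hy, norm_zero]; positivity
  · have h1 := integrable_exp_neg_mul_sq ha
    have h2 := integrable_rpow_mul_exp_neg_mul_sq ha (s := 2) (by norm_num)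
    refine ((h1.add h2).const_mul C).congr (.of_forall fun y => ?_)
    simp only [Pi.add_apply, Real.rpow_two]
    ring
  · refine .of_forall fun y => ?_
    refine (hlim y).congr' ?_
    have : Tendsto (fun n : ℕ => y / √(n : ℝ)) atTop (𝓝 0) :=
      (Real.tendsto_sqrt_atTop.comp tendsto_natCast_atTop_atTop).const_div_atTop y
    have := (this.abs).eventually_lt_const (show |(0 : ℝ)| < δ by simpa using hδ)
    filter_upwards [this] with n hn
    rw [indicator_of_mem]
    simpa [hS] using hn

open MeasureTheory in
lemma integral_id_mul_gaussian {b : ℝ} (hb : 0 < b) : ∫ y : ℝ, y * Real.exp (-b * y ^ 2) = 0 := by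
  have h1 := integrable_exp_neg_mul_sq hb
  have h2 := integrable_mul_exp_neg_mul_sq hb
  have := integral_eq_zero_of_hasDerivAt_of_integrable
    (f := fun y : ℝ => Real.exp (-b * y ^ 2))
    (f' := fun y => (-b * 2) * (y * Real.exp (-b * y ^ 2)))
    (fun y => by
      refine (((hasDerivAt_pow 2 y).const_mul (-b)).exp).congr_deriv ?_
      push_cast; ring) (h2.const_mul _) h1
  rw [integral_const_mul] at this
  rcases mul_eq_zero.1 this with h | h
  · linarith
  · exact h

open MeasureTheory in
lemma integral_sq_mul_gaussian {b : ℝ} (hb : 0 < b) :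
    ∫ y : ℝ, y ^ 2 * Real.exp (-b * y ^ 2) = 1 / (2 * b) * ∫ y : ℝ, Real.exp (-b * y ^ 2) := by
  have h1 := integrable_exp_neg_mul_sq hb
  have h2 := integrable_mul_exp_neg_mul_sq hb
  have h3 : Integrable fun y : ℝ => y ^ 2 * Real.exp (-b * y ^ 2) := by
    simpa only [Real.rpow_two] using
      integrable_rpow_mul_exp_neg_mul_sq hb (s := 2) (by norm_num)
  have := integral_eq_zero_of_hasDerivAt_of_integrable
    (f := fun y : ℝ => y * Real.exp (-b * y ^ 2))
    (f' := fun y => Real.exp (-b * y ^ 2) - 2 * b * (y ^ 2 * Real.exp (-b * y ^ 2)))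
    (fun y => by
      refine ((hasDerivAt_id' y).mul ((hasDerivAt_pow 2 y).const_mul (-b)).exp).congr_deriv ?_
      push_cast; ring) (h1.sub (h3.const_mul _)) h2
  rw [integral_sub h1 (h3.const_mul _), integral_const_mul] at this
  rw [one_div, eq_inv_mul_iff_mul_eq₀ (by positivity)]
  linarith

/-- Second-order Taylor expansion, with Peano remainder, at a critical point. -/
lemma eventually_abs_sub_add_sq_le {Φ Φ' : ℝ → ℝ} {x₀ κ : ℝ}
    (hΦ : ∀ᶠ x in 𝓝 x₀, HasDerivAt Φ (Φ' x) x) (hΦ' : HasDerivAt Φ' (-κ) x₀) (h0 : Φ' x₀ = 0)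
    {ε : ℝ} (hε : 0 < ε) :
    ∀ᶠ x in 𝓝 x₀, |Φ x - Φ x₀ + κ / 2 * (x - x₀) ^ 2| ≤ ε * (x - x₀) ^ 2 := by
  have h1 := (hasDerivAt_iff_isLittleO.1 hΦ').def hε
  obtain ⟨δ, hδ, hball⟩ := Metric.eventually_nhds_iff_ball.1 (hΦ.and h1)
  filter_upwards [Metric.ball_mem_nhds x₀ hδ] with x hx
  have hsub : Metric.closedBall x₀ |x - x₀| ⊆ Metric.ball x₀ δ :=
    Metric.closedBall_subset_ball (by simpa [Real.dist_eq] using hx)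
  have := (convex_closedBall x₀ |x - x₀|).norm_image_sub_le_of_norm_hasDerivWithin_le
    (f := fun x => Φ x + κ / 2 * (x - x₀) ^ 2) (f' := fun x => Φ' x + κ * (x - x₀))
    (C := ε * |x - x₀|) (x := x₀) (y := x) (fun z hz => ?_) (fun z hz => ?_)
    (Metric.mem_closedBall_self (abs_nonneg _)) (by simp [Real.dist_eq])
  · simp only [sub_self, ne_eq, OfNat.ofNat_ne_zero, not_false_eq_true, zero_pow, mul_zero,
      add_zero, Real.norm_eq_abs] at this
    rw [mul_assoc, abs_mul_abs_self] at this
    rw [show Φ x - Φ x₀ + κ / 2 * (x - x₀) ^ 2 = Φ x + κ / 2 * (x - x₀) ^ 2 - Φ x₀ by ring]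
    linarith [this, sq (x - x₀)]
  · refine ((hball z (hsub hz)).1.add ((((hasDerivAt_id' z).sub_const x₀).pow 2).const_mul
      (κ / 2))).hasDerivWithinAt.congr_deriv ?_
    simp; ring
  · have h2 := (hball z (hsub hz)).2
    rw [h0, sub_zero, smul_eq_mul, Real.norm_eq_abs, Real.norm_eq_abs] at h2
    have h3 : |z - x₀| ≤ |x - x₀| := by simpa [Real.dist_eq] using hz
    rw [Real.norm_eq_abs]
    calc |Φ' z + κ * (z - x₀)| = |Φ' z - (z - x₀) * -κ| := by congr 1; ring
      _ ≤ ε * |z - x₀| := h2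
      _ ≤ ε * |x - x₀| := by gcongr

/-! ### The maximizer of the integrand -/

/-- The factor that a vertex of degree `D` contributes to the integrand. With `|x|` in place of `x`
it is positive, and bounds the absolute value of the factor where `x` is negative. -/
def siteRatio (c B : ℝ) (D : ℕ) (x : ℝ) : ℝ := siteWeight B D |x| / √(quad c x) ^ D

/-- The critical points of `siteRatio c B d` with `c < x` and `c * x < 1` are the solutions
of `critFun c d x = 2 * B`; the function does not depend on `B`. -/
def critFun (c : ℝ) (d : ℕ) (x : ℝ) : ℝ :=
  Real.log ((x - c) / (1 - c * x)) - ((d : ℝ) - 1) * Real.log x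

/-- The derivative of `critFun c d`. -/
def critSlope (c : ℝ) (d : ℕ) (x : ℝ) : ℝ :=
  (1 - c ^ 2) / ((x - c) * (1 - c * x)) - ((d : ℝ) - 1) / x

/-- `x` is the unique maximizer of `siteRatio c B d` on the line with a point at infinity, and it is
nondegenerate. The value at infinity is `exp B`. -/
structure IsRegularMax (c : ℝ) (d : ℕ) (B x : ℝ) : Prop where
  lt_self : c < x
  mul_lt_one : c * x < 1
  critFun_eq : critFun c d x = 2 * B
  critSlope_pos : 0 < critSlope c d x
  siteRatio_lt : ∀ z, z ≠ x → siteRatio c B d z < siteRatio c B d x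
  exp_lt : Real.exp B < siteRatio c B d x

section

variable {c : ℝ} {d : ℕ} {B x : ℝ}

lemma siteRatio_pos (h0 : 0 ≤ c) (h1 : c < 1) (B : ℝ) (D : ℕ) (x : ℝ) :
    0 < siteRatio c B D x := by
  have := quad_pos h0 h1 x
  have := siteWeight_pos B D (abs_nonneg x)
  unfold siteRatio; positivity

lemma continuous_siteRatio (h0 : 0 ≤ c) (h1 : c < 1) (B : ℝ) (D : ℕ) :
    Continuous (siteRatio c B D) := by
  unfold siteRatio siteWeight
  refine Continuous.div (by fun_prop) (((continuous_quad c).sqrt).pow _) fun x => ?_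
  have := quad_pos h0 h1 x
  positivity

lemma quad_inv (c : ℝ) {x : ℝ} (hx : x ≠ 0) : quad c x⁻¹ = quad c x / x ^ 2 := by
  unfold quad; field_simp; ring

/-- Spin flip exchanges `x` with `x⁻¹` and `B` with `-B`. -/
lemma siteRatio_inv (B : ℝ) (D : ℕ) {x : ℝ} (hx : x ≠ 0) :
    siteRatio c (-B) D x⁻¹ = siteRatio c B D x := by
  have hx' : 0 < |x| := abs_pos.2 hx
  rw [siteRatio, siteRatio, quad_inv c hx, Real.sqrt_div' _ (sq_nonneg x), Real.sqrt_sq_eq_abs,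
    div_pow, abs_inv]
  unfold siteWeight
  rw [neg_neg, inv_pow, div_div_eq_mul_div]
  congr 1
  field_simp
  ring

lemma critFun_inv (hx : c < x) (hx0 : 0 < x) (hx1 : c * x < 1) :
    critFun c d x⁻¹ = -critFun c d x := by
  have h1 : (x⁻¹ - c) / (1 - c * x⁻¹) = ((x - c) / (1 - c * x))⁻¹ := by
    have : x - c ≠ 0 := by linarith
    have : 1 - c * x ≠ 0 := by linarith
    rw [inv_div]
    field_simp
  rw [critFun, critFun, h1, Real.log_inv, Real.log_inv]
  ring

lemma critSlope_inv (hx : c < x) (hx0 : 0 < x) (hx1 : c * x < 1) :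
    critSlope c d x⁻¹ = x ^ 2 * critSlope c d x := by
  have : x - c ≠ 0 := by linarith
  have : 1 - c * x ≠ 0 := by linarith
  have h1 : x⁻¹ - c = (1 - c * x) / x := by field_simp
  have h2 : 1 - c * x⁻¹ = (x - c) / x := by field_simp
  rw [critSlope, critSlope, h1, h2]
  field_simp

lemma siteRatio_zero (hd : d ≠ 0) : siteRatio c B d 0 = Real.exp (-B) := by
  simp [siteRatio, siteWeight, quad, hd]

lemma IsRegularMax.pos (h0 : 0 ≤ c) (h : IsRegularMax c d B x) : 0 < x := h0.trans_lt h.lt_self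

/-- The spin flip of a regular maximum. The points `0` and infinity are exchanged, too. -/
lemma IsRegularMax.inv (h0 : 0 ≤ c) (hd : d ≠ 0) (h : IsRegularMax c d B x) :
    IsRegularMax c d (-B) x⁻¹ := by
  have hx := h.pos h0
  have hg := siteRatio_inv (c := c) B d hx.ne'
  refine ⟨?_, ?_, ?_, ?_, fun z hz => ?_, ?_⟩
  · rw [← one_div, lt_div_iff₀ hx]; exact h.mul_lt_one
  · rw [← div_eq_mul_inv, div_lt_one hx]; exact h.lt_self
  · rw [critFun_inv h.lt_self hx h.mul_lt_one, h.critFun_eq]; ring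
  · rw [critSlope_inv h.lt_self hx h.mul_lt_one]
    have := h.critSlope_pos
    positivity
  · rw [hg]
    rcases eq_or_ne z 0 with rfl | hz0
    · rw [siteRatio_zero hd, neg_neg]; exact h.exp_lt
    · have := siteRatio_inv (c := c) B d (inv_ne_zero hz0)
      rw [inv_inv] at this
      rw [this]
      exact h.siteRatio_lt _ fun e => hz (by rw [← e, inv_inv])
  · rw [hg, ← siteRatio_zero (c := c) hd]
    exact h.siteRatio_lt _ hx.ne

/-! ### The derivative of the logarithm of the integrand -/

/-- The logarithm of `siteRatio c B d` on the positive half-line. -/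
def logRatio (c B : ℝ) (d : ℕ) (x : ℝ) : ℝ :=
  Real.log (siteWeight B d x) - (d : ℝ) / 2 * Real.log (quad c x)

/-- The numerator, up to the factor `d`, of the derivative of `logRatio c B d`. -/
def critNum (c B : ℝ) (d : ℕ) (x : ℝ) : ℝ :=
  Real.exp B * x ^ (d - 1) * (1 - c * x) - Real.exp (-B) * (x - c)

/-- The derivative of `logRatio c B d`. -/
def logRatioDeriv (c B : ℝ) (d : ℕ) (x : ℝ) : ℝ :=
  d * critNum c B d x / (siteWeight B d x * quad c x)

lemma siteRatio_eq_exp (h0 : 0 ≤ c) (h1 : c < 1) (hx : 0 < x) :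
    siteRatio c B d x = Real.exp (logRatio c B d x) := by
  have hq := quad_pos h0 h1 x
  have hw := siteWeight_pos B d hx.le
  rw [logRatio, Real.exp_sub, Real.exp_log hw, siteRatio, abs_of_pos hx]
  congr 1
  rw [div_mul_eq_mul_div, mul_div_assoc, ← Real.log_sqrt hq.le, ← Real.log_pow,
    Real.exp_log (by positivity)]

lemma hasDerivAt_siteWeight_right (B : ℝ) (d : ℕ) (x : ℝ) :
    HasDerivAt (siteWeight B d) (Real.exp B * (d * x ^ (d - 1))) x :=
  ((hasDerivAt_pow d x).const_mul _).add_const _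

lemma hasDerivAt_logRatio (h0 : 0 ≤ c) (h1 : c < 1) (hd : d ≠ 0) (hx : 0 < x) :
    HasDerivAt (logRatio c B d) (logRatioDeriv c B d x) x := by
  have hq := (quad_pos h0 h1 x).ne'
  have hw := (siteWeight_pos B d hx.le).ne'
  refine (((hasDerivAt_siteWeight_right B d x).log hw).sub
    (((hasDerivAt_quad c x).log hq).const_mul _)).congr_deriv ?_
  obtain ⟨e, rfl⟩ : ∃ e, d = e + 1 := ⟨d - 1, by omega⟩
  unfold logRatioDeriv
  have hk : critNum c B (e + 1) x =
      Real.exp B * x ^ e * quad c x - (x - c) * siteWeight B (e + 1) x := by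
    simp only [critNum, quad, siteWeight, Nat.add_sub_cancel]; ring
  rw [hk]
  simp only [Nat.add_sub_cancel]
  field_simp

lemma critNum_pos_iff (hd : d ≠ 0) (hx : c < x) (hx0 : 0 < x) (hx1 : c * x < 1) :
    0 < critNum c B d x ↔ critFun c d x < 2 * B := by
  have e1 : 0 < x - c := by linarith
  have e2 : 0 < 1 - c * x := by linarith
  have hd' : ((d : ℝ) - 1) * Real.log x = Real.log (x ^ (d - 1)) := by
    rw [Real.log_pow, Nat.cast_sub (by omega), Nat.cast_one]
  rw [critNum, sub_pos, critFun, hd', sub_lt_iff_lt_add, Real.log_div e1.ne' e2.ne',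
    ← Real.log_lt_log_iff (by positivity) (by positivity), Real.log_mul (Real.exp_pos _).ne' e1.ne',
    Real.log_mul (by positivity) e2.ne', Real.log_mul (Real.exp_pos _).ne' (by positivity),
    Real.log_exp, Real.log_exp]
  constructor <;> intro h <;> linarith

lemma critNum_neg_iff (hd : d ≠ 0) (hx : c < x) (hx0 : 0 < x) (hx1 : c * x < 1) :
    critNum c B d x < 0 ↔ 2 * B < critFun c d x := by
  have e1 : 0 < x - c := by linarith
  have e2 : 0 < 1 - c * x := by linarith
  have hd' : ((d : ℝ) - 1) * Real.log x = Real.log (x ^ (d - 1)) := by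
    rw [Real.log_pow, Nat.cast_sub (by omega), Nat.cast_one]
  rw [critNum, sub_neg, critFun, hd', lt_sub_iff_add_lt, Real.log_div e1.ne' e2.ne',
    ← Real.log_lt_log_iff (by positivity) (by positivity), Real.log_mul (Real.exp_pos _).ne' e1.ne',
    Real.log_mul (by positivity) e2.ne', Real.log_mul (Real.exp_pos _).ne' (by positivity),
    Real.log_exp, Real.log_exp]
  constructor <;> intro h <;> linarith

lemma critNum_eq_zero (hd : d ≠ 0) (hx : c < x) (hx0 : 0 < x) (hx1 : c * x < 1)
    (h : critFun c d x = 2 * B) : critNum c B d x = 0 :=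
  le_antisymm (not_lt.1 fun hh => h.not_lt ((critNum_pos_iff hd hx hx0 hx1).1 hh))
    (not_lt.1 fun hh => h.not_gt ((critNum_neg_iff hd hx hx0 hx1).1 hh))

/-! ### Monotonicity of the critical equation -/

lemma hasDerivAt_critFun (hx : c < x) (hx0 : 0 < x) (hx1 : c * x < 1) :
    HasDerivAt (critFun c d) (critSlope c d x) x := by
  have e1 : x - c ≠ 0 := by linarith
  have e2 : 1 - c * x ≠ 0 := by linarith
  have h := (((hasDerivAt_id' x).sub_const c).div
    (((hasDerivAt_id' x).const_mul c).const_sub 1) e2).log (div_ne_zero e1 e2)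
  refine (h.sub ((Real.hasDerivAt_log hx0.ne').const_mul ((d : ℝ) - 1))).congr_deriv ?_
  simp only [critSlope, Pi.div_apply]
  field_simp
  ring

lemma critFun_one (hc : c < 1) : critFun c d 1 = 0 := by
  have : 1 - c ≠ 0 := by linarith
  simp [critFun, this]

/-- The function `x ↦ x * critSlope c d x` increases strictly to the right of `1`, because
`x / ((x - c) * (1 - c * x))` does. -/
lemma mul_critSlope_lt (h0 : 0 < c) (h1 : c < 1) {y : ℝ} (hx : 1 ≤ x) (hxy : x < y)
    (hy : c * y < 1) : x * critSlope c d x < y * critSlope c d y := by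
  have hx0 : 0 < x := by linarith
  have hy0 : 0 < y := by linarith
  have a1 : 0 < x - c := by linarith
  have a2 : 0 < 1 - c * x := by nlinarith
  have b1 : 0 < y - c := by linarith
  have b2 : 0 < 1 - c * y := by linarith
  have hc : 0 < 1 - c ^ 2 := by nlinarith
  have key : x * ((y - c) * (1 - c * y)) < y * ((x - c) * (1 - c * x)) := by
    have : 0 < c * ((y - x) * (x * y - 1)) :=
      mul_pos h0 (mul_pos (by linarith) (by nlinarith))
    nlinarith
  have e : ∀ z : ℝ, 0 < z → z * critSlope c d z =
      (1 - c ^ 2) * (z / ((z - c) * (1 - c * z))) - ((d : ℝ) - 1) := by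
    intro z hz
    unfold critSlope; field_simp
  rw [e x hx0, e y hy0]
  have : x / ((x - c) * (1 - c * x)) < y / ((y - c) * (1 - c * y)) := by
    rw [div_lt_div_iff₀ (by positivity) (by positivity)]; exact key
  have := mul_lt_mul_of_pos_left this hc
  linarith

lemma critSlope_pos_of_lt (h0 : 0 < c) (h1 : c < 1) {y : ℝ} (hx : 1 ≤ x) (hxy : x < y)
    (hy : c * y < 1) (h : 0 ≤ critSlope c d x) : 0 < critSlope c d y := by
  have := mul_critSlope_lt (d := d) h0 h1 hx hxy hy
  have h2 : 0 ≤ x * critSlope c d x := mul_nonneg (by linarith) h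
  exact pos_of_mul_pos_right (h2.trans_lt this) (by linarith)

/-- To the right of `1`, the function `critFun` increases strictly from the first point on where its
slope is nonnegative. -/
lemma critFun_lt_of_lt (h0 : 0 < c) (h1 : c < 1) {y : ℝ} (hx : 1 ≤ x) (hxy : x < y)
    (hy : c * y < 1) (h : 0 ≤ critSlope c d x) : critFun c d x < critFun c d y := by
  have hd : ∀ z ∈ Icc x y, HasDerivAt (critFun c d) (critSlope c d z) z := fun z hz =>
    hasDerivAt_critFun (by linarith [hz.1]) (by linarith [hz.1]) (by nlinarith [hz.2])
  have := strictMonoOn_of_deriv_pos (convex_Icc x y)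
    (fun z hz => (hd z hz).continuousAt.continuousWithinAt) (fun z hz => by
      rw [interior_Icc] at hz
      rw [(hd z ⟨hz.1.le, hz.2.le⟩).deriv]
      exact critSlope_pos_of_lt h0 h1 hx hz.1 (by nlinarith [hz.2]) h)
  exact this (left_mem_Icc.2 hxy.le) (right_mem_Icc.2 hxy.le) hxy

/-- As `critFun` vanishes at `1`, it can only be positive at `x` if its slope is positive somewhere
between `1` and `x`, and hence also at `x`. -/
lemma critSlope_pos_of_critFun_pos (h0 : 0 < c) (h1 : c < 1) (hx : 1 < x) (hx1 : c * x < 1)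
    (h : 0 < critFun c d x) : 0 < critSlope c d x := by
  have hd : ∀ z ∈ Icc 1 x, HasDerivAt (critFun c d) (critSlope c d z) z := fun z hz =>
    hasDerivAt_critFun (by linarith [hz.1]) (by linarith [hz.1]) (by nlinarith [hz.2])
  obtain ⟨ξ, hξ, hs⟩ := exists_hasDerivAt_eq_slope (critFun c d) (critSlope c d) hx
    (fun z hz => (hd z hz).continuousAt.continuousWithinAt)
    (fun z hz => hd z ⟨hz.1.le, hz.2.le⟩)
  rw [critFun_one h1, sub_zero] at hs
  refine critSlope_pos_of_lt h0 h1 hξ.1.le hξ.2 hx1 ?_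
  rw [hs]
  exact (div_pos h (by linarith)).le

lemma exists_critFun_eq (h0 : 0 < c) (h1 : c < 1) (hd : d ≠ 0) (hB : 0 < B) :
    ∃ x, 1 < x ∧ c * x < 1 ∧ critFun c d x = 2 * B := by
  -- The point `(1 - ε) / c` is so close to the pole `c⁻¹` of `critFun` that its value is at least
  -- `2 * B`.
  set ε := (1 - c) * (Real.exp (-(2 * B)) * c ^ (d - 1)) with hε
  have hc : 0 < 1 - c := by linarith
  have hε0 : 0 < ε := by positivity
  have hε1 : ε < 1 - c := by
    have e1 : Real.exp (-(2 * B)) < 1 := by rw [Real.exp_lt_one_iff]; linarith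
    have e2 : c ^ (d - 1) ≤ 1 := pow_le_one₀ h0.le h1.le
    have : Real.exp (-(2 * B)) * c ^ (d - 1) < 1 := by
      nlinarith [Real.exp_pos (-(2 * B)), pow_pos h0 (d - 1)]
    nlinarith
  set y := (1 - ε) / c with hy
  have hcy : c * y = 1 - ε := by rw [hy]; field_simp
  have hy1 : 1 < y := by rw [hy, lt_div_iff₀ h0]; linarith
  have hyL : 2 * B ≤ critFun c d y := by
    have l1 : Real.log ((1 - c) / ε) = 2 * B - ((d : ℝ) - 1) * Real.log c := by
      rw [hε, div_mul_cancel_left₀ hc.ne', Real.log_inv, Real.log_mul (by positivity)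
        (by positivity), Real.log_exp, Real.log_pow, Nat.cast_sub (by omega), Nat.cast_one]
      ring
    have l2 : Real.log ((1 - c) / ε) ≤ Real.log ((y - c) / (1 - c * y)) := by
      rw [hcy, sub_sub_cancel]
      exact Real.log_le_log (by positivity) (by gcongr)
    have l3 : Real.log y ≤ -Real.log c := by
      rw [← Real.log_inv]
      refine Real.log_le_log (by linarith) ?_
      rw [hy, div_eq_mul_inv]
      nlinarith [inv_pos.2 h0]
    have hd1 : (0 : ℝ) ≤ (d : ℝ) - 1 := by
      have : (1 : ℝ) ≤ d := by exact_mod_cast Nat.one_le_iff_ne_zero.2 hd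
      linarith
    unfold critFun
    nlinarith [mul_le_mul_of_nonneg_left l3 hd1]
  have hcont : ContinuousOn (critFun c d) (Icc 1 y) := fun z hz =>
    (hasDerivAt_critFun (by linarith [hz.1]) (by linarith [hz.1])
      (by nlinarith [hz.2])).continuousAt.continuousWithinAt
  obtain ⟨x, hx, hxB⟩ := intermediate_value_Icc hy1.le hcont
    (show 2 * B ∈ _ from ⟨by rw [critFun_one h1]; linarith, hyL⟩)
  refine ⟨x, lt_of_le_of_ne hx.1 ?_, by nlinarith [hx.2], hxB⟩
  rintro rfl
  rw [critFun_one h1] at hxB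
  linarith

/-- Between `1` and a solution of the critical equation, `critFun` stays below `2 * B`. -/
lemma critFun_lt_two_mul (h0 : 0 < c) (h1 : c < 1) (hB : 0 < B)
    (hx1 : c * x < 1) (h : critFun c d x = 2 * B) {z : ℝ} (hz : 1 ≤ z) (hzx : z < x) :
    critFun c d z < 2 * B := by
  by_contra! hh
  have hz1 : 1 < z := lt_of_le_of_ne hz (by rintro rfl; rw [critFun_one h1] at hh; linarith)
  have hs := critSlope_pos_of_critFun_pos (d := d) h0 h1 hz1 (by nlinarith) (by linarith)
  have := critFun_lt_of_lt (d := d) h0 h1 hz hzx hx1 hs.le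
  linarith

/-! ### Existence of the maximizer -/

lemma siteRatio_neg_lt (h0 : 0 < c) (h1 : c < 1) (hd : d ≠ 0) (hx : x < 0) :
    siteRatio c B d x < siteRatio c B d (-x) := by
  have hq := quad_pos h0.le h1 (-x)
  have hw := siteWeight_pos B d (abs_nonneg x)
  rw [siteRatio, siteRatio, abs_neg]
  refine div_lt_div_of_pos_left hw (by positivity) (pow_lt_pow_left₀ ?_ (Real.sqrt_nonneg _) hd)
  refine Real.sqrt_lt_sqrt hq.le ?_
  unfold quad; nlinarith

lemma siteRatio_le_inv (hB : 0 ≤ B) (hx : 0 < x) (hx1 : x ≤ 1) :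
    siteRatio c B d x ≤ siteRatio c B d x⁻¹ := by
  rw [← siteRatio_inv (c := c) B d (inv_ne_zero hx.ne'), inv_inv, siteRatio, siteRatio,
    abs_of_pos hx]
  refine div_le_div_of_nonneg_right ?_ (by positivity)
  have : x ^ d ≤ 1 := pow_le_one₀ hx.le hx1
  have : Real.exp (-B) ≤ Real.exp B := Real.exp_le_exp.2 (by linarith)
  simp only [siteWeight, neg_neg]
  nlinarith

lemma siteRatio_lt_inv (h0 : 0 ≤ c) (h1 : c < 1) (hd : d ≠ 0) (hB : 0 < B) (hx : 0 < x)
    (hx1 : x < 1) : siteRatio c B d x < siteRatio c B d x⁻¹ := by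
  have hq := quad_pos h0 h1 x
  rw [← siteRatio_inv (c := c) B d (inv_ne_zero hx.ne'), inv_inv, siteRatio, siteRatio,
    abs_of_pos hx]
  refine div_lt_div_of_pos_right ?_ (by positivity)
  have : x ^ d < 1 := pow_lt_one₀ hx.le hx1 hd
  have : Real.exp (-B) < Real.exp B := Real.exp_lt_exp.2 (by linarith)
  simp only [siteWeight, neg_neg]
  nlinarith

/-- For `B ≥ 0`, a solution of the critical equation to the right of `1` is the maximizer on
`[1, ∞)`; the comparison with `x⁻¹` and `-x` excludes larger values elsewhere. -/
lemma isRegularMax_of_critFun_eq (h0 : 0 < c) (h1 : c < 1) (hd : d ≠ 0) (hB : 0 ≤ B)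
    (hx : 1 ≤ x) (hx1 : c * x < 1) (h : critFun c d x = 2 * B) (hs : 0 < critSlope c d x)
    (hBx : 1 < x → 0 < B) : IsRegularMax c d B x := by
  have hd0 : (0 : ℝ) < d := by positivity
  have hmono : StrictMonoOn (logRatio c B d) (Icc 1 x) := by
    refine strictMonoOn_of_deriv_pos (convex_Icc 1 x) (fun z hz =>
      (hasDerivAt_logRatio h0.le h1 hd (by linarith [hz.1])).continuousAt.continuousWithinAt)
      fun z hz => ?_
    rw [interior_Icc] at hz
    have hz0 : 0 < z := by linarith [hz.1]
    rw [(hasDerivAt_logRatio h0.le h1 hd hz0).deriv, logRatioDeriv]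
    have := (critNum_pos_iff (B := B) hd (by linarith [hz.1]) hz0 (by nlinarith [hz.2])).2
      (critFun_lt_two_mul h0 h1 (hBx (hz.1.trans hz.2)) hx1 h hz.1.le hz.2)
    have := siteWeight_pos B d hz0.le
    have := quad_pos h0.le h1 z
    positivity
  have hanti : StrictAntiOn (logRatio c B d) (Ici x) := by
    refine strictAntiOn_of_deriv_neg (convex_Ici x) (fun z hz =>
      (hasDerivAt_logRatio h0.le h1 hd
        (by linarith [mem_Ici.1 hz])).continuousAt.continuousWithinAt) fun z hz => ?_
    rw [interior_Ici, mem_Ioi] at hz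
    have hz0 : 0 < z := by linarith
    rw [(hasDerivAt_logRatio h0.le h1 hd hz0).deriv, logRatioDeriv]
    have hn : critNum c B d z < 0 := by
      rcases lt_or_ge (c * z) 1 with hcz | hcz
      · refine (critNum_neg_iff hd (by linarith) hz0 hcz).2 ?_
        rw [← h]
        exact critFun_lt_of_lt h0 h1 hx hz hcz hs.le
      · have e1 : 0 < Real.exp (-B) * (z - c) := mul_pos (Real.exp_pos _) (by linarith)
        have e2 : 0 ≤ Real.exp B * z ^ (d - 1) * (c * z - 1) :=
          mul_nonneg (by positivity) (by linarith)
        unfold critNum; linarith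
    have hw := siteWeight_pos B d hz0.le
    have hq := quad_pos h0.le h1 z
    exact div_neg_of_neg_of_pos (mul_neg_of_pos_of_neg hd0 hn) (by positivity)
  have hge : ∀ z, 1 ≤ z → z ≠ x → siteRatio c B d z < siteRatio c B d x := by
    intro z hz hzx
    rw [siteRatio_eq_exp h0.le h1 (by linarith), siteRatio_eq_exp h0.le h1 (by linarith),
      Real.exp_lt_exp]
    rcases lt_or_gt_of_ne hzx with hlt | hlt
    · exact hmono ⟨hz, hlt.le⟩ ⟨hx, le_rfl⟩ hlt
    · exact hanti (mem_Ici.2 le_rfl) (mem_Ici.2 hlt.le) hlt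
  have hpos : ∀ z, 0 < z → z ≠ x → siteRatio c B d z < siteRatio c B d x := by
    intro z hz hzx
    rcases le_or_gt 1 z with hz1 | hz1
    · exact hge z hz1 hzx
    have hzi : 1 < z⁻¹ := (one_lt_inv₀ hz).2 hz1
    rcases eq_or_ne z⁻¹ x with e | e
    · rw [← e]
      exact siteRatio_lt_inv h0.le h1 hd (hBx (e ▸ hzi)) hz hz1
    · exact (siteRatio_le_inv hB hz hz1.le).trans_lt (hge _ hzi.le e)
  have htop : Real.exp B < siteRatio c B d x := by
    refine lt_of_le_of_lt ?_ (hge (x + 1) (by linarith) (by linarith))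
    have ht : Tendsto (siteRatio c (-B) d) (𝓝[>] 0) (𝓝 (Real.exp B)) := by
      have := (continuous_siteRatio h0.le h1 (-B) d).tendsto 0
      rw [siteRatio_zero hd, neg_neg] at this
      exact this.mono_left nhdsWithin_le_nhds
    refine le_of_tendsto ht ?_
    filter_upwards [Ioo_mem_nhdsGT (show (0 : ℝ) < (x + 1)⁻¹ by positivity)] with u hu
    have hu' : x + 1 < u⁻¹ := (lt_inv_comm₀ hu.1 (by linarith)).1 hu.2
    rw [← inv_inv u, siteRatio_inv B d (inv_ne_zero hu.1.ne'),
      siteRatio_eq_exp h0.le h1 (by linarith), siteRatio_eq_exp h0.le h1 (by linarith),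
      Real.exp_le_exp]
    exact (hanti (mem_Ici.2 (by linarith)) (mem_Ici.2 (by linarith)) hu').le
  refine ⟨by linarith, hx1, h, hs, fun z hz => ?_, htop⟩
  rcases lt_trichotomy z 0 with hz0 | rfl | hz0
  · refine (siteRatio_neg_lt h0 h1 hd hz0).trans_le ?_
    rcases eq_or_ne (-z) x with e | e
    · rw [e]
    · exact (hpos _ (by linarith) e).le
  · rw [siteRatio_zero hd]
    exact (Real.exp_le_exp.2 (by linarith)).trans_lt htop
  · exact hpos z hz0 hz

lemma exists_isRegularMax (h0 : 0 < c) (h1 : c < 1) (hd : d ≠ 0) (hB : 0 < B) :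
    ∃ x, 1 < x ∧ IsRegularMax c d B x := by
  obtain ⟨x, hx, hx1, h⟩ := exists_critFun_eq h0 h1 hd hB
  exact ⟨x, hx, isRegularMax_of_critFun_eq h0 h1 hd hB.le hx.le hx1 h
    (critSlope_pos_of_critFun_pos h0 h1 hx hx1 (by linarith)) fun _ => hB⟩

lemma critSlope_one (h1 : c < 1) : critSlope c d 1 = (1 + c) / (1 - c) - ((d : ℝ) - 1) := by
  have : 1 - c ≠ 0 := by linarith
  rw [critSlope]; field_simp; ring

lemma isRegularMax_one (h0 : 0 < c) (h1 : c < 1) (hd : d ≠ 0) (hs : 0 < critSlope c d 1) :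
    IsRegularMax c d 0 1 :=
  isRegularMax_of_critFun_eq h0 h1 hd le_rfl le_rfl (by linarith)
    (by rw [critFun_one h1, mul_zero]) hs fun h => absurd h (lt_irrefl _)

/-! ### Local and global bounds at the maximizer -/

/-- Away from the maximizer the integrand is smaller by a definite factor, also near infinity. -/
lemma IsRegularMax.exists_lt_of_le_abs_sub (h0 : 0 ≤ c) (h1 : c < 1) (hd : d ≠ 0)
    (h : IsRegularMax c d B x) {δ : ℝ} (hδ : 0 < δ) :
    ∃ ρ, 0 < ρ ∧ ρ < 1 ∧ ∀ z, δ ≤ |z - x| → siteRatio c B d z ≤ ρ * siteRatio c B d x := by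
  have hg := siteRatio_pos h0 h1 B d x
  have hcont := continuous_siteRatio h0 h1 B d
  have ht : Tendsto (siteRatio c B d) (cocompact ℝ) (𝓝 (Real.exp B)) := by
    have h2 := (continuous_siteRatio h0 h1 (-B) d).tendsto 0
    rw [siteRatio_zero hd, neg_neg] at h2
    have h3 := h2.comp (tendsto_inv₀_cobounded (α := ℝ))
    rw [Metric.cobounded_eq_cocompact] at h3
    refine h3.congr' ?_
    filter_upwards [(isCompact_singleton (x := (0 : ℝ))).compl_mem_cocompact] with z hz
    exact siteRatio_inv B d hz
  obtain ⟨ρ₁, hρ1, hρ1'⟩ := exists_between ((div_lt_one hg).2 h.exp_lt)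
  have hev := ht.eventually_lt_const ((div_lt_iff₀ hg).1 hρ1)
  obtain ⟨K, hK, hKs⟩ := mem_cocompact.1 hev
  have hclosed : IsClosed {z : ℝ | δ ≤ |z - x|} := isClosed_le continuous_const (by fun_prop)
  have hρ1pos : 0 < ρ₁ := (by positivity : (0 : ℝ) < Real.exp B / siteRatio c B d x).trans hρ1
  rcases (K ∩ {z : ℝ | δ ≤ |z - x|}).eq_empty_or_nonempty with he | hne
  · refine ⟨ρ₁, hρ1pos, hρ1', fun z hz => ?_⟩
    exact le_of_lt (hKs fun hzK => he.subset ⟨hzK, hz⟩)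
  · obtain ⟨z₀, hz₀, hmax⟩ := (hK.inter_right hclosed).exists_isMaxOn hne hcont.continuousOn
    have hz₀x : z₀ ≠ x := by
      rintro rfl
      have := hz₀.2
      simp at this
      linarith
    refine ⟨max ρ₁ (siteRatio c B d z₀ / siteRatio c B d x), lt_max_of_lt_left hρ1pos,
      max_lt hρ1' ((div_lt_one hg).2 (h.siteRatio_lt _ hz₀x)), fun z hz => ?_⟩
    by_cases hzK : z ∈ K
    · refine (hmax ⟨hzK, hz⟩).trans ?_
      rw [← div_le_iff₀ hg]
      exact le_max_right _ _
    · refine (hKs hzK).le.trans ?_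
      gcongr
      exact le_max_left _ _

/-- Minus the second derivative of `logRatio c B d` at a critical point. -/
def curvature (c B : ℝ) (d : ℕ) (x : ℝ) : ℝ :=
  d * (Real.exp (-B) * (x - c)) / (siteWeight B d x * quad c x) * critSlope c d x

lemma IsRegularMax.critNum_eq (h0 : 0 ≤ c) (hd : d ≠ 0) (h : IsRegularMax c d B x) :
    critNum c B d x = 0 :=
  critNum_eq_zero hd h.lt_self (h.pos h0) h.mul_lt_one h.critFun_eq

lemma IsRegularMax.curvature_pos (h0 : 0 ≤ c) (h1 : c < 1) (hd : d ≠ 0)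
    (h : IsRegularMax c d B x) : 0 < curvature c B d x := by
  have := quad_pos h0 h1 x
  have := siteWeight_pos B d (h.pos h0).le
  have : 0 < x - c := sub_pos.2 h.lt_self
  have := h.critSlope_pos
  unfold curvature; positivity

lemma IsRegularMax.hasDerivAt_logRatioDeriv (h0 : 0 ≤ c) (h1 : c < 1) (hd : d ≠ 0)
    (h : IsRegularMax c d B x) :
    HasDerivAt (logRatioDeriv c B d) (-curvature c B d x) x := by
  have hx := h.pos h0
  have hq := (quad_pos h0 h1 x).ne'
  have hw := (siteWeight_pos B d hx.le).ne'
  have hn := h.critNum_eq h0 hd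
  have e1 : x - c ≠ 0 := (sub_pos.2 h.lt_self).ne'
  have e2 : 1 - c * x ≠ 0 := (sub_pos.2 h.mul_lt_one).ne'
  obtain ⟨e, rfl⟩ : ∃ e, d = e + 1 := ⟨d - 1, by omega⟩
  have hR : HasDerivAt (critNum c B (e + 1))
      (-(Real.exp (-B) * (x - c) * critSlope c (e + 1) x)) x := by
    have := (((hasDerivAt_pow e x).const_mul (Real.exp B)).mul
      (((hasDerivAt_id' x).const_mul c).const_sub 1)).sub
        (((hasDerivAt_id' x).sub_const c).const_mul (Real.exp (-B)))
    refine this.congr_deriv ?_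
    simp only [critNum, Nat.add_sub_cancel] at hn
    have hpow : (e : ℝ) * x ^ (e - 1) = e * x ^ e / x := by
      rcases e with _ | k
      · simp
      · simp only [Nat.add_sub_cancel, pow_succ]; field_simp
    rw [hpow, critSlope]
    push_cast
    have hE : Real.exp B * x ^ e = Real.exp (-B) * (x - c) / (1 - c * x) := by
      rw [eq_div_iff e2]; linarith
    have : Real.exp B * (e * x ^ e / x) * (1 - c * x) + Real.exp B * x ^ e * -(c * 1)
        - Real.exp (-B) * 1 = (Real.exp B * x ^ e) * (e / x * (1 - c * x) - c) - Real.exp (-B) := by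
      ring
    have e2' : 1 - x * c ≠ 0 := by rwa [mul_comm]
    rw [this, hE]
    field_simp
    ring
  refine ((hR.const_mul ((e + 1 : ℕ) : ℝ)).div
    ((hasDerivAt_siteWeight_right B (e + 1) x).mul (hasDerivAt_quad c x))
    (mul_ne_zero hw hq)).congr_deriv ?_
  simp only [Pi.mul_apply, hn, curvature]
  field_simp
  ring

end

/-! ### Concentration of the integrand -/

/-- All degrees are `d` except one, which is `d + e` for an `e ≤ 1` that makes the number of
half-edges even. -/
lemma IsRegularDegrees.exists_prod_sum_eq {d n : ℕ} {D : Fin n → ℕ} (h : IsRegularDegrees d n D)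
    (hn : 0 < n) : ∃ e ≤ 1, ∃ r, n * d + e = 2 * r ∧ ∑ i, D i = 2 * r ∧
      (∀ F : ℕ → ℝ, ∏ i, F (D i) = F (d + e) * F d ^ (n - 1)) ∧
      ∀ F : ℕ → ℝ, ∑ i, F (D i) = F (d + e) + (n - 1) * F d := by
  have key : ∀ v : Fin n, ∀ e, D v = d + e → (∀ i, i ≠ v → D i = d) →
      ∑ i, D i = n * d + e ∧ (∀ F : ℕ → ℝ, ∏ i, F (D i) = F (d + e) * F d ^ (n - 1)) ∧
        ∀ F : ℕ → ℝ, ∑ i, F (D i) = F (d + e) + (n - 1) * F d := by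
    intro v e hv hD
    have hc : (Finset.univ.erase v).card = n - 1 := by
      rw [Finset.card_erase_of_mem (Finset.mem_univ v), Finset.card_univ, Fintype.card_fin]
    refine ⟨?_, fun F => ?_, fun F => ?_⟩
    · rw [← Finset.add_sum_erase _ _ (Finset.mem_univ v), hv,
        Finset.sum_congr rfl fun i hi => hD i (Finset.ne_of_mem_erase hi), Finset.sum_const, hc,
        smul_eq_mul]
      obtain ⟨m, rfl⟩ : ∃ m, n = m + 1 := ⟨n - 1, by omega⟩
      simp only [Nat.add_sub_cancel]; ring
    · rw [← Finset.mul_prod_erase _ _ (Finset.mem_univ v), hv,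
        Finset.prod_congr rfl fun i hi => by rw [hD i (Finset.ne_of_mem_erase hi)],
        Finset.prod_const, hc]
    · rw [← Finset.add_sum_erase _ _ (Finset.mem_univ v), hv,
        Finset.sum_congr rfl fun i hi => by rw [hD i (Finset.ne_of_mem_erase hi)],
        Finset.sum_const, hc, nsmul_eq_mul, Nat.cast_sub (by omega), Nat.cast_one]
  rcases Nat.even_or_odd (n * d) with he | ho
  · obtain ⟨r, hr⟩ := he.exists_two_nsmul
    obtain ⟨h1, h2, h3⟩ := key ⟨0, hn⟩ 0 (h.1 he _) fun i _ => h.1 he i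
    exact ⟨0, zero_le_one, r, by simpa using hr, by simpa [hr] using h1, h2, h3⟩
  · obtain ⟨v, hv, hD⟩ := h.2 ho
    obtain ⟨h1, h2, h3⟩ := key v 1 hv hD
    obtain ⟨r, hr⟩ := ho
    exact ⟨1, le_rfl, r + 1, by omega, by omega, h2, h3⟩

lemma exists_degree_data {d : ℕ} {D : (n : ℕ) → Fin n → ℕ}
    (hD : ∀ n, IsRegularDegrees d n (D n)) :
    ∃ e r : ℕ → ℕ, (∀ n, e n ≤ 1) ∧ ∀ n, 0 < n → n * d + e n = 2 * r n ∧ ∑ i, D n i = 2 * r n ∧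
      (∀ F : ℕ → ℝ, ∏ i, F (D n i) = F (d + e n) * F d ^ (n - 1)) ∧
      ∀ F : ℕ → ℝ, ∑ i, F (D n i) = F (d + e n) + (n - 1) * F d := by
  have : ∀ n, ∃ e r : ℕ, e ≤ 1 ∧ (0 < n → n * d + e = 2 * r ∧ ∑ i, D n i = 2 * r ∧
      (∀ F : ℕ → ℝ, ∏ i, F (D n i) = F (d + e) * F d ^ (n - 1)) ∧
      ∀ F : ℕ → ℝ, ∑ i, F (D n i) = F (d + e) + (n - 1) * F d) := by
    intro n
    rcases Nat.eq_zero_or_pos n with rfl | hn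
    · exact ⟨0, 0, zero_le_one, fun h => absurd h (lt_irrefl _)⟩
    · obtain ⟨e, he, r, h⟩ := (hD n).exists_prod_sum_eq hn
      exact ⟨e, r, he, fun _ => h⟩
  choose e r h1 h2 using this
  exact ⟨e, r, h1, h2⟩

lemma integrable_spinSum {n : ℕ} {D : Fin n → ℕ} {c : ℝ} (h0 : 0 ≤ c) (h1 : c < 1) {r : ℕ}
    (hr : ∑ i, D i = 2 * r) (B : ℝ) (X : Spins n → ℝ) :
    MeasureTheory.Integrable fun x => spinSum D B X x / quad c x ^ (r + 1) := by
  have : ∀ x : ℝ, spinSum D B X x / quad c x ^ (r + 1) =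
      ∑ σ, X σ * Real.exp (B * totalSpin σ) * (x ^ plusDegree D σ / quad c x ^ (r + 1)) := by
    intro x
    rw [spinSum, Finset.sum_div]
    exact Finset.sum_congr rfl fun σ _ => by ring
  simp only [this]
  exact MeasureTheory.integrable_finsetSum _ fun σ _ =>
    (integrable_moment h0 h1 (hr ▸ plusDegree_le σ)).const_mul _

lemma abs_siteMean_le (B : ℝ) (D : ℕ) {x : ℝ} (hx : 0 ≤ x) : |siteMean B D x| ≤ 1 := by
  have hw := siteWeight_pos B D hx
  rw [siteMean, abs_div, abs_of_pos hw, div_le_one hw, abs_le]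
  have h1 : 0 ≤ Real.exp B * x ^ D := by positivity
  have h2 := Real.exp_pos (-B)
  unfold siteWeight
  constructor <;> linarith

lemma hasDerivAt_siteMean_right (B : ℝ) (d : ℕ) {x : ℝ} (hx : 0 < x) :
    HasDerivAt (siteMean B d) ((1 - siteMean B d x ^ 2) * (d / (2 * x))) x := by
  have hw := (siteWeight_pos B d hx.le).ne'
  have h1 : HasDerivAt (fun x => Real.exp B * x ^ d - Real.exp (-B))
      (Real.exp B * (d * x ^ (d - 1))) x := ((hasDerivAt_pow d x).const_mul _).sub_const _
  refine (h1.div (hasDerivAt_siteWeight_right B d x) hw).congr_deriv ?_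
  have hpow : (d : ℝ) * x ^ (d - 1) = d * x ^ d / x := by
    rcases d with _ | k
    · simp
    · simp only [Nat.add_sub_cancel, pow_succ]; field_simp
  rw [hpow]
  simp only [siteMean]
  field_simp
  simp only [siteWeight]
  ring

lemma exists_siteRatio_le {c : ℝ} (h0 : 0 ≤ c) (h1 : c < 1) (B : ℝ) (D : ℕ) :
    ∃ G, ∀ x, siteRatio c B D x ≤ G := by
  have hc : 0 < 1 - c := by linarith
  refine ⟨(Real.exp B + Real.exp (-B)) / √(1 - c) ^ D, fun x => ?_⟩
  have hq := quad_pos h0 h1 x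
  have hs : √(1 - c) * √(1 + x ^ 2) ≤ √(quad c x) := by
    rw [← Real.sqrt_mul hc.le]
    exact Real.sqrt_le_sqrt (quad_ge h0 x)
  have hx : |x| ≤ √(1 + x ^ 2) := Real.abs_le_sqrt (by linarith)
  have hone : 1 ≤ √(1 + x ^ 2) := by rw [Real.one_le_sqrt]; nlinarith
  rw [siteRatio, div_le_div_iff₀ (by positivity) (by positivity)]
  calc siteWeight B D |x| * √(1 - c) ^ D
      ≤ ((Real.exp B + Real.exp (-B)) * √(1 + x ^ 2) ^ D) * √(1 - c) ^ D := by
        refine mul_le_mul_of_nonneg_right ?_ (by positivity)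
        unfold siteWeight
        rw [add_mul]
        refine add_le_add ?_ ?_
        · gcongr
        · exact le_mul_of_one_le_right (Real.exp_pos _).le (one_le_pow₀ hone)
    _ = (Real.exp B + Real.exp (-B)) * (√(1 - c) * √(1 + x ^ 2)) ^ D := by rw [mul_pow]; ring
    _ ≤ _ := by gcongr

lemma tendsto_sub_of_le_one {f : ℕ → ℝ → ℝ} {x₀ : ℝ} (hf : ∀ j, ContinuousAt (f j) x₀) {e : ℕ → ℕ}
    (he : ∀ n, e n ≤ 1) {u : ℕ → ℝ} (hu : Tendsto u atTop (𝓝 x₀)) :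
    Tendsto (fun n => f (e n) (u n) - f (e n) x₀) atTop (𝓝 0) := by
  have h : ∀ j, Tendsto (fun n => |f j (u n) - f j x₀|) atTop (𝓝 0) := fun j => by
    have := (((hf j).tendsto.comp hu).sub_const (f j x₀)).abs
    simpa using this
  have h01 := (h 0).add (h 1)
  rw [add_zero] at h01
  refine squeeze_zero_norm (fun n => ?_) h01
  rw [Real.norm_eq_abs]
  rcases Nat.le_one_iff_eq_zero_or_eq_one.1 (he n) with h | h <;> rw [h]
  · exact le_add_of_nonneg_right (abs_nonneg _)
  · exact le_add_of_nonneg_left (abs_nonneg _)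

/-- The integrand of the partition function, normalized by its value at `x₀`, for `n - 1` vertices
of degree `d` and one vertex of degree `d + e`. The factor `1 / quad c x`, left over from the
exponent `r + 1` of the moment integrals, is not normalized. For negative `x` it is an
upper bound. -/
def laplaceWeight (c B : ℝ) (d e : ℕ) (x₀ : ℝ) (n : ℕ) (x : ℝ) : ℝ :=
  siteRatio c B (d + e) x / siteRatio c B (d + e) x₀ *
    (siteRatio c B d x / siteRatio c B d x₀) ^ (n - 1) * (1 / quad c x)

section Concentration

variable {c B x₀ : ℝ} {d : ℕ}

lemma tendsto_add_div_sqrt (x₀ y : ℝ) :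
    Tendsto (fun n : ℕ => x₀ + y / √n) atTop (𝓝 x₀) := by
  have : Tendsto (fun n : ℕ => y / √(n : ℝ)) atTop (𝓝 0) :=
    (Real.tendsto_sqrt_atTop.comp tendsto_natCast_atTop_atTop).const_div_atTop y
  simpa using this.const_add x₀

lemma IsRegularMax.eventually_abs_logRatio_le (h0 : 0 ≤ c) (h1 : c < 1) (hd : d ≠ 0)
    (h : IsRegularMax c d B x₀) {ε : ℝ} (hε : 0 < ε) :
    ∀ᶠ x in 𝓝 x₀, |logRatio c B d x - logRatio c B d x₀ +
      curvature c B d x₀ / 2 * (x - x₀) ^ 2| ≤ ε * (x - x₀) ^ 2 := by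
  refine eventually_abs_sub_add_sq_le (Φ' := logRatioDeriv c B d) ?_
    (h.hasDerivAt_logRatioDeriv h0 h1 hd) ?_ hε
  · filter_upwards [lt_mem_nhds (h.pos h0)] with x hx
    exact hasDerivAt_logRatio h0 h1 hd hx
  · simp [logRatioDeriv, h.critNum_eq h0 hd]

lemma siteRatio_div_pow (h0 : 0 ≤ c) (h1 : c < 1) {x : ℝ} (hx : 0 < x) (hx₀ : 0 < x₀) (n : ℕ) :
    (siteRatio c B d x / siteRatio c B d x₀) ^ n =
      Real.exp (n * (logRatio c B d x - logRatio c B d x₀)) := by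
  rw [siteRatio_eq_exp h0 h1 hx, siteRatio_eq_exp h0 h1 hx₀, ← Real.exp_sub, ← Real.exp_nat_mul]

lemma IsRegularMax.tendsto_laplaceWeight (h0 : 0 ≤ c) (h1 : c < 1) (hd : d ≠ 0)
    (h : IsRegularMax c d B x₀) {e : ℕ → ℕ} (he : ∀ n, e n ≤ 1) (y : ℝ) :
    Tendsto (fun n : ℕ => laplaceWeight c B d (e n) x₀ n (x₀ + y / √n)) atTop
      (𝓝 (Real.exp (-(curvature c B d x₀ / 2) * y ^ 2) * (1 / quad c x₀))) := by
  have hu := tendsto_add_div_sqrt x₀ y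
  have hx₀ := h.pos h0
  set κ := curvature c B d x₀ with hκ
  have t1 : Tendsto (fun n : ℕ => siteRatio c B (d + e n) (x₀ + y / √n) /
      siteRatio c B (d + e n) x₀) atTop (𝓝 1) := by
    have := tendsto_sub_of_le_one (f := fun j x => siteRatio c B (d + j) x /
      siteRatio c B (d + j) x₀) (fun j =>
        ((continuous_siteRatio h0 h1 B (d + j)).div_const _).continuousAt) he hu
    have := this.add_const 1
    rw [zero_add] at this
    refine this.congr fun n => ?_
    rw [div_self (siteRatio_pos h0 h1 B _ x₀).ne']
    ring
  have t3 : Tendsto (fun n : ℕ => 1 / quad c (x₀ + y / √n)) atTop (𝓝 (1 / quad c x₀)) :=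
    (tendsto_const_nhds.div ((continuous_quad c).tendsto x₀) (quad_pos h0 h1 x₀).ne').comp hu
  have t2 : Tendsto (fun n : ℕ => (n : ℝ) *
      (logRatio c B d (x₀ + y / √n) - logRatio c B d x₀)) atTop (𝓝 (-(κ / 2) * y ^ 2)) := by
    rw [Metric.tendsto_atTop']
    intro ε hε
    have hε' : 0 < ε / (y ^ 2 + 1) := by positivity
    obtain ⟨N, hN⟩ := eventually_atTop.1
      (hu.eventually (h.eventually_abs_logRatio_le h0 h1 hd hε'))
    refine ⟨N, fun n hn => ?_⟩
    have hb := hN n hn.le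
    have hn0 : (0 : ℝ) < n := by exact_mod_cast (Nat.zero_le N).trans_lt hn
    have hsq : (n : ℝ) * (y / √n) ^ 2 = y ^ 2 := by
      rw [div_pow, Real.sq_sqrt hn0.le]; field_simp
    rw [add_sub_cancel_left] at hb
    have hb' := mul_le_mul_of_nonneg_left hb hn0.le
    rw [← abs_of_pos hn0, ← abs_mul, abs_of_pos hn0, mul_left_comm, hsq] at hb'
    rw [Real.dist_eq]
    refine lt_of_le_of_lt (le_trans (le_of_eq ?_) hb') ?_
    · congr 1
      linear_combination (-(κ / 2)) * hsq
    · rw [div_mul_eq_mul_div, div_lt_iff₀ (by positivity)]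
      nlinarith
  have t2' : Tendsto (fun n : ℕ => ((n - 1 : ℕ) : ℝ) *
      (logRatio c B d (x₀ + y / √n) - logRatio c B d x₀)) atTop (𝓝 (-(κ / 2) * y ^ 2)) := by
    have hc : Tendsto (fun n : ℕ => logRatio c B d (x₀ + y / √n) - logRatio c B d x₀) atTop
        (𝓝 0) := by
      have := ((hasDerivAt_logRatio (B := B) h0 h1 hd hx₀).continuousAt.tendsto.comp hu).sub_const
        (logRatio c B d x₀)
      simpa using this
    have := t2.sub hc
    rw [sub_zero] at this
    refine this.congr' ?_
    filter_upwards [eventually_gt_atTop 0] with n hn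
    rw [Nat.cast_sub (by omega), Nat.cast_one]
    ring
  have t2'' := (Real.continuous_exp.tendsto _).comp t2'
  have := (t1.mul t2'').mul t3
  rw [one_mul] at this
  refine this.congr' ?_
  filter_upwards [hu.eventually (lt_mem_nhds hx₀)] with n hn
  simp only [Function.comp, laplaceWeight]
  rw [siteRatio_div_pow h0 h1 hn hx₀]

lemma one_div_quad_le (h0 : 0 ≤ c) (h1 : c < 1) (x : ℝ) : 1 / quad c x ≤ 1 / (1 - c) := by
  have hc : 0 < 1 - c := by linarith
  refine one_div_le_one_div_of_le hc (le_trans ?_ (quad_ge h0 x))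
  nlinarith [sq_nonneg x]

lemma laplaceWeight_nonneg (h0 : 0 ≤ c) (h1 : c < 1) (e n : ℕ) (x : ℝ) :
    0 ≤ laplaceWeight c B d e x₀ n x := by
  have := quad_pos h0 h1 x
  have := siteRatio_pos h0 h1 B
  unfold laplaceWeight
  have := this d x
  have := siteRatio_pos h0 h1 B d x₀
  have := siteRatio_pos h0 h1 B (d + e) x
  have := siteRatio_pos h0 h1 B (d + e) x₀
  positivity

/-- The normalized integrand is dominated by a Gaussian near the maximizer, and decays exponentially
in `n` away from it. -/
lemma IsRegularMax.exists_laplaceWeight_le (h0 : 0 ≤ c) (h1 : c < 1) (hd : d ≠ 0)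
    (h : IsRegularMax c d B x₀) : ∃ G a, 0 < a ∧
      (∀ᶠ x in 𝓝 x₀, ∀ n ≥ 2, ∀ e ≤ 1, laplaceWeight c B d e x₀ n x ≤
        G * Real.exp (-(a * (n * (x - x₀) ^ 2)))) ∧
      ∀ δ > 0, ∃ ρ, 0 < ρ ∧ ρ < 1 ∧ ∀ n, ∀ e ≤ 1, ∀ x, δ ≤ |x - x₀| →
        laplaceWeight c B d e x₀ n x ≤ G * ρ ^ (n - 1) * (1 / quad c x) := by
  have hc : 0 < 1 - c := by linarith
  have hx₀ := h.pos h0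
  have hκ := h.curvature_pos h0 h1 hd
  obtain ⟨G₀, hG₀⟩ := exists_siteRatio_le h0 h1 B (d + 0)
  obtain ⟨G₁, hG₁⟩ := exists_siteRatio_le h0 h1 B (d + 1)
  have p0 := siteRatio_pos h0 h1 B (d + 0) x₀
  have p1 := siteRatio_pos h0 h1 B (d + 1) x₀
  have hG₀' : 0 ≤ G₀ := (siteRatio_pos h0 h1 B (d + 0) x₀).le.trans (hG₀ _)
  have hG₁' : 0 ≤ G₁ := (siteRatio_pos h0 h1 B (d + 1) x₀).le.trans (hG₁ _)
  set G := G₀ / siteRatio c B (d + 0) x₀ + G₁ / siteRatio c B (d + 1) x₀ with hG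
  have hGn : 0 ≤ G := by positivity
  have hGe : ∀ e ≤ 1, ∀ x, siteRatio c B (d + e) x / siteRatio c B (d + e) x₀ ≤ G := by
    intro e he x
    rcases Nat.le_one_iff_eq_zero_or_eq_one.1 he with rfl | rfl
    · refine le_trans ?_ (le_add_of_nonneg_right (by positivity))
      exact div_le_div_of_nonneg_right (hG₀ x) p0.le
    · refine le_trans ?_ (le_add_of_nonneg_left (by positivity))
      exact div_le_div_of_nonneg_right (hG₁ x) p1.le
  have hs := siteRatio_pos h0 h1 B d x₀
  refine ⟨G + G * (1 / (1 - c)), curvature c B d x₀ / 8, by positivity, ?_, fun δ hδ => ?_⟩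
  · filter_upwards [h.eventually_abs_logRatio_le h0 h1 hd (ε := curvature c B d x₀ / 4)
      (by positivity), lt_mem_nhds hx₀] with x hx hxpos n hn e he
    have hΔ : logRatio c B d x - logRatio c B d x₀ ≤ -(curvature c B d x₀ / 4) * (x - x₀) ^ 2 := by
      have := (abs_le.1 hx).2
      linarith
    have hn' : (n : ℝ) / 2 ≤ ((n - 1 : ℕ) : ℝ) := by
      rw [Nat.cast_sub (by omega), Nat.cast_one]
      have : (2 : ℝ) ≤ n := by exact_mod_cast hn
      linarith
    have hexp : (siteRatio c B d x / siteRatio c B d x₀) ^ (n - 1) ≤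
        Real.exp (-(curvature c B d x₀ / 8 * (n * (x - x₀) ^ 2))) := by
      rw [siteRatio_div_pow h0 h1 hxpos hx₀, Real.exp_le_exp]
      calc ((n - 1 : ℕ) : ℝ) * (logRatio c B d x - logRatio c B d x₀)
          ≤ ((n - 1 : ℕ) : ℝ) * (-(curvature c B d x₀ / 4) * (x - x₀) ^ 2) := by gcongr
        _ = -(((n - 1 : ℕ) : ℝ) * (curvature c B d x₀ / 4 * (x - x₀) ^ 2)) := by ring
        _ ≤ -((n : ℝ) / 2 * (curvature c B d x₀ / 4 * (x - x₀) ^ 2)) := by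
          refine neg_le_neg (mul_le_mul_of_nonneg_right hn' (by positivity))
        _ = _ := by ring
    have hqx := quad_pos h0 h1 x
    calc laplaceWeight c B d e x₀ n x ≤ G * Real.exp
          (-(curvature c B d x₀ / 8 * (n * (x - x₀) ^ 2))) * (1 / (1 - c)) := by
          unfold laplaceWeight
          have q1 := siteRatio_pos h0 h1 B d x
          have q2 := siteRatio_pos h0 h1 B (d + e) x
          have q3 := siteRatio_pos h0 h1 B (d + e) x₀
          exact mul_le_mul (mul_le_mul (hGe e he x) hexp (by positivity) hGn)
            (one_div_quad_le h0 h1 x) (by positivity) (by positivity)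
      _ ≤ _ := by
          have : 0 ≤ G * Real.exp (-(curvature c B d x₀ / 8 * (n * (x - x₀) ^ 2))) := by positivity
          linarith
  · obtain ⟨ρ, hρ0, hρ1, hρ⟩ := h.exists_lt_of_le_abs_sub h0 h1 hd hδ
    refine ⟨ρ, hρ0, hρ1, fun n e he x hx => ?_⟩
    have q1 := siteRatio_pos h0 h1 B d x
    have q2 := siteRatio_pos h0 h1 B (d + e) x
    have q3 := siteRatio_pos h0 h1 B (d + e) x₀
    have hqx := quad_pos h0 h1 x
    have hGG : G ≤ G + G * (1 / (1 - c)) := le_add_of_nonneg_right (by positivity)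
    unfold laplaceWeight
    refine mul_le_mul_of_nonneg_right (mul_le_mul ((hGe e he x).trans hGG)
      (pow_le_pow_left₀ (by positivity) ?_ _) (by positivity) (by positivity)) (by positivity)
    rw [div_le_iff₀ hs]
    exact hρ x hx

lemma tendsto_sqrt_mul_pow {ρ : ℝ} (hρ0 : 0 < ρ) (hρ1 : ρ < 1) (k : ℕ) (G : ℝ) :
    Tendsto (fun n : ℕ => √n * ((2 * √n) ^ k * (G * ρ ^ (n - 1)))) atTop (𝓝 0) := by
  have h := (tendsto_pow_const_mul_const_pow_of_abs_lt_one (k + 1)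
    (show |ρ| < 1 by rwa [abs_of_pos hρ0])).const_mul (2 ^ k * |G| * ρ⁻¹)
  rw [mul_zero] at h
  refine squeeze_zero_norm' ?_ h
  filter_upwards [eventually_gt_atTop 0] with n hn
  have hn1 : (1 : ℝ) ≤ n := by exact_mod_cast hn
  have hs : √(n : ℝ) ≤ n := by
    rw [Real.sqrt_le_left (by linarith)]; nlinarith
  have hp : ρ ^ (n - 1) = ρ⁻¹ * ρ ^ n := by
    obtain ⟨m, rfl⟩ : ∃ m, n = m + 1 := ⟨n - 1, by omega⟩
    rw [Nat.add_sub_cancel, pow_succ]; field_simp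
  have e1 : √(n : ℝ) * ((2 * √n) ^ k * (G * ρ ^ (n - 1))) =
      G * (√(n : ℝ) ^ (k + 1) * (2 ^ k * ρ⁻¹ * ρ ^ n)) := by rw [hp]; ring
  rw [e1, Real.norm_eq_abs, abs_mul, abs_of_nonneg
    (show 0 ≤ √(n : ℝ) ^ (k + 1) * (2 ^ k * ρ⁻¹ * ρ ^ n) by positivity)]
  calc |G| * (√(n : ℝ) ^ (k + 1) * (2 ^ k * ρ⁻¹ * ρ ^ n))
      ≤ |G| * ((n : ℝ) ^ (k + 1) * (2 ^ k * ρ⁻¹ * ρ ^ n)) := by gcongr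
    _ = 2 ^ k * |G| * ρ⁻¹ * ((n : ℝ) ^ (k + 1) * ρ ^ n) := by ring

/-- Laplace's method for `laplaceWeight` times a moment that grows at most quadratically in the
rescaled variable. Each of the `k` factors of the moment, a centred spin sum divided by `√n`, is at
most `2 * √n`, which is the bound used far from the maximizer. -/
lemma IsRegularMax.tendsto_integral (h0 : 0 ≤ c) (h1 : c < 1) (hd : d ≠ 0)
    (h : IsRegularMax c d B x₀) {e : ℕ → ℕ} (he : ∀ n, e n ≤ 1) {P mom : ℕ → ℝ → ℝ} {M : ℝ → ℝ}
    {k : ℕ} {C : ℝ}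
    (hint : ∀ n > 0, MeasureTheory.Integrable (P n))
    (hP : ∀ n > 0, ∀ x > 0, P n x = laplaceWeight c B d (e n) x₀ n x * mom n x)
    (hPle : ∀ n > 0, ∀ x, |P n x| ≤ (2 * √n) ^ k * laplaceWeight c B d (e n) x₀ n x)
    (hmom : ∀ᶠ x in 𝓝 x₀, ∀ n > 0, |mom n x| ≤ C * (1 + n * (x - x₀) ^ 2))
    (hlim : ∀ y, Tendsto (fun n : ℕ => mom n (x₀ + y / √n)) atTop (𝓝 (M y))) :
    Tendsto (fun n : ℕ => √n * ∫ x, P n x) atTop (𝓝 (∫ y,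
      Real.exp (-(curvature c B d x₀ / 2) * y ^ 2) * (1 / quad c x₀) * M y)) := by
  have hx₀ := h.pos h0
  obtain ⟨G, a, ha, hnear, hfar⟩ := h.exists_laplaceWeight_le h0 h1 hd
  obtain ⟨δ, hδ, hball⟩ := Metric.eventually_nhds_iff.1 ((hnear.and hmom).and (lt_mem_nhds hx₀))
  obtain ⟨ρ, hρ0, hρ1, hρ⟩ := hfar δ hδ
  refine tendsto_sqrt_mul_integral (x₀ := x₀) (δ := δ) (C := G * C) (w := fun x => 1 / quad c x)
    (E := fun n => (2 * √n) ^ k * (G * ρ ^ (n - 1))) ha ?_ (integrable_inv_quad h0 h1) ?_ ?_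
    (tendsto_sqrt_mul_pow hρ0 hρ1 k G) hδ fun y => ?_
  · filter_upwards [eventually_gt_atTop 0] with n hn using hint n hn
  · filter_upwards [eventually_ge_atTop 2] with n hn x hx
    obtain ⟨⟨b1, b2⟩, b3⟩ := hball (y := x) (by rwa [Real.dist_eq])
    have hw := laplaceWeight_nonneg (x₀ := x₀) (B := B) (d := d) h0 h1 (e n) n x
    rw [hP n (by omega) x b3, abs_mul, abs_of_nonneg hw]
    calc _ ≤ (G * Real.exp (-(a * (n * (x - x₀) ^ 2)))) * (C * (1 + n * (x - x₀) ^ 2)) :=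
          mul_le_mul (b1 n hn _ (he n)) (b2 n (by omega)) (abs_nonneg _)
            (hw.trans (b1 n hn _ (he n)))
      _ = _ := by ring
  · filter_upwards [eventually_gt_atTop 0] with n hn x hx
    refine (hPle n hn x).trans ?_
    rw [mul_assoc]
    exact mul_le_mul_of_nonneg_left (hρ n _ (he n) x hx) (by positivity)
  · refine ((h.tendsto_laplaceWeight h0 h1 hd he y).mul (hlim y)).congr' ?_
    filter_upwards [eventually_gt_atTop 0,
      (tendsto_add_div_sqrt x₀ y).eventually (lt_mem_nhds hx₀)] with n hn hn'
    exact (hP n hn _ hn').symm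

end Concentration

/-! ### Laplace asymptotics of the moments of the total spin -/

section Moments

variable {c B x₀ : ℝ} {d : ℕ}

lemma prod_siteWeight_div (h0 : 0 ≤ c) (h1 : c < 1) {n e r : ℕ} (hn : 0 < n)
    (hr : n * d + e = 2 * r) (x : ℝ) :
    siteWeight B (d + e) |x| * siteWeight B d |x| ^ (n - 1) / quad c x ^ (r + 1) /
      (siteRatio c B (d + e) x₀ * siteRatio c B d x₀ ^ (n - 1)) =
        laplaceWeight c B d e x₀ n x := by
  have hq := quad_pos h0 h1 x
  have hpow : quad c x ^ r = √(quad c x) ^ (d + e) * (√(quad c x) ^ d) ^ (n - 1) := by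
    rw [← pow_mul, ← pow_add]
    have : d + e + d * (n - 1) = 2 * r := by
      obtain ⟨m, rfl⟩ : ∃ m, n = m + 1 := ⟨n - 1, by omega⟩
      rw [← hr, Nat.add_sub_cancel]; ring
    rw [this, pow_mul, Real.sq_sqrt hq.le]
  have q1 := siteRatio_pos h0 h1 B d x₀
  have q2 := siteRatio_pos h0 h1 B (d + e) x₀
  have hs : 0 < √(quad c x) := Real.sqrt_pos.2 hq
  rw [laplaceWeight, siteRatio.eq_1 c B (d + e) x, siteRatio.eq_1 c B d x, pow_succ, hpow,
    div_pow, div_pow]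
  field_simp

/-- The integrand of the rescaled `k`-th moment of the centred total spin, divided by the
`siteRatio` factors at the maximizer. -/
def momentIntegrand (c B : ℝ) (d e r : ℕ) (x₀ : ℝ) {n : ℕ} (D : Fin n → ℕ) (k : ℕ) (x : ℝ) : ℝ :=
  spinSum D B (fun σ => ((totalSpin σ - n * siteMean B d x₀) / √n) ^ k) x / quad c x ^ (r + 1) /
    (siteRatio c B (d + e) x₀ * siteRatio c B d x₀ ^ (n - 1))

/-- The mean, divided by `√n`, of the centred total spin of independent spins at one vertex of
degree `d + e` and `n - 1` vertices of degree `d`. -/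
def rescaledMean (B : ℝ) (d e : ℕ) (x₀ : ℝ) (n : ℕ) (x : ℝ) : ℝ :=
  (siteMean B (d + e) x - siteMean B d x) / √n + √n * (siteMean B d x - siteMean B d x₀)

/-- The variance, divided by `n`, of the total spin of independent spins at one vertex of degree
`d + e` and `n - 1` vertices of degree `d`. -/
def meanVariance (B : ℝ) (d e : ℕ) (n : ℕ) (x : ℝ) : ℝ :=
  ((1 - siteMean B (d + e) x ^ 2) + (n - 1) * (1 - siteMean B d x ^ 2)) / n

section

variable {n e r : ℕ} {D : Fin n → ℕ}

lemma integrable_momentIntegrand (h0 : 0 ≤ c) (h1 : c < 1) (hD : ∑ i, D i = 2 * r) (k : ℕ) :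
    MeasureTheory.Integrable (momentIntegrand c B d e r x₀ D k) :=
  (integrable_spinSum h0 h1 hD B _).div_const _

lemma abs_momentIntegrand_le (h0 : 0 ≤ c) (h1 : c < 1) (hn : 0 < n) (hr : n * d + e = 2 * r)
    (hp : ∀ F : ℕ → ℝ, ∏ i, F (D i) = F (d + e) * F d ^ (n - 1)) (hx₀ : 0 ≤ x₀) (k : ℕ) (x : ℝ) :
    |momentIntegrand c B d e r x₀ D k x| ≤ (2 * √n) ^ k * laplaceWeight c B d e x₀ n x := by
  have hn0 : (0 : ℝ) < n := by exact_mod_cast hn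
  have hs : 0 < √(n : ℝ) := Real.sqrt_pos.2 hn0
  have hX : ∀ σ : Spins n, |((totalSpin σ - n * siteMean B d x₀) / √n) ^ k| ≤ (2 * √n) ^ k := by
    intro σ
    rw [abs_pow]
    refine pow_le_pow_left₀ (abs_nonneg _) ?_ k
    rw [abs_div, abs_of_pos hs, div_le_iff₀ hs, mul_assoc, Real.mul_self_sqrt hn0.le]
    have h2 := abs_siteMean_le B d hx₀
    have h3 : |(n : ℝ) * siteMean B d x₀| ≤ n := by
      rw [abs_mul, abs_of_pos hn0]; nlinarith
    have := abs_sub (totalSpin σ) (n * siteMean B d x₀)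
    linarith [abs_totalSpin_le σ]
  have q1 := siteRatio_pos h0 h1 B d x₀
  have q2 := siteRatio_pos h0 h1 B (d + e) x₀
  have hq := quad_pos h0 h1 x
  rw [← prod_siteWeight_div h0 h1 hn hr, momentIntegrand, abs_div, abs_div,
    abs_of_pos (show 0 < siteRatio c B (d + e) x₀ * siteRatio c B d x₀ ^ (n - 1) by positivity),
    abs_of_pos (show 0 < quad c x ^ (r + 1) by positivity), ← mul_div_assoc, ← mul_div_assoc,
    ← hp fun k => siteWeight B k |x|]
  gcongr
  exact abs_spinSum_le D B hX x

lemma momentIntegrand_zero (h0 : 0 ≤ c) (h1 : c < 1) (hn : 0 < n) (hr : n * d + e = 2 * r)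
    (hp : ∀ F : ℕ → ℝ, ∏ i, F (D i) = F (d + e) * F d ^ (n - 1)) {x : ℝ} (hx : 0 < x) :
    momentIntegrand c B d e r x₀ D 0 x = laplaceWeight c B d e x₀ n x := by
  simp only [momentIntegrand, pow_zero]
  rw [spinSum_one, ← prod_siteWeight_div h0 h1 hn hr, hp fun k => siteWeight B k x,
    abs_of_pos hx]

lemma spinSum_div_pow (X : Spins n → ℝ) (a : ℝ) (k : ℕ) (x : ℝ) :
    spinSum D B (fun σ => (X σ / a) ^ k) x = spinSum D B (fun σ => X σ ^ k) x / a ^ k := by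
  rw [spinSum, spinSum, Finset.sum_div]
  exact Finset.sum_congr rfl fun σ _ => by rw [div_pow]; ring

lemma momentIntegrand_one (h0 : 0 ≤ c) (h1 : c < 1) (hn : 0 < n) (hr : n * d + e = 2 * r)
    (hp : ∀ F : ℕ → ℝ, ∏ i, F (D i) = F (d + e) * F d ^ (n - 1))
    (hs : ∀ F : ℕ → ℝ, ∑ i, F (D i) = F (d + e) + (n - 1) * F d) {x : ℝ} (hx : 0 < x) :
    momentIntegrand c B d e r x₀ D 1 x =
      laplaceWeight c B d e x₀ n x * rescaledMean B d e x₀ n x := by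
  have hn0 : (0 : ℝ) < n := by exact_mod_cast hn
  have hsq : √(n : ℝ) * √n = n := Real.mul_self_sqrt hn0.le
  have hne : √(n : ℝ) ≠ 0 := (Real.sqrt_pos.2 hn0).ne'
  have hm : (siteMean B (d + e) x + (n - 1) * siteMean B d x - n * siteMean B d x₀) / √n =
      rescaledMean B d e x₀ n x := by
    rw [rescaledMean]
    field_simp
    rw [sq, hsq]; ring
  rw [momentIntegrand, spinSum_div_pow]
  simp only [pow_one]
  rw [spinSum_sub D B _ hx.le, ← prod_siteWeight_div h0 h1 hn hr, hp fun k => siteWeight B k x,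
    hs fun k => siteMean B k x, abs_of_pos hx, ← hm]
  ring

lemma momentIntegrand_two (h0 : 0 ≤ c) (h1 : c < 1) (hn : 0 < n) (hr : n * d + e = 2 * r)
    (hp : ∀ F : ℕ → ℝ, ∏ i, F (D i) = F (d + e) * F d ^ (n - 1))
    (hs : ∀ F : ℕ → ℝ, ∑ i, F (D i) = F (d + e) + (n - 1) * F d) {x : ℝ} (hx : 0 < x) :
    momentIntegrand c B d e r x₀ D 2 x = laplaceWeight c B d e x₀ n x *
      (rescaledMean B d e x₀ n x ^ 2 + meanVariance B d e n x) := by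
  have hn0 : (0 : ℝ) < n := by exact_mod_cast hn
  have hsq : √(n : ℝ) * √n = n := Real.mul_self_sqrt hn0.le
  have hne : √(n : ℝ) ≠ 0 := (Real.sqrt_pos.2 hn0).ne'
  have hm : (siteMean B (d + e) x + (n - 1) * siteMean B d x - n * siteMean B d x₀) / √n =
      rescaledMean B d e x₀ n x := by
    rw [rescaledMean]
    field_simp
    rw [sq, hsq]; ring
  rw [momentIntegrand, spinSum_div_pow, spinSum_sub_sq D B _ hx.le,
    ← prod_siteWeight_div h0 h1 hn hr, hp fun k => siteWeight B k x,
    hs fun k => siteMean B k x, hs fun k => 1 - siteMean B k x ^ 2, abs_of_pos hx, ← hm,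
    meanVariance, div_pow, Real.sq_sqrt hn0.le]
  ring

end

lemma tendsto_const_div_sqrt (C : ℝ) : Tendsto (fun n : ℕ => C / √n) atTop (𝓝 0) :=
  (Real.tendsto_sqrt_atTop.comp tendsto_natCast_atTop_atTop).const_div_atTop C

/-- The derivative of `siteMean B d`. -/
def siteMeanDeriv (B : ℝ) (d : ℕ) (x : ℝ) : ℝ := (1 - siteMean B d x ^ 2) * (d / (2 * x))

lemma tendsto_rescaledMean (hx₀ : 0 < x₀) {e : ℕ → ℕ} (y : ℝ) :
    Tendsto (fun n : ℕ => rescaledMean B d (e n) x₀ n (x₀ + y / √n)) atTop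
      (𝓝 (siteMeanDeriv B d x₀ * y)) := by
  have hu := tendsto_add_div_sqrt x₀ y
  have t1 : Tendsto (fun n : ℕ => (siteMean B (d + e n) (x₀ + y / √n) -
      siteMean B d (x₀ + y / √n)) / √n) atTop (𝓝 0) := by
    refine squeeze_zero_norm' ?_ (tendsto_const_div_sqrt 2)
    filter_upwards [hu.eventually (lt_mem_nhds hx₀)] with n hn
    rw [norm_div, Real.norm_of_nonneg (Real.sqrt_nonneg _), Real.norm_eq_abs]
    gcongr
    refine (abs_sub _ _).trans ?_
    linarith [abs_siteMean_le B (d + e n) hn.le, abs_siteMean_le B d hn.le]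
  have t2 : Tendsto (fun n : ℕ => √n * (siteMean B d (x₀ + y / √n) - siteMean B d x₀)) atTop
      (𝓝 (siteMeanDeriv B d x₀ * y)) := by
    rcases eq_or_ne y 0 with rfl | hy
    · simp
    have hslope := (hasDerivAt_iff_tendsto_slope_zero.1 (hasDerivAt_siteMean_right B d hx₀))
    have hyn : Tendsto (fun n : ℕ => y / √(n : ℝ)) atTop (𝓝[≠] 0) := by
      refine tendsto_nhdsWithin_iff.2 ⟨tendsto_const_div_sqrt y, ?_⟩
      filter_upwards [eventually_gt_atTop 0] with n hn
      have : (0 : ℝ) < n := by exact_mod_cast hn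
      simp only [mem_compl_iff, mem_singleton_iff]
      positivity
    refine ((hslope.comp hyn).mul_const y).congr fun n => ?_
    simp only [Function.comp, smul_eq_mul, inv_div]
    field_simp
  simpa [rescaledMean] using t1.add t2

lemma tendsto_meanVariance (hx₀ : 0 < x₀) {e : ℕ → ℕ} (y : ℝ) :
    Tendsto (fun n : ℕ => meanVariance B d (e n) n (x₀ + y / √n)) atTop
      (𝓝 (1 - siteMean B d x₀ ^ 2)) := by
  have hu := tendsto_add_div_sqrt x₀ y
  have t2 : Tendsto (fun n : ℕ => 1 - siteMean B d (x₀ + y / √n) ^ 2) atTop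
      (𝓝 (1 - siteMean B d x₀ ^ 2)) :=
    (((hasDerivAt_siteMean_right B d hx₀).continuousAt.tendsto.comp hu).pow 2).const_sub 1
  have t1 : Tendsto (fun n : ℕ => (siteMean B d (x₀ + y / √n) ^ 2 -
      siteMean B (d + e n) (x₀ + y / √n) ^ 2) / n) atTop (𝓝 0) := by
    refine squeeze_zero_norm' ?_ (tendsto_const_div_atTop_nhds_zero_nat (1 : ℝ))
    filter_upwards [hu.eventually (lt_mem_nhds hx₀)] with n hn
    rw [norm_div, Real.norm_of_nonneg (Nat.cast_nonneg n), Real.norm_eq_abs]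
    gcongr
    have a1 := (sq_le_one_iff_abs_le_one _).2 (abs_siteMean_le B (d + e n) hn.le)
    have a2 := (sq_le_one_iff_abs_le_one _).2 (abs_siteMean_le B d hn.le)
    rw [abs_le]
    constructor <;> nlinarith [sq_nonneg (siteMean B (d + e n) (x₀ + y / √n)),
      sq_nonneg (siteMean B d (x₀ + y / √n))]
  have := t1.add t2
  rw [zero_add] at this
  refine this.congr' ?_
  filter_upwards [eventually_gt_atTop 0] with n hn
  have : (n : ℝ) ≠ 0 := by positivity
  rw [meanVariance]
  field_simp
  ring

lemma exists_abs_rescaledMean_le (hx₀ : 0 < x₀) : ∃ K, 0 ≤ K ∧ ∀ᶠ x in 𝓝 x₀, ∀ n > 0, ∀ e,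
    |rescaledMean B d e x₀ n x| ≤ 2 + K * (√n * |x - x₀|) := by
  obtain ⟨K, hK⟩ := (hasDerivAt_siteMean_right B d hx₀).isBigO_sub.bound
  refine ⟨|K|, abs_nonneg K, ?_⟩
  filter_upwards [hK, lt_mem_nhds hx₀] with x hx hxpos n hn e
  have hn1 : (1 : ℝ) ≤ √n := by
    rw [Real.one_le_sqrt]; exact_mod_cast hn
  rw [rescaledMean]
  refine (abs_add_le _ _).trans (add_le_add ?_ ?_)
  · rw [abs_div, abs_of_nonneg (Real.sqrt_nonneg _), div_le_iff₀ (by linarith)]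
    have := abs_sub (siteMean B (d + e) x) (siteMean B d x)
    linarith [abs_siteMean_le B (d + e) hxpos.le, abs_siteMean_le B d hxpos.le]
  · rw [abs_mul, abs_of_nonneg (Real.sqrt_nonneg _)]
    have h3 : |siteMean B d x - siteMean B d x₀| ≤ |K| * |x - x₀| :=
      hx.trans (mul_le_mul_of_nonneg_right (le_abs_self K) (norm_nonneg _))
    calc √(n : ℝ) * |siteMean B d x - siteMean B d x₀| ≤ √n * (|K| * |x - x₀|) := by gcongr
      _ = _ := by ring

lemma abs_meanVariance_le {e n : ℕ} (hn : 0 < n) {x : ℝ} (hx : 0 ≤ x) :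
    |meanVariance B d e n x| ≤ 1 := by
  have hn1 : (1 : ℝ) ≤ n := by exact_mod_cast hn
  have a1 := (sq_le_one_iff_abs_le_one _).2 (abs_siteMean_le B (d + e) hx)
  have a2 := (sq_le_one_iff_abs_le_one _).2 (abs_siteMean_le B d hx)
  have b2 := mul_nonneg (sub_nonneg.2 hn1) (sub_nonneg.2 a2)
  have b3 := mul_nonneg (sub_nonneg.2 hn1) (sq_nonneg (siteMean B d x))
  rw [meanVariance, abs_div, abs_of_pos (by linarith : (0 : ℝ) < n), div_le_one (by linarith),
    abs_of_nonneg (by linarith)]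
  linarith [sq_nonneg (siteMean B (d + e) x)]

/-- Laplace asymptotics of the rescaled moments of orders `0`, `1` and `2` of the total spin. The
second moment combines the variance of the Gaussian, transported by the mean of a spin, with the
variance of the independent spins. -/
lemma IsRegularMax.tendsto_integral_momentIntegrand (h0 : 0 ≤ c) (h1 : c < 1) (hd : d ≠ 0)
    (h : IsRegularMax c d B x₀) {D : (n : ℕ) → Fin n → ℕ} {e r : ℕ → ℕ} (he : ∀ n, e n ≤ 1)
    (hD : ∀ n, 0 < n → n * d + e n = 2 * r n ∧ ∑ i, D n i = 2 * r n ∧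
      (∀ F : ℕ → ℝ, ∏ i, F (D n i) = F (d + e n) * F d ^ (n - 1)) ∧
      ∀ F : ℕ → ℝ, ∑ i, F (D n i) = F (d + e n) + (n - 1) * F d) :
    ∃ I > 0,
      Tendsto (fun n : ℕ => √n * ∫ x, momentIntegrand c B d (e n) (r n) x₀ (D n) 0 x) atTop (𝓝 I) ∧
      Tendsto (fun n : ℕ => √n * ∫ x, momentIntegrand c B d (e n) (r n) x₀ (D n) 1 x) atTop (𝓝 0) ∧
      Tendsto (fun n : ℕ => √n * ∫ x, momentIntegrand c B d (e n) (r n) x₀ (D n) 2 x) atTop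
        (𝓝 (I * (siteMeanDeriv B d x₀ ^ 2 / curvature c B d x₀ +
          (1 - siteMean B d x₀ ^ 2)))) := by
  have hx₀ := h.pos h0
  have hκ := h.curvature_pos h0 h1 hd
  set κ := curvature c B d x₀ with hκd
  have hκ2 : 0 < κ / 2 := by positivity
  have hq := quad_pos h0 h1 x₀
  obtain ⟨K, hK0, hK⟩ := exists_abs_rescaledMean_le (B := B) (d := d) hx₀
  have hg1 := integrable_exp_neg_mul_sq hκ2
  have hgpos : 0 < ∫ y : ℝ, Real.exp (-(κ / 2) * y ^ 2) := by
    rw [integral_gaussian]; positivity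
  have T0 := h.tendsto_integral h0 h1 hd he
    (P := fun n => momentIntegrand c B d (e n) (r n) x₀ (D n) 0) (mom := fun _ _ => 1)
    (M := fun _ => 1) (k := 0) (C := 1)
    (fun n hn => integrable_momentIntegrand h0 h1 (hD n hn).2.1 0)
    (fun n hn x hx => by
      rw [momentIntegrand_zero h0 h1 hn (hD n hn).1 (hD n hn).2.2.1 hx, mul_one])
    (fun n hn x => abs_momentIntegrand_le h0 h1 hn (hD n hn).1 (hD n hn).2.2.1 hx₀.le 0 x)
    (.of_forall fun x n _ => by rw [abs_one, one_mul]; exact le_add_of_nonneg_right (by positivity))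
    (fun y => tendsto_const_nhds)
  have hsqle : ∀ (n : ℕ) (x : ℝ), 2 * (√(n : ℝ) * |x - x₀|) ≤ 1 + n * (x - x₀) ^ 2 := by
    intro n x
    have := sq_nonneg (√(n : ℝ) * |x - x₀| - 1)
    have e1 : (√(n : ℝ) * |x - x₀|) ^ 2 = n * (x - x₀) ^ 2 := by
      rw [mul_pow, Real.sq_sqrt (Nat.cast_nonneg n), sq_abs]
    nlinarith
  have T1 := h.tendsto_integral h0 h1 hd he
    (P := fun n => momentIntegrand c B d (e n) (r n) x₀ (D n) 1)
    (mom := fun n => rescaledMean B d (e n) x₀ n)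
    (M := fun y => siteMeanDeriv B d x₀ * y) (k := 1) (C := 2 + K)
    (fun n hn => integrable_momentIntegrand h0 h1 (hD n hn).2.1 1)
    (fun n hn x hx => momentIntegrand_one h0 h1 hn (hD n hn).1 (hD n hn).2.2.1 (hD n hn).2.2.2 hx)
    (fun n hn x => abs_momentIntegrand_le h0 h1 hn (hD n hn).1 (hD n hn).2.2.1 hx₀.le 1 x)
    (by
      filter_upwards [hK] with x hx n hn
      refine (hx n hn (e n)).trans ?_
      have a1 := hsqle n x
      have a2 : 0 ≤ (n : ℝ) * (x - x₀) ^ 2 := by positivity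
      nlinarith [mul_le_mul_of_nonneg_left a1 hK0])
    (fun y => tendsto_rescaledMean hx₀ y)
  have T2 := h.tendsto_integral h0 h1 hd he
    (P := fun n => momentIntegrand c B d (e n) (r n) x₀ (D n) 2)
    (mom := fun n x => rescaledMean B d (e n) x₀ n x ^ 2 + meanVariance B d (e n) n x)
    (M := fun y => (siteMeanDeriv B d x₀ * y) ^ 2 + (1 - siteMean B d x₀ ^ 2)) (k := 2)
    (C := 9 + 2 * K ^ 2)
    (fun n hn => integrable_momentIntegrand h0 h1 (hD n hn).2.1 2)
    (fun n hn x hx => momentIntegrand_two h0 h1 hn (hD n hn).1 (hD n hn).2.2.1 (hD n hn).2.2.2 hx)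
    (fun n hn x => abs_momentIntegrand_le h0 h1 hn (hD n hn).1 (hD n hn).2.2.1 hx₀.le 2 x)
    (by
      filter_upwards [hK, lt_mem_nhds hx₀] with x hx hxpos n hn
      refine (abs_add_le _ _).trans ?_
      have a1 := abs_meanVariance_le (B := B) (d := d) (e := e n) hn hxpos.le
      have a2 := hx n hn (e n)
      rw [abs_pow]
      have a3 := pow_le_pow_left₀ (abs_nonneg _) a2 2
      have e1 : (√(n : ℝ) * |x - x₀|) ^ 2 = n * (x - x₀) ^ 2 := by
        rw [mul_pow, Real.sq_sqrt (Nat.cast_nonneg n), sq_abs]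
      have e2 : (2 + K * (√(n : ℝ) * |x - x₀|)) ^ 2 ≤ 8 + 2 * K ^ 2 * (n * (x - x₀) ^ 2) := by
        rw [← e1]
        nlinarith [sq_nonneg (2 - K * (√(n : ℝ) * |x - x₀|))]
      have a4 : 0 ≤ (n : ℝ) * (x - x₀) ^ 2 := by positivity
      nlinarith [sq_nonneg K])
    (fun y => ((tendsto_rescaledMean hx₀ y).pow 2).add (tendsto_meanVariance hx₀ y))
  have hg2 : MeasureTheory.Integrable fun y : ℝ => y ^ 2 * Real.exp (-(κ / 2) * y ^ 2) := by
    simpa only [Real.rpow_two] using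
      integrable_rpow_mul_exp_neg_mul_sq hκ2 (s := 2) (by norm_num)
  refine ⟨_, ?_, T0, ?_, ?_⟩
  · simp only [mul_one]
    rw [MeasureTheory.integral_mul_const]
    positivity
  · convert T1 using 2
    rw [MeasureTheory.integral_congr_ae (g := fun y => (1 / quad c x₀ * siteMeanDeriv B d x₀) *
      (y * Real.exp (-(κ / 2) * y ^ 2))) (.of_forall fun y => by ring),
      MeasureTheory.integral_const_mul, integral_id_mul_gaussian hκ2, mul_zero]
  · convert T2 using 2
    rw [MeasureTheory.integral_congr_ae
      (f := fun y => Real.exp (-(κ / 2) * y ^ 2) * (1 / quad c x₀) *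
        ((siteMeanDeriv B d x₀ * y) ^ 2 + (1 - siteMean B d x₀ ^ 2)))
      (g := fun y => (1 / quad c x₀ * siteMeanDeriv B d x₀ ^ 2) *
      (y ^ 2 * Real.exp (-(κ / 2) * y ^ 2)) + (1 / quad c x₀ * (1 - siteMean B d x₀ ^ 2)) *
      Real.exp (-(κ / 2) * y ^ 2)) (.of_forall fun y => by ring),
      MeasureTheory.integral_add (hg2.const_mul _) (hg1.const_mul _),
      MeasureTheory.integral_const_mul, MeasureTheory.integral_const_mul,
      integral_sq_mul_gaussian hκ2]
    simp only [mul_one]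
    rw [MeasureTheory.integral_mul_const]
    field_simp
    exact mul_comm _ _

end Moments

/-! ### Thermodynamic limits at a nondegenerate maximizer -/

/-- The minimum of `quad c` is `1 - c ^ 2`, attained at `c`, and so `momentIntegral c r 0` behaves
like `(1 - c ^ 2) ^ (-r)` up to a power of `r`. -/
lemma exists_abs_log_momentIntegral_le {c : ℝ} (h0 : 0 ≤ c) (h1 : c < 1) :
    ∃ C, ∀ r : ℕ, |Real.log (momentIntegral c r 0) + r * Real.log (1 - c ^ 2)| ≤
      C + 1 / 2 * Real.log (r + 1) := by
  set s := 1 - c ^ 2 with hs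
  have hs0 : 0 < s := by rw [hs]; nlinarith
  have hqs : ∀ x, quad c x = (x - c) ^ 2 + s := fun x => by rw [hs]; unfold quad; ring
  refine ⟨|Real.log (momentIntegral c 0 0)| + |Real.log s| + 1 / s, fun r => ?_⟩
  have hJ := momentIntegral_zero_pos h0 h1 r
  have hJ0 := momentIntegral_zero_pos h0 h1 0
  have hr0 : (0 : ℝ) < (r : ℝ) + 1 := by positivity
  have hlogr : 0 ≤ Real.log ((r : ℝ) + 1) :=
    Real.log_nonneg (by linarith [Nat.cast_nonneg (α := ℝ) r])
  have hup : momentIntegral c r 0 ≤ (s ^ r)⁻¹ * momentIntegral c 0 0 := by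
    unfold momentIntegral
    rw [← MeasureTheory.integral_const_mul]
    refine MeasureTheory.integral_mono (integrable_moment h0 h1 (by omega))
      ((integrable_moment h0 h1 (by omega)).const_mul _) fun x => ?_
    have hq := quad_pos h0 h1 x
    have hsq : s ≤ quad c x := by rw [hqs]; nlinarith [sq_nonneg (x - c)]
    simp only [pow_zero, zero_add, pow_one]
    rw [pow_succ, ← one_div, one_div_mul_one_div]
    exact one_div_le_one_div_of_le (by positivity) (by gcongr)
  -- The lower bound restricts the integral to an interval of length `2 / √(r + 1)` around `c`.
  have hlow : 2 * (1 / √((r : ℝ) + 1)) * (1 / (1 / ((r : ℝ) + 1) + s) ^ (r + 1)) ≤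
      momentIntegral c r 0 := by
    set η := 1 / √((r : ℝ) + 1) with hη
    have hη0 : 0 < η := by positivity
    have hη2 : η ^ 2 = 1 / ((r : ℝ) + 1) := by rw [hη, div_pow, Real.sq_sqrt hr0.le, one_pow]
    have hi := integrable_moment h0 h1 (r := r) (k := 0) (by omega)
    calc _ = ∫ _ in Icc (c - η) (c + η), 1 / (1 / ((r : ℝ) + 1) + s) ^ (r + 1) := by
          rw [MeasureTheory.setIntegral_const, Real.volume_real_Icc_of_le (by linarith),
            smul_eq_mul]
          congr 1; ring
      _ ≤ ∫ x in Icc (c - η) (c + η), x ^ 0 / quad c x ^ (r + 1) := by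
          refine MeasureTheory.setIntegral_mono_on (by simp) hi.integrableOn measurableSet_Icc ?_
          intro x hx
          have hq := quad_pos h0 h1 x
          rw [pow_zero]
          refine one_div_le_one_div_of_le (by positivity) ?_
          have : quad c x ≤ 1 / ((r : ℝ) + 1) + s := by
            rw [hqs, ← hη2]
            nlinarith [hx.1, hx.2]
          gcongr
      _ ≤ _ := MeasureTheory.setIntegral_le_integral hi (.of_forall fun x => by
          have hq := quad_pos h0 h1 x
          simp only [Pi.zero_apply]; positivity)
  have hup' : Real.log (momentIntegral c r 0) ≤
      -(r * Real.log s) + Real.log (momentIntegral c 0 0) := by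
    refine (Real.log_le_log hJ hup).trans_eq ?_
    rw [Real.log_mul (by positivity) hJ0.ne', Real.log_inv, Real.log_pow]
  have hlow' : Real.log 2 - 1 / 2 * Real.log ((r : ℝ) + 1) -
      (r + 1) * Real.log (1 / ((r : ℝ) + 1) + s) ≤ Real.log (momentIntegral c r 0) := by
    refine le_trans (le_of_eq ?_) (Real.log_le_log (by positivity) hlow)
    rw [Real.log_mul (by positivity) (by positivity), Real.log_mul (by positivity) (by positivity),
      Real.log_div one_ne_zero (by positivity), Real.log_div one_ne_zero (by positivity),
      Real.log_one, Real.log_pow, Real.log_sqrt hr0.le]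
    push_cast
    ring
  have hlog : (r + 1) * Real.log (1 / ((r : ℝ) + 1) + s) ≤ (r + 1) * Real.log s + 1 / s := by
    have e : 1 / ((r : ℝ) + 1) + s = s * (1 + 1 / (s * (r + 1))) := by field_simp; ring
    have e2 : Real.log (1 + 1 / (s * ((r : ℝ) + 1))) ≤ 1 / (s * (r + 1)) := by
      have := Real.log_le_sub_one_of_pos (show 0 < 1 + 1 / (s * ((r : ℝ) + 1)) by positivity)
      linarith
    rw [e, Real.log_mul hs0.ne' (by positivity), mul_add]
    have := mul_le_mul_of_nonneg_left e2 hr0.le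
    have e3 : ((r : ℝ) + 1) * (1 / (s * (r + 1))) = 1 / s := by field_simp
    linarith
  have hs1 : 0 < 1 / s := by positivity
  have := Real.log_nonneg (show (1 : ℝ) ≤ 2 by norm_num)
  rw [abs_le]
  constructor
  · linarith [le_abs_self (Real.log s), abs_nonneg (Real.log (momentIntegral c 0 0))]
  · linarith [le_abs_self (Real.log (momentIntegral c 0 0)), abs_nonneg (Real.log s)]

section

variable {n : ℕ} {D : Fin n → ℕ}

lemma annealedExpect_const_add (β B a b : ℝ) (X : Spins n → ℝ)
    (h : annealedExpect D β B (fun _ => 1) = 1) :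
    annealedExpect D β B (fun σ => a + b * X σ) = a + b * annealedExpect D β B X := by
  have h1 : ∑ σ, annealedWeight D β B σ = 1 := by simpa [annealedExpect] using h
  calc _ = (∑ σ, annealedWeight D β B σ) * a + b * annealedExpect D β B X := by
        simp only [annealedExpect, Finset.sum_mul, Finset.mul_sum, ← Finset.sum_add_distrib]
        exact Finset.sum_congr rfl fun σ _ => by ring
    _ = _ := by rw [h1, one_mul]

lemma annealedVar_eq (β B a : ℝ) {b : ℝ} (X : Spins n → ℝ)
    (h : annealedExpect D β B (fun _ => 1) = 1) :
    annealedVar D β B (fun σ => a + b * X σ) =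
      b ^ 2 * (annealedExpect D β B (fun σ => X σ ^ 2) - annealedExpect D β B X ^ 2) := by
  rw [annealedVar, annealedExpect_const_add β B a b X h]
  set m := annealedExpect D β B X
  have h1 : ∑ σ, annealedWeight D β B σ = 1 := by simpa [annealedExpect] using h
  have : ∀ σ, (a + b * X σ - (a + b * m)) ^ 2 =
      (b ^ 2 * m ^ 2) + b ^ 2 * (X σ ^ 2 - 2 * m * X σ) := fun σ => by ring
  simp only [this]
  rw [annealedExpect_const_add β B _ _ _ h]
  have h2 : annealedExpect D β B (fun σ => X σ ^ 2 - 2 * m * X σ) =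
      annealedExpect D β B (fun σ => X σ ^ 2) - 2 * m * m := by
    simp only [m, annealedExpect, Finset.mul_sum, ← Finset.sum_sub_distrib]
    exact Finset.sum_congr rfl fun σ _ => by ring
  rw [h2]; ring

lemma magnetization_eq (hn : 0 < n) (β B m : ℝ)
    (h : annealedExpect D β B (fun _ => 1) = 1) :
    magnetization D β B =
      m + 1 / √n * annealedExpect D β B (fun σ => (totalSpin σ - n * m) / √n) := by
  have hn0 : (0 : ℝ) < n := by exact_mod_cast hn
  rw [← annealedExpect_const_add β B _ _ _ h, magnetization]
  congr 1
  ext σ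
  rw [one_div_mul_eq_div, div_div, Real.mul_self_sqrt hn0.le]
  field_simp
  ring

lemma susceptibility_eq (hn : 0 < n) (β B m : ℝ)
    (h : annealedExpect D β B (fun _ => 1) = 1) :
    susceptibility D β B =
      annealedExpect D β B (fun σ => ((totalSpin σ - n * m) / √n) ^ 2) -
        annealedExpect D β B (fun σ => (totalSpin σ - n * m) / √n) ^ 2 := by
  have hn0 : (0 : ℝ) < n := by exact_mod_cast hn
  have := annealedVar_eq (D := D) β B (n * m / √n) (b := 1)
    (fun σ => (totalSpin σ - n * m) / √n) h
  rw [one_pow, one_mul] at this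
  rw [← this, susceptibility]
  congr 1
  ext σ
  ring

end

lemma tendsto_log_div_nat : Tendsto (fun n : ℕ => Real.log n / n) atTop (𝓝 0) :=
  Real.isLittleO_log_id_atTop.tendsto_div_nhds_zero.comp tendsto_natCast_atTop_atTop

section

variable {β B x₀ : ℝ} {d : ℕ} {D : (n : ℕ) → Fin n → ℕ}

/-- The limits of the magnetization and the susceptibility at a nondegenerate maximizer. -/
theorem IsRegularMax.tendsto_magnetization_susceptibility (hβ : 0 < β) (hd : d ≠ 0)
    (h : IsRegularMax (Real.exp (-2 * β)) d B x₀) (hD : ∀ n, IsRegularDegrees d n (D n)) :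
    Tendsto (fun n => magnetization (D n) β B) atTop (𝓝 (siteMean B d x₀)) ∧
    Tendsto (fun n => susceptibility (D n) β B) atTop
      (𝓝 (siteMeanDeriv B d x₀ ^ 2 / curvature (Real.exp (-2 * β)) B d x₀ +
        (1 - siteMean B d x₀ ^ 2))) := by
  have h0 : 0 ≤ Real.exp (-2 * β) := (Real.exp_pos _).le
  have h1 : Real.exp (-2 * β) < 1 := by rw [Real.exp_lt_one_iff]; linarith
  obtain ⟨e, r, he, hdat⟩ := exists_degree_data hD
  obtain ⟨I, hI, T0, T1, T2⟩ := h.tendsto_integral_momentIntegrand h0 h1 hd he hdat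
  set m := siteMean B d x₀
  have hE : ∀ n > 0, ∀ k, annealedExpect (D n) β B (fun σ => ((totalSpin σ - n * m) / √n) ^ k) =
      (√n * ∫ x, momentIntegrand (Real.exp (-2 * β)) B d (e n) (r n) x₀ (D n) k x) /
        (√n * ∫ x, momentIntegrand (Real.exp (-2 * β)) B d (e n) (r n) x₀ (D n) 0 x) := by
    intro n hn k
    have hn0 : (0 : ℝ) < n := by exact_mod_cast hn
    have hs : √(n : ℝ) ≠ 0 := (Real.sqrt_pos.2 hn0).ne'
    have q1 := (siteRatio_pos h0 h1 B d x₀).ne'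
    have q2 := (siteRatio_pos h0 h1 B (d + e n) x₀).ne'
    rw [mul_div_mul_left _ _ hs, annealedExpect_eq_integral hβ B (hdat n hn).2.1]
    unfold momentIntegrand
    rw [MeasureTheory.integral_div, MeasureTheory.integral_div,
      div_div_div_cancel_right₀ (mul_ne_zero q2 (pow_ne_zero _ q1))]
    simp only [pow_zero, m]
  have hone : ∀ᶠ n : ℕ in atTop, annealedExpect (D n) β B (fun _ => 1) = 1 := by
    filter_upwards [T0.eventually (lt_mem_nhds hI), eventually_gt_atTop 0] with n hn hn0
    have := hE n hn0 0
    simp only [pow_zero] at this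
    rw [this, div_self hn.ne']
  have A1 : Tendsto (fun n : ℕ => annealedExpect (D n) β B
      (fun σ => (totalSpin σ - n * m) / √n)) atTop (𝓝 0) := by
    have := T1.div T0 hI.ne'
    rw [zero_div] at this
    refine this.congr' ?_
    filter_upwards [eventually_gt_atTop 0] with n hn
    have := hE n hn 1
    simp only [pow_one] at this
    exact this.symm
  have A2 : Tendsto (fun n : ℕ => annealedExpect (D n) β B
      (fun σ => ((totalSpin σ - n * m) / √n) ^ 2)) atTop
      (𝓝 (siteMeanDeriv B d x₀ ^ 2 / curvature (Real.exp (-2 * β)) B d x₀ + (1 - m ^ 2))) := by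
    have := T2.div T0 hI.ne'
    rw [mul_div_cancel_left₀ _ hI.ne'] at this
    refine this.congr' ?_
    filter_upwards [eventually_gt_atTop 0] with n hn
    exact (hE n hn 2).symm
  constructor
  · have := ((tendsto_const_div_sqrt 1).mul A1).const_add m
    rw [mul_zero, add_zero] at this
    refine this.congr' ?_
    filter_upwards [hone, eventually_gt_atTop 0] with n hn hn0
    exact (magnetization_eq hn0 β B m hn).symm
  · have := A2.sub (A1.pow 2)
    rw [zero_pow two_ne_zero, sub_zero] at this
    refine this.congr' ?_
    filter_upwards [hone, eventually_gt_atTop 0] with n hn hn0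
    exact (susceptibility_eq hn0 β B m hn).symm

/-- The limit of the pressure at a nondegenerate maximizer. -/
theorem IsRegularMax.tendsto_pressure (hβ : 0 < β) (hd : d ≠ 0)
    (h : IsRegularMax (Real.exp (-2 * β)) d B x₀) (hD : ∀ n, IsRegularDegrees d n (D n)) :
    Tendsto (fun n => pressure (D n) β B) atTop
      (𝓝 (β * d / 2 + d / 2 * Real.log (1 - Real.exp (-2 * β) ^ 2) +
        logRatio (Real.exp (-2 * β)) B d x₀)) := by
  set c := Real.exp (-2 * β) with hc
  have h0 : 0 ≤ c := (Real.exp_pos _).le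
  have h1 : c < 1 := by rw [hc, Real.exp_lt_one_iff]; linarith
  have hx₀ := h.pos h0
  obtain ⟨e, r, he, hdat⟩ := exists_degree_data hD
  obtain ⟨I, hI, T0, -, -⟩ := h.tendsto_integral_momentIntegrand h0 h1 hd he hdat
  set J : ℕ → ℝ := fun n => √n * ∫ x, momentIntegrand c B d (e n) (r n) x₀ (D n) 0 x with hJdef
  clear_value J
  have q1 := siteRatio_pos h0 h1 B d x₀
  have hinv : Tendsto (fun n : ℕ => (1 : ℝ) / n) atTop (𝓝 0) := tendsto_one_div_atTop_nhds_zero_nat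
  have hbdd : ∀ (a : ℕ → ℝ) (K : ℝ), (∀ᶠ n in atTop, |a n| ≤ K) →
      Tendsto (fun n : ℕ => a n / n) atTop (𝓝 0) := by
    intro a K ha
    refine squeeze_zero_norm' ?_ (tendsto_const_div_atTop_nhds_zero_nat K)
    filter_upwards [ha] with n hn
    rw [norm_div, Real.norm_of_nonneg (Nat.cast_nonneg n)]
    gcongr
    exact hn
  have tr : Tendsto (fun n : ℕ => (r n : ℝ) / n) atTop (𝓝 (d / 2)) := by
    have t := (hbdd (fun n => (e n : ℝ) / 2) 1 (.of_forall fun n => by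
      have : (e n : ℝ) ≤ 1 := by exact_mod_cast he n
      rw [abs_of_nonneg (by positivity)]; linarith)).const_add ((d : ℝ) / 2)
    rw [add_zero] at t
    refine t.congr' ?_
    filter_upwards [eventually_gt_atTop 0] with n hn
    have hn0 : (n : ℝ) ≠ 0 := by positivity
    have : (n : ℝ) * d + e n = 2 * r n := by exact_mod_cast (hdat n hn).1
    field_simp
    linarith
  have tJ : Tendsto (fun n => Real.log (momentIntegral c (r n) 0) / n) atTop
      (𝓝 (-(d / 2 * Real.log (1 - c ^ 2)))) := by
    obtain ⟨C, hC⟩ := exists_abs_log_momentIntegral_le h0 h1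
    have hz : Tendsto (fun n => (Real.log (momentIntegral c (r n) 0) +
        r n * Real.log (1 - c ^ 2)) / n) atTop (𝓝 0) := by
      have hb : Tendsto (fun n : ℕ => (C + 1 / 2 * Real.log (d + 2)) / n +
          1 / 2 * (Real.log n / n)) atTop (𝓝 0) := by
        have := (tendsto_const_div_atTop_nhds_zero_nat (C + 1 / 2 * Real.log (d + 2))).add
          (tendsto_log_div_nat.const_mul (1 / 2))
        rwa [mul_zero, add_zero] at this
      refine squeeze_zero_norm' ?_ hb
      filter_upwards [eventually_gt_atTop 0] with n hn
      have hn0 : (0 : ℝ) < n := by exact_mod_cast hn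
      have hle : (r n : ℝ) + 1 ≤ (d + 2) * n := by
        have e1 := (hdat n hn).1
        have e2 := he n
        have : r n + 1 ≤ (d + 2) * n := by nlinarith
        exact_mod_cast this
      have hl : Real.log ((r n : ℝ) + 1) ≤ Real.log (d + 2) + Real.log n := by
        rw [← Real.log_mul (by positivity) hn0.ne']
        exact Real.log_le_log (by positivity) hle
      rw [norm_div, Real.norm_of_nonneg hn0.le, Real.norm_eq_abs, ← mul_div_assoc, ← add_div]
      gcongr
      linarith [hC (r n)]
    have := hz.sub (tr.mul_const (Real.log (1 - c ^ 2)))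
    rw [zero_sub] at this
    refine this.congr fun n => ?_
    ring
  have tI : Tendsto (fun n => Real.log (J n) / n) atTop (𝓝 0) := by
    have hl : Tendsto (fun n => Real.log (J n)) atTop (𝓝 (Real.log I)) := T0.log hI.ne'
    refine hbdd _ (|Real.log I| + 1) ?_
    filter_upwards [hl.abs.eventually (gt_mem_nhds (lt_add_one _))] with n hn using hn.le
  have te : Tendsto (fun n => Real.log (siteRatio c B (d + e n) x₀) / n) atTop (𝓝 0) := by
    refine hbdd _ (|Real.log (siteRatio c B (d + 0) x₀)| +
      |Real.log (siteRatio c B (d + 1) x₀)|) (.of_forall fun n => ?_)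
    rcases Nat.le_one_iff_eq_zero_or_eq_one.1 (he n) with h | h <;> rw [h]
    · exact le_add_of_nonneg_right (abs_nonneg _)
    · exact le_add_of_nonneg_left (abs_nonneg _)
  have tn : Tendsto (fun n : ℕ => (((n : ℝ) - 1) / n) * logRatio c B d x₀) atTop
      (𝓝 (logRatio c B d x₀)) := by
    have := (hinv.const_sub 1).mul_const (logRatio c B d x₀)
    rw [sub_zero, one_mul] at this
    refine this.congr' ?_
    filter_upwards [eventually_gt_atTop 0] with n hn
    have hn0 : (n : ℝ) ≠ 0 := by positivity
    rw [sub_div, div_self hn0]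
  have := (((((tr.const_mul β).sub tJ).add tn).add te).add tI).sub
    (tendsto_log_div_nat.const_mul (1 / 2))
  rw [mul_zero, sub_zero, add_zero, add_zero, sub_neg_eq_add, ← mul_div_assoc] at this
  refine this.congr' ?_
  filter_upwards [eventually_gt_atTop 0, T0.eventually (lt_mem_nhds hI)] with n hn hJn
  have hn0 : (0 : ℝ) < n := by exact_mod_cast hn
  have hs : 0 < √(n : ℝ) := Real.sqrt_pos.2 hn0
  have q2 := siteRatio_pos h0 h1 B (d + e n) x₀
  have hM := momentIntegral_zero_pos h0 h1 (r n)
  have hZ : graphExpect (D n) (fun π => partitionFunction β B π) =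
      Real.exp (β * r n) / momentIntegral c (r n) 0 *
        ((siteRatio c B (d + e n) x₀ * siteRatio c B d x₀ ^ (n - 1)) * (J n / √n)) := by
    rw [graphExpect_partitionFunction_eq_integral hβ B (hdat n hn).2.1, hJdef]
    simp only
    rw [mul_div_cancel_left₀ _ hs.ne']
    unfold momentIntegrand
    rw [MeasureTheory.integral_div, mul_div_cancel₀ _ (by positivity)]
    simp only [pow_zero]
    rfl
  have hJn' : 0 < J n := hJn
  rw [pressure, hZ, Real.log_mul (by positivity) (by positivity),
    Real.log_mul (by positivity) (by positivity), Real.log_mul (by positivity) (by positivity),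
    Real.log_div (by positivity) (by positivity), Real.log_div (by positivity) (by positivity),
    Real.log_exp, Real.log_pow, Real.log_sqrt hn0.le, Nat.cast_sub (by omega), Nat.cast_one,
    siteRatio_eq_exp (d := d) h0 h1 hx₀, Real.log_exp]
  ring

end

/-! ### The variational formula for the limiting pressure -/

section Variational

variable {β s : ℝ}

lemma exp_neg_four_mul (β : ℝ) : Real.exp (-4 * β) = Real.exp (-2 * β) ^ 2 := by
  rw [← Real.exp_nat_mul]; congr 1; push_cast; ring

lemma exp_neg_two_mul_lt_one (hβ : 0 < β) : Real.exp (-2 * β) < 1 := by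
  rw [Real.exp_lt_one_iff]; linarith

lemma discr_eq (β s : ℝ) : 1 + (Real.exp (-4 * β) - 1) * (1 - 2 * s) ^ 2 =
    (Real.exp (-2 * β) * (1 - 2 * s)) ^ 2 + 4 * s * (1 - s) := by
  rw [exp_neg_four_mul]; ring

lemma discr_pos (hs0 : 0 ≤ s) (hs1 : s < 1) :
    0 < 1 + (Real.exp (-4 * β) - 1) * (1 - 2 * s) ^ 2 := by
  rw [discr_eq]
  rcases hs0.eq_or_lt with rfl | hs
  · have := Real.exp_pos (-2 * β)
    simp only [mul_zero, sub_zero, mul_one, add_zero]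
    positivity
  · have := mul_pos hs (sub_pos.2 hs1)
    nlinarith [sq_nonneg (Real.exp (-2 * β) * (1 - 2 * s))]

lemma fFun_pos (hs0 : 0 ≤ s) (hs1 : s < 1) : 0 < fFun β s := by
  have hc := Real.exp_pos (-2 * β)
  have h1 : 0 < 2 * (1 - s) := by linarith
  refine div_pos ?_ h1
  rw [discr_eq]
  rcases hs0.eq_or_lt with rfl | hs
  · have := Real.sqrt_nonneg ((Real.exp (-2 * β) * (1 - 2 * 0)) ^ 2 + 4 * 0 * (1 - 0))
    simp only [mul_zero, sub_zero, mul_one] at this ⊢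
    linarith
  · have : |Real.exp (-2 * β) * (1 - 2 * s)| <
        √((Real.exp (-2 * β) * (1 - 2 * s)) ^ 2 + 4 * s * (1 - s)) := by
      rw [← Real.sqrt_sq_eq_abs]
      refine Real.sqrt_lt_sqrt (sq_nonneg _) ?_
      nlinarith
    linarith [neg_abs_le (Real.exp (-2 * β) * (1 - 2 * s))]

/-- `fFun β s` solves the stationarity condition of `x ↦ s * log x - log (quad c x) / 2`. -/
lemma mul_quad_fFun (hs0 : 0 ≤ s) (hs1 : s < 1) :
    s * quad (Real.exp (-2 * β)) (fFun β s) = fFun β s * (fFun β s - Real.exp (-2 * β)) := by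
  have h1 : 2 * (1 - s) ≠ 0 := by linarith
  have hsq := Real.sq_sqrt (discr_pos (β := β) hs0 hs1).le
  have hf : fFun β s * (2 * (1 - s)) - Real.exp (-2 * β) * (1 - 2 * s) =
      √(1 + (Real.exp (-4 * β) - 1) * (1 - 2 * s) ^ 2) := by
    rw [fFun, div_mul_cancel₀ _ h1]; ring
  rw [← hf, discr_eq] at hsq
  unfold quad
  apply mul_left_cancel₀ h1
  linear_combination (-1 / 2) * hsq

/-- The stationarity condition has only one positive solution. -/
lemma fFun_eq (hs0 : 0 < s) (hs1 : s < 1) {x : ℝ} (hx : 0 < x)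
    (h : s * quad (Real.exp (-2 * β)) x = x * (x - Real.exp (-2 * β))) : fFun β s = x := by
  have h2 := mul_quad_fFun (β := β) hs0.le hs1
  have hf := fFun_pos (β := β) hs0.le hs1
  unfold quad at h h2
  have : (fFun β s - x) * ((1 - s) * (fFun β s * x) + s) = 0 := by
    linear_combination fFun β s * h - x * h2
  rcases mul_eq_zero.1 this with h | h
  · linarith
  · have : 0 < (1 - s) * (fFun β s * x) := mul_pos (by linarith) (mul_pos hf hx)
    linarith

/-- The symmetry of `f` that makes the definition of `F` through `min t (1 - t)` consistent with the
closed form. -/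
lemma fFun_one_sub (hs0 : 0 < s) (hs1 : s < 1) : fFun β (1 - s) = (fFun β s)⁻¹ := by
  have hf := fFun_pos (β := β) hs0.le hs1
  refine fFun_eq (by linarith) (by linarith) (inv_pos.2 hf) ?_
  rw [quad_inv _ hf.ne']
  have := mul_quad_fFun (β := β) hs0.le hs1
  unfold quad at this ⊢
  generalize Real.exp (-2 * β) = c at this ⊢
  field_simp
  linear_combination -this

lemma differentiableAt_fFun (hs0 : 0 ≤ s) (hs1 : s < 1) : DifferentiableAt ℝ (fFun β) s := by
  unfold fFun
  refine DifferentiableAt.fun_div ?_ (by fun_prop) (by linarith)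
  refine DifferentiableAt.fun_add (by fun_prop) (DifferentiableAt.sqrt (by fun_prop) ?_)
  exact (discr_pos hs0 hs1).ne'

lemma continuousOn_log_fFun : ContinuousOn (fun s => Real.log (fFun β s)) (Icc 0 (1 / 2)) :=
  fun s hs => ((differentiableAt_fFun hs.1 (by linarith [hs.2])).continuousAt.log
    (fFun_pos hs.1 (by linarith [hs.2])).ne').continuousWithinAt

/-- The function `F` in closed form, as the maximum of `x ↦ s * log x - log (quad c x) / 2`. -/
lemma FFun_eq (hβ : 0 < β) (hs0 : 0 ≤ s) (hs1 : s < 1) :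
    FFun β s = s * Real.log (fFun β s) - 1 / 2 * Real.log (quad (Real.exp (-2 * β)) (fFun β s)) +
      1 / 2 * Real.log (1 - Real.exp (-2 * β) ^ 2) := by
  set c := Real.exp (-2 * β) with hc
  have h0 : 0 ≤ c := (Real.exp_pos _).le
  have h1 : c < 1 := exp_neg_two_mul_lt_one hβ
  set G : ℝ → ℝ := fun s => s * Real.log (fFun β s) - 1 / 2 * Real.log (quad c (fFun β s)) with hG
  have hder : ∀ t, 0 ≤ t → t < 1 → HasDerivAt G (Real.log (fFun β t)) t := by
    intro t ht0 ht1
    have hf := (differentiableAt_fFun (β := β) ht0 ht1).hasDerivAt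
    have hfp := (fFun_pos (β := β) ht0 ht1).ne'
    have hq := (quad_pos h0 h1 (fFun β t)).ne'
    have e := mul_quad_fFun (β := β) ht0 ht1
    have hqf : HasDerivAt (fun t => quad c (fFun β t)) (2 * (fFun β t - c) * deriv (fFun β) t) t :=
      (hasDerivAt_quad c (fFun β t)).comp t hf
    refine (((hasDerivAt_id' t).mul (hf.log hfp)).sub
      ((hqf.log hq).const_mul (1 / 2))).congr_deriv ?_
    have e' : t / fFun β t = (fFun β t - c) / quad c (fFun β t) := by
      rw [div_eq_div_iff hfp hq, e]; ring
    linear_combination (deriv (fFun β) t) * e'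
  have hhalf : ∀ t, 0 ≤ t → t ≤ 1 / 2 → FFun β t = G t + 1 / 2 * Real.log (1 - c ^ 2) := by
    intro t ht0 ht1
    have hm : min t (1 - t) = t := min_eq_left (by linarith)
    have hsub : Icc 0 t ⊆ Icc 0 (1 / 2) := Icc_subset_Icc_right ht1
    rw [FFun, hm, intervalIntegral.integral_eq_sub_of_hasDerivAt_of_le ht0
      (fun u hu => (hder u hu.1 (by linarith [hu.2])).continuousAt.continuousWithinAt)
      (fun u hu => hder u hu.1.le (by linarith [hu.2]))
      ((continuousOn_log_fFun.mono hsub).intervalIntegrable_of_Icc ht0)]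
    have hf0 : fFun β 0 = c := by
      rw [fFun, discr_eq]
      simp only [mul_zero, sub_zero, mul_one, add_zero]
      rw [Real.sqrt_sq h0]; ring
    have : G 0 = -(1 / 2 * Real.log (1 - c ^ 2)) := by
      simp only [hG, hf0, zero_mul, zero_sub, quad]
      ring_nf
    rw [this]; ring
  rcases le_or_gt s (1 / 2) with h | h
  · exact hhalf s hs0 h
  · have hs : 0 < s := by linarith
    have e1 : FFun β s = FFun β (1 - s) := by
      unfold FFun; rw [sub_sub_cancel, min_comm]
    have hf := fFun_pos (β := β) hs.le hs1
    rw [e1, hhalf (1 - s) (by linarith) (by linarith)]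
    congr 1
    simp only [hG]
    rw [fFun_one_sub hs hs1, quad_inv _ hf.ne', Real.log_inv,
      Real.log_div (quad_pos h0 h1 _).ne' (by positivity), Real.log_pow]
    push_cast; ring

/-- The Gibbs variational principle for two states. -/
lemma entropy_add_le {A C t : ℝ} (hA : 0 < A) (hC : 0 < C) (ht0 : 0 ≤ t) (ht1 : t < 1) :
    (t - 1) * Real.log (1 - t) - t * Real.log t + t * Real.log A + (1 - t) * Real.log C ≤
      Real.log (A + C) := by
  rcases ht0.eq_or_lt with rfl | ht
  · simp
    exact Real.log_le_log hC (by linarith)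
  have h1 : 0 < 1 - t := by linarith
  have e1 := Real.log_le_sub_one_of_pos (show 0 < A / (t * (A + C)) by positivity)
  have e2 := Real.log_le_sub_one_of_pos (show 0 < C / ((1 - t) * (A + C)) by positivity)
  rw [Real.log_div hA.ne' (by positivity), Real.log_mul ht.ne' (by positivity)] at e1
  rw [Real.log_div hC.ne' (by positivity), Real.log_mul h1.ne' (by positivity)] at e2
  have e1' := mul_le_mul_of_nonneg_left e1 ht.le
  have e2' := mul_le_mul_of_nonneg_left e2 h1.le
  have : t * (A / (t * (A + C)) - 1) + (1 - t) * (C / ((1 - t) * (A + C)) - 1) = 0 := by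
    field_simp; ring
  linarith

lemma entropy_add_eq {A C : ℝ} (hA : 0 < A) (hC : 0 < C) {t : ℝ} (ht : t = A / (A + C)) :
    (t - 1) * Real.log (1 - t) - t * Real.log t + t * Real.log A + (1 - t) * Real.log C =
      Real.log (A + C) := by
  have e : 1 - t = C / (A + C) := by rw [ht]; field_simp; ring
  have l1 : Real.log t = Real.log A - Real.log (A + C) := by
    rw [ht, Real.log_div hA.ne' (by positivity)]
  have l2 : Real.log (1 - t) = Real.log C - Real.log (A + C) := by
    rw [e, Real.log_div hC.ne' (by positivity)]
  rw [l1, l2]; ring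

lemma continuousOn_FFun (β : ℝ) : ContinuousOn (FFun β) (Icc 0 1) := by
  have h1 : ContinuousOn (fun t => ∫ s in (0 : ℝ)..t, Real.log (fFun β s)) (Icc 0 (1 / 2)) := by
    have h := intervalIntegral.continuousOn_primitive_interval (μ := MeasureTheory.volume)
      (f := fun s => Real.log (fFun β s)) (a := 0) (b := 1 / 2) (by
        rw [uIcc_of_le (by norm_num)]
        exact continuousOn_log_fFun.integrableOn_Icc)
    rwa [uIcc_of_le (by norm_num)] at h
  refine h1.comp (f := fun t : ℝ => min t (1 - t)) (by fun_prop) fun t ht => ⟨?_, ?_⟩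
  · exact le_min ht.1 (by linarith [ht.2])
  · rcases le_total t (1 / 2) with h | h
    · exact (min_le_left _ _).trans h
    · exact (min_le_right _ _).trans (by linarith)

/-- The supremum in the limiting pressure is attained. -/
theorem isGreatest_objective (d : ℕ) (β B : ℝ) :
    IsGreatest (objective d β B '' Icc 0 1) (sSup (objective d β B '' Icc 0 1)) := by
  have hcont : ContinuousOn (objective d β B) (Icc 0 1) := by
    have h : ContinuousOn (fun t => Real.negMulLog (1 - t) + Real.negMulLog t + 2 * B * t +
        (d : ℝ) * FFun β t) (Icc 0 1) := by
      have h1 : Continuous fun t : ℝ => Real.negMulLog (1 - t) + Real.negMulLog t + 2 * B * t := by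
        have := Real.continuous_negMulLog
        fun_prop
      exact h1.continuousOn.add ((continuousOn_FFun β).const_mul _)
    refine h.congr fun t _ => ?_
    simp only [objective, Real.negMulLog]; ring
  have hne : (Icc (0 : ℝ) 1).Nonempty := ⟨0, by simp⟩
  exact (isCompact_Icc.image_of_continuousOn hcont).isGreatest_sSup (hne.image _)

variable {d : ℕ} {B x₀ : ℝ}

/-- Half of the variational formula: `FFun_eq` and the Gibbs inequality bound the objective at `t`
by the logarithm of the integrand at `fFun β t`. -/
lemma objective_le (hβ : 0 < β) (h : IsRegularMax (Real.exp (-2 * β)) d B x₀)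
    {t : ℝ} (ht0 : 0 ≤ t) (ht1 : t ≤ 1) :
    objective d β B t ≤ B + d / 2 * Real.log (1 - Real.exp (-2 * β) ^ 2) +
      logRatio (Real.exp (-2 * β)) B d x₀ := by
  set c := Real.exp (-2 * β) with hc
  have hc0 : 0 < c := Real.exp_pos _
  have h1 : c < 1 := exp_neg_two_mul_lt_one hβ
  have hmax : ∀ x, 0 < x → logRatio c B d x ≤ logRatio c B d x₀ := by
    intro x hx
    rw [← Real.exp_le_exp, ← siteRatio_eq_exp hc0.le h1 hx,
      ← siteRatio_eq_exp hc0.le h1 (h.pos hc0.le)]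
    rcases eq_or_ne x x₀ with rfl | hne
    · exact le_rfl
    · exact (h.siteRatio_lt x hne).le
  have hc2 : 0 < 1 - c ^ 2 := by nlinarith
  rcases ht1.eq_or_lt with rfl | ht1
  -- The value `t = 1` corresponds to the point `c⁻¹`.
  · have h2 := hmax c⁻¹ (inv_pos.2 hc0)
    have hF : FFun β 1 = 0 := by simp [FFun]
    have hq : quad c c⁻¹ = (1 - c ^ 2) / c ^ 2 := by unfold quad; field_simp; ring
    have hw : Real.log (Real.exp B * c⁻¹ ^ d) ≤ Real.log (siteWeight B d c⁻¹) :=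
      Real.log_le_log (by positivity) (by unfold siteWeight; linarith [Real.exp_pos (-B)])
    rw [Real.log_mul (by positivity) (by positivity), Real.log_exp, Real.log_pow,
      Real.log_inv] at hw
    rw [logRatio, hq, Real.log_div hc2.ne' (by positivity), Real.log_pow] at h2
    push_cast at h2
    simp only [objective, hF, sub_self, zero_mul, Real.log_one, mul_zero, mul_one, add_zero,
      zero_add]
    linarith
  have hf := fFun_pos (β := β) ht0 ht1
  have h2 := hmax _ hf
  have h3 := entropy_add_le (show 0 < Real.exp B * fFun β t ^ d by positivity)
    (Real.exp_pos (-B)) ht0 ht1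
  rw [Real.log_mul (by positivity) (by positivity), Real.log_exp, Real.log_exp,
    Real.log_pow] at h3
  rw [objective, FFun_eq hβ ht0 ht1]
  rw [logRatio, siteWeight] at h2
  linarith

/-- The other half: equality holds if `t` is the probability of a plus spin at the maximizer `x₀`,
for which `fFun β t = x₀`. -/
lemma exists_objective_eq (hβ : 0 < β) (hd : d ≠ 0)
    (h : IsRegularMax (Real.exp (-2 * β)) d B x₀) :
    ∃ t ∈ Icc (0 : ℝ) 1, objective d β B t = B + d / 2 * Real.log (1 - Real.exp (-2 * β) ^ 2) +
      logRatio (Real.exp (-2 * β)) B d x₀ := by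
  set c := Real.exp (-2 * β) with hc
  have hc0 : 0 < c := Real.exp_pos _
  have h1 : c < 1 := exp_neg_two_mul_lt_one hβ
  have hx := h.pos hc0.le
  have hA : 0 < Real.exp B * x₀ ^ d := by positivity
  have hC := Real.exp_pos (-B)
  set t := Real.exp B * x₀ ^ d / (Real.exp B * x₀ ^ d + Real.exp (-B)) with ht
  have ht0 : 0 < t := by positivity
  have ht1 : t < 1 := by rw [ht, div_lt_one (by positivity)]; linarith
  have hf : fFun β t = x₀ := by
    refine fFun_eq ht0 ht1 hx ?_
    have hn := h.critNum_eq hc0.le hd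
    obtain ⟨k, rfl⟩ : ∃ k, d = k + 1 := ⟨d - 1, by omega⟩
    simp only [critNum, Nat.add_sub_cancel] at hn
    rw [ht, div_mul_eq_mul_div, div_eq_iff (by positivity), quad]
    linear_combination x₀ * hn
  refine ⟨t, ⟨ht0.le, ht1.le⟩, ?_⟩
  have h3 := entropy_add_eq hA hC ht
  rw [Real.log_mul (by positivity) (by positivity), Real.log_exp, Real.log_exp,
    Real.log_pow] at h3
  rw [objective, FFun_eq hβ ht0.le ht1, hf, logRatio, siteWeight]
  linarith

/-- The limiting pressure in terms of the maximizer of the integrand. -/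
theorem limitPressure_eq (hβ : 0 < β) (hd : d ≠ 0)
    (h : IsRegularMax (Real.exp (-2 * β)) d B x₀) :
    limitPressure d β B = β * d / 2 + d / 2 * Real.log (1 - Real.exp (-2 * β) ^ 2) +
      logRatio (Real.exp (-2 * β)) B d x₀ := by
  obtain ⟨t, ht, hobj⟩ := exists_objective_eq hβ hd h
  have hg : IsGreatest (objective d β B '' Icc 0 1) (B + d / 2 *
      Real.log (1 - Real.exp (-2 * β) ^ 2) + logRatio (Real.exp (-2 * β)) B d x₀) := by
    refine ⟨⟨t, ht, hobj⟩, ?_⟩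
    rintro _ ⟨u, hu, rfl⟩
    exact objective_le hβ h hu.1 hu.2
  rw [limitPressure, hg.csSup_eq]
  ring

lemma FFun_zero_eq {t : ℝ} (ht0 : 0 ≤ t) (ht1 : t ≤ 1) : FFun 0 t = 0 := by
  have : ∀ s ∈ uIcc 0 (min t (1 - t)), Real.log (fFun 0 s) = 0 := by
    intro s hs
    have hm : min t (1 - t) ≤ 1 / 2 := by
      rcases le_total t (1 / 2) with h | h
      · exact (min_le_left _ _).trans h
      · exact (min_le_right _ _).trans (by linarith)
    rw [uIcc_of_le (le_min ht0 (by linarith))] at hs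
    have h1 : 2 * (1 - s) ≠ 0 := by linarith [hs.2]
    have : fFun 0 s = 1 := by
      rw [fFun]
      simp only [mul_zero, Real.exp_zero, sub_self, zero_mul, add_zero, Real.sqrt_one]
      rw [div_eq_one_iff_eq h1]; ring
    rw [this, Real.log_one]
  rw [FFun, intervalIntegral.integral_congr (g := fun _ => 0) this]
  simp

/-- The pressure of independent spins. -/
theorem limitPressure_zero (d : ℕ) (B : ℝ) :
    limitPressure d 0 B = Real.log (Real.exp B + Real.exp (-B)) := by
  have hA := Real.exp_pos B
  have hC := Real.exp_pos (-B)
  have hg : IsGreatest (objective d 0 B '' Icc 0 1)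
      (B + Real.log (Real.exp B + Real.exp (-B))) := by
    constructor
    · set t := Real.exp B / (Real.exp B + Real.exp (-B)) with ht
      have ht0 : 0 < t := by positivity
      have ht1 : t < 1 := by rw [ht, div_lt_one (by positivity)]; linarith
      refine ⟨t, ⟨ht0.le, ht1.le⟩, ?_⟩
      have := entropy_add_eq hA hC ht
      rw [Real.log_exp, Real.log_exp] at this
      rw [objective, FFun_zero_eq ht0.le ht1.le]
      linarith
    · rintro _ ⟨t, ht, rfl⟩
      rw [objective, FFun_zero_eq ht.1 ht.2]
      rcases ht.2.eq_or_lt with rfl | ht1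
      · have : B ≤ Real.log (Real.exp B + Real.exp (-B)) := by
          conv_lhs => rw [← Real.log_exp B]
          exact Real.log_le_log hA (by linarith)
        simp; linarith
      · have := entropy_add_le hA hC ht.1 ht1
        rw [Real.log_exp, Real.log_exp] at this
        linarith
  rw [limitPressure, hg.csSup_eq]
  ring

end Variational

/-! ### Derivatives of the limiting pressure -/

/-- The nondegenerate maximizer as a function of the field `B` (an arbitrary value if there is
none). -/
def maxPoint (c : ℝ) (d : ℕ) (B : ℝ) : ℝ := Classical.epsilon (IsRegularMax c d B)

section Derivatives

variable {c B x : ℝ} {d : ℕ}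

lemma IsRegularMax.maxPoint_eq (h : IsRegularMax c d B x) : maxPoint c d B = x := by
  have h' : IsRegularMax c d B (maxPoint c d B) :=
    Classical.epsilon_spec (p := IsRegularMax c d B) ⟨x, h⟩
  by_contra hne
  have h1 := h.siteRatio_lt _ hne
  have h2 := h'.siteRatio_lt _ (Ne.symm hne)
  linarith

lemma isRegularMax_maxPoint (h : ∃ x, IsRegularMax c d B x) :
    IsRegularMax c d B (maxPoint c d B) :=
  Classical.epsilon_spec (p := IsRegularMax c d B) h

lemma siteRatio_le_exp_mul (c : ℝ) (d : ℕ) (B B' x : ℝ) :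
    siteRatio c B' d x ≤ Real.exp |B' - B| * siteRatio c B d x := by
  rw [siteRatio, siteRatio, ← mul_div_assoc]
  refine div_le_div_of_nonneg_right ?_ (by positivity)
  have e1 : Real.exp B' ≤ Real.exp |B' - B| * Real.exp B := by
    rw [← Real.exp_add, Real.exp_le_exp]; linarith [le_abs_self (B' - B)]
  have e2 : Real.exp (-B') ≤ Real.exp |B' - B| * Real.exp (-B) := by
    rw [← Real.exp_add, Real.exp_le_exp]; linarith [neg_abs_le (B' - B)]
  have := mul_le_mul_of_nonneg_right e1 (pow_nonneg (abs_nonneg x) d)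
  unfold siteWeight
  linarith

/-- A small change of the field multiplies the integrand by a factor close to `1`, and so cannot
move the maximizer far. -/
lemma IsRegularMax.continuousAt_maxPoint (h0 : 0 ≤ c) (h1 : c < 1) (hd : d ≠ 0)
    (h : IsRegularMax c d B x) (hev : ∀ᶠ B' in 𝓝 B, ∃ x, IsRegularMax c d B' x) :
    ContinuousAt (maxPoint c d) B := by
  rw [ContinuousAt, h.maxPoint_eq, Metric.tendsto_nhds]
  intro δ hδ
  obtain ⟨ρ, hρ0, hρ1, hρ⟩ := h.exists_lt_of_le_abs_sub h0 h1 hd hδ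
  have hlim : Tendsto (fun B' => Real.exp |B - B'| * (Real.exp |B' - B| * ρ)) (𝓝 B) (𝓝 ρ) := by
    have : Continuous fun B' => Real.exp |B - B'| * (Real.exp |B' - B| * ρ) := by fun_prop
    simpa using this.tendsto B
  filter_upwards [hev, hlim.eventually_lt_const hρ1] with B' hB' hlt
  have hx' := isRegularMax_maxPoint hB'
  by_contra hfar
  rw [not_lt, Real.dist_eq] at hfar
  have hne : x ≠ maxPoint c d B' := by
    rintro rfl
    rw [sub_self, abs_zero] at hfar
    linarith
  have a1 := hx'.siteRatio_lt _ hne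
  have a2 := siteRatio_le_exp_mul c d B B' (maxPoint c d B')
  have a3 := hρ _ hfar
  have a4 := siteRatio_le_exp_mul c d B' B x
  have hpos := siteRatio_pos h0 h1 B' d x
  have a5 := mul_le_mul_of_nonneg_left (a3.trans (mul_le_mul_of_nonneg_left a4 hρ0.le))
    (Real.exp_pos |B' - B|).le
  nlinarith

/-- Implicit differentiation of the critical equation. -/
lemma IsRegularMax.hasDerivAt_maxPoint (h0 : 0 ≤ c) (h1 : c < 1) (hd : d ≠ 0)
    (h : IsRegularMax c d B x) (hev : ∀ᶠ B' in 𝓝 B, ∃ x, IsRegularMax c d B' x) :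
    HasDerivAt (maxPoint c d) (2 / critSlope c d x) B := by
  have hcont := h.continuousAt_maxPoint h0 h1 hd hev
  have hc := (hasDerivAt_critFun (d := d) h.lt_self (h.pos h0) h.mul_lt_one).div_const 2
  rw [← h.maxPoint_eq] at hc
  have := HasDerivAt.of_local_left_inverse hcont hc
    (by rw [h.maxPoint_eq]; exact div_ne_zero h.critSlope_pos.ne' two_ne_zero) (by
      filter_upwards [hev] with B' hB'
      rw [(isRegularMax_maxPoint hB').critFun_eq]; ring)
  rwa [h.maxPoint_eq, inv_div] at this

lemma hasDerivAt_siteWeight_comp {X : ℝ → ℝ} {X' : ℝ} (hX : HasDerivAt X X' B) (hX0 : 0 < X B) :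
    HasDerivAt (fun B => siteWeight B d (X B))
      (siteWeight B d (X B) * siteMean B d (X B) + Real.exp B * X B ^ d * (d / X B) * X') B := by
  have h := ((Real.hasDerivAt_exp B).mul (hX.pow d)).add (hasDerivAt_neg B).exp
  refine h.congr_deriv ?_
  rw [siteMean, mul_div_cancel₀ _ (siteWeight_pos B d hX0.le).ne']
  have hpow : (d : ℝ) * X B ^ (d - 1) = X B ^ d * (d / X B) := by
    rcases d with _ | k
    · simp
    · simp only [Nat.add_sub_cancel, pow_succ]; field_simp
  simp only [Pi.pow_apply]
  linear_combination Real.exp B * X' * hpow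

/-- The contribution of the moving maximizer to the derivative vanishes. -/
lemma IsRegularMax.hasDerivAt_logRatio_maxPoint (h0 : 0 ≤ c) (h1 : c < 1) (hd : d ≠ 0)
    (h : IsRegularMax c d B x) (hev : ∀ᶠ B' in 𝓝 B, ∃ x, IsRegularMax c d B' x) :
    HasDerivAt (fun B => logRatio c B d (maxPoint c d B)) (siteMean B d x) B := by
  have hx := h.pos h0
  have hX := h.hasDerivAt_maxPoint h0 h1 hd hev
  have hXB := h.maxPoint_eq
  have hw := hasDerivAt_siteWeight_comp (d := d) hX (by rwa [hXB])
  have hq : HasDerivAt (fun B => quad c (maxPoint c d B))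
      (2 * (maxPoint c d B - c) * (2 / critSlope c d x)) B :=
    (hasDerivAt_quad c (maxPoint c d B)).comp B hX
  rw [hXB] at hw hq
  have hw0 := (siteWeight_pos B d hx.le).ne'
  have hq0 := (quad_pos h0 h1 x).ne'
  refine ((hw.log (by rwa [hXB])).sub ((hq.log (by rwa [hXB])).const_mul _)).congr_deriv ?_
  simp only [hXB]
  have hn := h.critNum_eq h0 hd
  have key : Real.exp B * x ^ d * quad c x = x * (x - c) * siteWeight B d x := by
    obtain ⟨k, rfl⟩ : ∃ k, d = k + 1 := ⟨d - 1, by omega⟩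
    simp only [critNum, Nat.add_sub_cancel] at hn
    unfold quad siteWeight
    linear_combination x * hn
  have e : Real.exp B * x ^ d / siteWeight B d x = x * (x - c) / quad c x := by
    rw [div_eq_div_iff hw0 hq0, key]
  rw [add_div, mul_div_cancel_left₀ _ hw0]
  have e2 : Real.exp B * x ^ d * (d / x) * (2 / critSlope c d x) / siteWeight B d x =
      (Real.exp B * x ^ d / siteWeight B d x) * (d / x) * (2 / critSlope c d x) := by ring
  rw [e2, e]
  field_simp
  ring

/-- The derivative of the magnetization is the limit of the susceptibilities. -/
lemma IsRegularMax.hasDerivAt_siteMean_maxPoint (h0 : 0 ≤ c) (h1 : c < 1) (hd : d ≠ 0)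
    (h : IsRegularMax c d B x) (hev : ∀ᶠ B' in 𝓝 B, ∃ x, IsRegularMax c d B' x) :
    HasDerivAt (fun B => siteMean B d (maxPoint c d B))
      (siteMeanDeriv B d x ^ 2 / curvature c B d x + (1 - siteMean B d x ^ 2)) B := by
  have hx := h.pos h0
  have hX := h.hasDerivAt_maxPoint h0 h1 hd hev
  have hXB := h.maxPoint_eq
  have hw := hasDerivAt_siteWeight_comp (d := d) hX (by rwa [hXB])
  have hw0 := (siteWeight_pos B d hx.le).ne'
  have hq0 := (quad_pos h0 h1 x).ne'
  have hnum : HasDerivAt (fun B => Real.exp B * maxPoint c d B ^ d - Real.exp (-B))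
      (siteWeight B d x * siteMean B d x + Real.exp B * x ^ d * (d / x) * (2 / critSlope c d x) +
        2 * Real.exp (-B)) B := by
    have h2 := hw.sub ((hasDerivAt_neg B).exp.const_mul 2)
    rw [hXB] at h2
    refine (h2.congr_of_eventuallyEq (.of_forall fun B' => ?_)).congr_deriv ?_
    · simp only [siteWeight, Pi.sub_apply]; ring
    · ring
  rw [hXB] at hw
  refine (hnum.div hw (by rwa [hXB])).congr_deriv ?_
  simp only [hXB]
  have hs := h.critSlope_pos.ne'
  have hxc : x - c ≠ 0 := (sub_pos.2 h.lt_self).ne'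
  have hn := h.critNum_eq h0 hd
  have key : Real.exp B * x ^ d * quad c x = x * (x - c) * siteWeight B d x := by
    obtain ⟨k, rfl⟩ : ∃ k, d = k + 1 := ⟨d - 1, by omega⟩
    simp only [critNum, Nat.add_sub_cancel] at hn
    unfold quad siteWeight
    linear_combination x * hn
  have hE := (Real.exp_pos (-B)).ne'
  have hd0 : (d : ℝ) ≠ 0 := by exact_mod_cast hd
  have hm1 : 1 - siteMean B d x ^ 2 =
      4 * (Real.exp B * x ^ d) * Real.exp (-B) / siteWeight B d x ^ 2 := by
    rw [siteMean, div_pow, eq_div_iff (pow_ne_zero _ hw0), sub_mul,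
      div_mul_cancel₀ _ (pow_ne_zero _ hw0)]
    unfold siteWeight; ring
  -- The derivative of the maximizer is the derivative of the mean divided by the curvature.
  have hratio : siteMeanDeriv B d x / curvature c B d x = 2 / critSlope c d x := by
    have hcurv := (h.curvature_pos h0 h1 hd).ne'
    rw [div_eq_div_iff hcurv hs, siteMeanDeriv, hm1, curvature]
    field_simp
    linear_combination 4 * key
  have hsum : siteMeanDeriv B d x ^ 2 / curvature c B d x =
      siteMeanDeriv B d x * (2 / critSlope c d x) := by rw [← hratio]; ring
  rw [hsum, siteMeanDeriv, hm1]
  have hm : Real.exp B * x ^ d - Real.exp (-B) = siteWeight B d x * siteMean B d x := by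
    rw [siteMean, mul_div_cancel₀ _ hw0]
  rw [hm]
  have hm2 : siteWeight B d x * siteMean B d x = siteWeight B d x - 2 * Real.exp (-B) := by
    rw [← hm]; unfold siteWeight; ring
  rw [hm2]
  have hA : Real.exp B * x ^ d = siteWeight B d x - Real.exp (-B) := by unfold siteWeight; ring
  rw [hA]
  field_simp
  ring

lemma limitPressure_hasDerivAt {β : ℝ} (hβ : 0 < β) (hd : d ≠ 0)
    (h : IsRegularMax (Real.exp (-2 * β)) d B x)
    (hev : ∀ᶠ B' in 𝓝 B, ∃ x, IsRegularMax (Real.exp (-2 * β)) d B' x) :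
    HasDerivAt (limitPressure d β) (siteMean B d x) B := by
  have h1 := exp_neg_two_mul_lt_one hβ
  refine ((h.hasDerivAt_logRatio_maxPoint (Real.exp_pos _).le h1 hd hev).const_add
    (β * d / 2 + d / 2 * Real.log (1 - Real.exp (-2 * β) ^ 2))).congr_of_eventuallyEq ?_
  filter_upwards [hev] with B' hB'
  exact limitPressure_eq hβ hd (isRegularMax_maxPoint hB')

lemma deriv_limitPressure_hasDerivAt {β : ℝ} (hβ : 0 < β) (hd : d ≠ 0)
    (h : IsRegularMax (Real.exp (-2 * β)) d B x)
    (hev : ∀ᶠ B' in 𝓝 B, ∃ x, IsRegularMax (Real.exp (-2 * β)) d B' x) :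
    HasDerivAt (deriv (limitPressure d β))
      (siteMeanDeriv B d x ^ 2 / curvature (Real.exp (-2 * β)) B d x +
        (1 - siteMean B d x ^ 2)) B := by
  have h1 := exp_neg_two_mul_lt_one hβ
  refine (h.hasDerivAt_siteMean_maxPoint (Real.exp_pos _).le h1 hd hev).congr_of_eventuallyEq ?_
  filter_upwards [hev, hev.eventually_nhds] with B' hB' hB''
  exact (limitPressure_hasDerivAt hβ hd (isRegularMax_maxPoint hB') hB'').deriv

lemma exists_isRegularMax_of_ne_zero (h0 : 0 < c) (h1 : c < 1) (hd : d ≠ 0) (hB : B ≠ 0) :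
    ∃ x, IsRegularMax c d B x := by
  rcases lt_or_gt_of_ne hB with hB | hB
  · obtain ⟨x, -, hx⟩ := exists_isRegularMax h0 h1 hd (neg_pos.2 hB)
    exact ⟨x⁻¹, by simpa using hx.inv h0.le hd⟩
  · obtain ⟨x, -, hx⟩ := exists_isRegularMax h0 h1 hd hB
    exact ⟨x, hx⟩

/-- Away from zero field, or below the critical point, there is a nondegenerate maximizer for all
nearby fields. -/
lemma eventually_exists_isRegularMax (h0 : 0 < c) (h1 : c < 1) (hd : d ≠ 0)
    (h : B ≠ 0 ∨ 0 < critSlope c d 1) : ∀ᶠ B' in 𝓝 B, ∃ x, IsRegularMax c d B' x := by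
  rcases h with hB | hs
  · filter_upwards [isOpen_ne.mem_nhds hB] with B' hB'
    exact exists_isRegularMax_of_ne_zero h0 h1 hd hB'
  · refine .of_forall fun B' => ?_
    rcases eq_or_ne B' 0 with rfl | hB'
    · exact ⟨1, isRegularMax_one h0 h1 hd hs⟩
    · exact exists_isRegularMax_of_ne_zero h0 h1 hd hB'

end Derivatives

/-! ### Spontaneous magnetization and the critical inverse temperature -/

section Critical

variable {c : ℝ} {d : ℕ}

lemma critSlope_one_pos_iff (h1 : c < 1) :
    0 < critSlope c d 1 ↔ (d : ℝ) - 2 < d * c := by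
  have h : 0 < 1 - c := by linarith
  rw [critSlope_one h1, sub_pos, lt_div_iff₀ h]
  constructor <;> intro h <;> linarith

lemma critSlope_one_neg_iff (h1 : c < 1) :
    critSlope c d 1 < 0 ↔ d * c < (d : ℝ) - 2 := by
  have h : 0 < 1 - c := by linarith
  rw [critSlope_one h1, sub_neg, div_lt_iff₀ h]
  constructor <;> intro h <;> linarith

lemma one_lt_maxPoint (h0 : 0 < c) (h1 : c < 1) (hd : d ≠ 0) {B : ℝ} (hB : 0 < B) :
    1 < maxPoint c d B := by
  obtain ⟨x, hx, h⟩ := exists_isRegularMax h0 h1 hd hB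
  rwa [h.maxPoint_eq]

/-- By `critFun_lt_two_mul`, there are no critical points of a larger field between `1` and the
maximizer of a smaller one. -/
lemma monotoneOn_maxPoint (h0 : 0 < c) (h1 : c < 1) (hd : d ≠ 0) :
    MonotoneOn (maxPoint c d) (Ioi 0) := by
  intro B hB B' hB' hBB
  by_contra! hlt
  have h := isRegularMax_maxPoint (exists_isRegularMax_of_ne_zero h0 h1 hd (ne_of_gt hB))
  have h' := isRegularMax_maxPoint (exists_isRegularMax_of_ne_zero h0 h1 hd (ne_of_gt hB'))
  have := critFun_lt_two_mul h0 h1 hB h.mul_lt_one h.critFun_eq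
    (one_lt_maxPoint h0 h1 hd hB').le hlt
  rw [h'.critFun_eq] at this
  linarith

/-- As the field decreases to zero, the maximizer tends to a limit, which is nontrivial exactly
above the critical point. -/
lemma exists_tendsto_maxPoint (h0 : 0 < c) (h1 : c < 1) (hd : d ≠ 0) :
    ∃ ℓ, 1 ≤ ℓ ∧ Tendsto (maxPoint c d) (𝓝[>] 0) (𝓝 ℓ) ∧ (1 < ℓ ↔ d * c < (d : ℝ) - 2) := by
  have hmono := monotoneOn_maxPoint h0 h1 hd
  have hbdd : BddBelow (maxPoint c d '' Ioi 0) := ⟨1, by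
    rintro _ ⟨B, hB, rfl⟩
    exact (one_lt_maxPoint h0 h1 hd hB).le⟩
  have ht := hmono.tendsto_nhdsGT hbdd
  set ℓ := sInf (maxPoint c d '' Ioi 0) with hℓ
  have hle : ∀ B, 0 < B → ℓ ≤ maxPoint c d B := fun B hB => csInf_le hbdd ⟨B, hB, rfl⟩
  have hge : ∀ a, (∀ B, 0 < B → a ≤ maxPoint c d B) → a ≤ ℓ := fun a ha =>
    le_csInf ⟨_, 1, mem_Ioi.2 one_pos, rfl⟩ (by rintro _ ⟨B, hB, rfl⟩; exact ha B hB)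
  have hreg : ∀ B, 0 < B → IsRegularMax c d B (maxPoint c d B) := fun B hB =>
    isRegularMax_maxPoint (exists_isRegularMax_of_ne_zero h0 h1 hd hB.ne')
  refine ⟨ℓ, hge 1 fun B hB => (one_lt_maxPoint h0 h1 hd hB).le, ht, ?_⟩
  rw [← critSlope_one_neg_iff h1]
  constructor
  · intro hℓ1
    by_contra! hs
    have hcℓ : c * ℓ < 1 := by
      have := hle 1 one_pos
      nlinarith [(hreg 1 one_pos).mul_lt_one]
    have hpos := critFun_lt_of_lt (d := d) h0 h1 le_rfl hℓ1 hcℓ hs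
    rw [critFun_one h1] at hpos
    have hB : 0 < critFun c d ℓ / 4 := by positivity
    have hr := hreg _ hB
    have heq := hr.critFun_eq
    have hsl := critSlope_pos_of_critFun_pos h0 h1 hℓ1 hcℓ hpos
    rcases (hle _ hB).eq_or_lt with e | hlt
    · rw [← e] at heq; linarith
    · have := critFun_lt_of_lt (d := d) h0 h1 hℓ1.le hlt hr.mul_lt_one hsl.le
      linarith
  · intro hs
    have hder := hasDerivAt_critFun (c := c) (d := d) h1 one_pos (by linarith)
    have hev : ∀ᶠ u in 𝓝[>] (1 : ℝ), critFun c d u < 0 := by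
      have hsl := (hasDerivAt_iff_tendsto_slope.1 hder).mono_left
        (nhdsWithin_mono _ fun u (hu : 1 < u) => ne_of_gt hu)
      filter_upwards [hsl.eventually_lt_const hs, self_mem_nhdsWithin] with u hu hu1
      rw [slope_def_field, critFun_one h1, sub_zero] at hu
      have hu1' : 0 < u - 1 := sub_pos.2 hu1
      by_contra! hh
      exact absurd hu (not_lt.2 (div_nonneg hh hu1'.le))
    obtain ⟨b, hb, hbs⟩ := (mem_nhdsGT_iff_exists_Ioo_subset).1 hev
    refine lt_of_lt_of_le hb (hge b fun B hB => ?_)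
    by_contra! hlt
    have : critFun c d (maxPoint c d B) < 0 := hbs ⟨one_lt_maxPoint h0 h1 hd hB, hlt⟩
    rw [(hreg B hB).critFun_eq] at this
    linarith

variable {β : ℝ} {D : (n : ℕ) → Fin n → ℕ}

/-- The spontaneous magnetization exists, and it is positive exactly above the critical point. -/
lemma exists_isSpontaneousMagnetization (hβ : 0 < β) (hd : d ≠ 0)
    (hD : ∀ n, IsRegularDegrees d n (D n)) :
    ∃ m, IsSpontaneousMagnetization D β m ∧
      (0 < m ↔ d * Real.exp (-2 * β) < (d : ℝ) - 2) := by
  set c := Real.exp (-2 * β) with hc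
  have h0 : 0 < c := Real.exp_pos _
  have h1 : c < 1 := exp_neg_two_mul_lt_one hβ
  obtain ⟨ℓ, hℓ, ht, hiff⟩ := exists_tendsto_maxPoint h0 h1 hd
  have hℓ0 : 0 < ℓ := by linarith
  refine ⟨siteMean 0 d ℓ, ⟨fun B => siteMean B d (maxPoint c d B), fun B hB => ?_, ?_⟩, ?_⟩
  · have h := isRegularMax_maxPoint (exists_isRegularMax_of_ne_zero h0 h1 hd hB.ne')
    exact (h.tendsto_magnetization_susceptibility hβ hd hD).1
  · have hB : Tendsto (fun B : ℝ => B) (𝓝[>] 0) (𝓝 0) := nhdsWithin_le_nhds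
    have e1 := (Real.continuous_exp.tendsto _).comp hB
    have e2 := (Real.continuous_exp.tendsto _).comp hB.neg
    have hX := ht.pow d
    exact ((e1.mul hX).sub e2).div ((e1.mul hX).add e2) (siteWeight_pos 0 d hℓ0.le).ne'
  · rw [← hiff]
    have hw := siteWeight_pos 0 d hℓ0.le
    rw [siteMean, div_pos_iff_of_pos_right hw, neg_zero, Real.exp_zero, one_mul, sub_pos]
    exact one_lt_pow_iff_of_nonneg hℓ0.le hd

lemma setOf_spontaneousMagnetization_pos (hd : d ≠ 0) (hD : ∀ n, IsRegularDegrees d n (D n)) :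
    {β : ℝ | 0 < β ∧ ∃ m, IsSpontaneousMagnetization D β m ∧ 0 < m} =
      {β : ℝ | 0 < β ∧ d * Real.exp (-2 * β) < (d : ℝ) - 2} := by
  ext β
  refine and_congr_right fun hβ => ?_
  obtain ⟨m, hm, hiff⟩ := exists_isSpontaneousMagnetization hβ hd hD
  refine ⟨fun ⟨m', hm', hpos⟩ => hiff.1 ?_, fun h => ⟨m, hm, hiff.2 h⟩⟩
  obtain ⟨M, hM1, hM2⟩ := hm
  obtain ⟨M', hM1', hM2'⟩ := hm'
  have : m = m' := by
    refine tendsto_nhds_unique hM2 (hM2'.congr' ?_)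
    filter_upwards [self_mem_nhdsWithin] with B hB
    exact tendsto_nhds_unique (hM1' B hB) (hM1 B hB)
  rwa [this]

/-- The critical inverse temperature `log (d / (d - 2)) / 2`. -/
def critBeta (d : ℕ) : ℝ := 1 / 2 * Real.log ((d : ℝ) / ((d : ℝ) - 2))

lemma lt_critBeta_iff (hd : 3 ≤ d) : β < critBeta d ↔ (d : ℝ) - 2 < d * Real.exp (-2 * β) := by
  have hd3 : (3 : ℝ) ≤ d := by exact_mod_cast hd
  have hd2 : (0 : ℝ) < (d : ℝ) - 2 := by linarith
  have hd0 : (0 : ℝ) < d := by linarith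
  rw [← Real.log_lt_log_iff hd2 (by positivity), Real.log_mul hd0.ne' (Real.exp_pos _).ne',
    Real.log_exp, critBeta, Real.log_div hd0.ne' hd2.ne']
  constructor <;> intro h <;> linarith

lemma critBeta_lt_iff (hd : 3 ≤ d) : critBeta d < β ↔ d * Real.exp (-2 * β) < (d : ℝ) - 2 := by
  have hd3 : (3 : ℝ) ≤ d := by exact_mod_cast hd
  have hd2 : (0 : ℝ) < (d : ℝ) - 2 := by linarith
  have hd0 : (0 : ℝ) < d := by linarith
  rw [← Real.log_lt_log_iff (by positivity) hd2, Real.log_mul hd0.ne' (Real.exp_pos _).ne',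
    Real.log_exp, critBeta, Real.log_div hd0.ne' hd2.ne']
  constructor <;> intro h <;> linarith

lemma critBeta_pos (hd : 3 ≤ d) : 0 < critBeta d := by
  rw [lt_critBeta_iff hd]; simp

lemma artanh_eq_critBeta (hd : 3 ≤ d) : Real.artanh (1 / ((d : ℝ) - 1)) = critBeta d := by
  have hd3 : (3 : ℝ) ≤ d := by exact_mod_cast hd
  have h1 : (0 : ℝ) < (d : ℝ) - 1 := by linarith
  have hmem : 1 / ((d : ℝ) - 1) ∈ Icc (-1 : ℝ) 1 := by
    refine ⟨by linarith [one_div_pos.2 h1], ?_⟩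
    rw [div_le_one h1]; linarith
  rw [Real.artanh_eq_half_log hmem, critBeta]
  congr 2
  have h3 : 1 + 1 / ((d : ℝ) - 1) = d / ((d : ℝ) - 1) := by
    rw [one_add_div h1.ne', sub_add_cancel]
  have h4 : 1 - 1 / ((d : ℝ) - 1) = ((d : ℝ) - 2) / ((d : ℝ) - 1) := by
    rw [one_sub_div h1.ne']; ring
  rw [h3, h4, div_div_div_cancel_right₀ h1.ne']

lemma criticalBeta_eq (hd : 3 ≤ d) (hD : ∀ n, IsRegularDegrees d n (D n)) :
    criticalBeta D = ((critBeta d : ℝ) : EReal) := by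
  rw [criticalBeta, setOf_spontaneousMagnetization_pos (by omega) hD]
  refine IsGLB.sInf_eq ⟨?_, fun b hb => ?_⟩
  · rintro _ ⟨β, ⟨-, hβ⟩, rfl⟩
    exact EReal.coe_le_coe_iff.2 ((critBeta_lt_iff hd).2 hβ).le
  · by_contra! hlt
    obtain ⟨β, h1, h2⟩ := EReal.lt_iff_exists_real_btwn.1 hlt
    have h1' := EReal.coe_lt_coe_iff.1 h1
    exact absurd h2 (not_lt.2 (hb ⟨β, ⟨(critBeta_pos hd).trans h1', (critBeta_lt_iff hd).1 h1'⟩,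
      rfl⟩))

lemma criticalBeta_two (hD : ∀ n, IsRegularDegrees 2 n (D n)) : criticalBeta D = ⊤ := by
  rw [criticalBeta, setOf_spontaneousMagnetization_pos two_ne_zero hD]
  have : {β : ℝ | 0 < β ∧ ((2 : ℕ) : ℝ) * Real.exp (-2 * β) < ((2 : ℕ) : ℝ) - 2} = ∅ := by
    ext β
    have := Real.exp_pos (-2 * β)
    simp only [mem_ofPred_eq, mem_empty_iff_false, iff_false, not_and, not_lt]
    intro _
    push_cast
    linarith
  rw [this, image_empty, sInf_empty]

lemma critSlope_one_pos_of_lt_criticalBeta (hd : 2 ≤ d) (hβ : 0 < β)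
    (hD : ∀ n, IsRegularDegrees d n (D n)) (h : (β : EReal) < criticalBeta D) :
    0 < critSlope (Real.exp (-2 * β)) d 1 := by
  rw [critSlope_one_pos_iff (exp_neg_two_mul_lt_one hβ)]
  rcases hd.eq_or_lt with rfl | hd
  · have := Real.exp_pos (-2 * β)
    push_cast; linarith
  · rw [criticalBeta_eq hd hD, EReal.coe_lt_coe_iff] at h
    exact (lt_critBeta_iff hd).1 h

end Critical

/-! ### Dependence of the pressures on the field -/

section Field

variable {d : ℕ} {β : ℝ}

lemma graphExpect_partitionFunction_pos {n : ℕ} {D : Fin n → ℕ} (hD : Even (∑ i, D i))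
    (β B : ℝ) : 0 < graphExpect D (fun π => partitionFunction β B π) := by
  have hM := nonempty_perfectMatching (γ := HalfEdge D) (by simpa using hD)
  have : 0 < Fintype.card (Matching D) := Fintype.card_pos
  refine div_pos (Finset.sum_pos (fun π _ => Finset.sum_pos (fun σ _ => Real.exp_pos _)
    Finset.univ_nonempty) Finset.univ_nonempty) (by exact_mod_cast this)

lemma graphExpect_partitionFunction_le {n : ℕ} (D : Fin n → ℕ) (β B B' : ℝ) :
    graphExpect D (fun π => partitionFunction β B' π) ≤
      Real.exp (n * |B' - B|) * graphExpect D (fun π => partitionFunction β B π) := by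
  rw [graphExpect, graphExpect, ← mul_div_assoc]
  refine div_le_div_of_nonneg_right ?_ (Nat.cast_nonneg _)
  simp only [partitionFunction, Finset.mul_sum]
  refine Finset.sum_le_sum fun π _ => Finset.sum_le_sum fun σ _ => ?_
  rw [← Real.exp_add, Real.exp_le_exp, neg_hamiltonian_eq, neg_hamiltonian_eq]
  have h1 : (B' - B) * totalSpin σ ≤ n * |B' - B| := by
    refine (le_abs_self _).trans ?_
    rw [abs_mul, mul_comm]
    exact mul_le_mul_of_nonneg_right (abs_totalSpin_le σ) (abs_nonneg _)
  linarith

lemma pressure_le {n : ℕ} (hn : 0 < n) {D : Fin n → ℕ} (hD : Even (∑ i, D i)) (β B B' : ℝ) :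
    pressure D β B' ≤ pressure D β B + |B' - B| := by
  have hn0 : (0 : ℝ) < n := by exact_mod_cast hn
  have hp := graphExpect_partitionFunction_pos hD β B
  have := Real.log_le_log (graphExpect_partitionFunction_pos hD β B')
    (graphExpect_partitionFunction_le D β B B')
  rw [Real.log_mul (Real.exp_pos _).ne' hp.ne', Real.log_exp] at this
  rw [pressure, pressure, one_div_mul_eq_div, one_div_mul_eq_div, div_le_iff₀ hn0, add_mul,
    div_mul_cancel₀ _ hn0.ne']
  linarith

lemma limitPressure_le (d : ℕ) (β B B' : ℝ) :
    limitPressure d β B' ≤ limitPressure d β B + |B' - B| := by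
  obtain ⟨t, ht, hobj⟩ := (isGreatest_objective d β B').1
  have h2 := (isGreatest_objective d β B).2 ⟨t, ht, rfl⟩
  rw [limitPressure, limitPressure, ← hobj]
  have h3 : (B' - B) * (2 * t - 1) ≤ |B' - B| := by
    refine (le_abs_self _).trans ?_
    rw [abs_mul]
    refine mul_le_of_le_one_right (abs_nonneg _) ?_
    rw [abs_le]; constructor <;> linarith [ht.1, ht.2]
  have h4 : objective d β B' t = objective d β B t + 2 * (B' - B) * t := by
    unfold objective; ring
  linarith

lemma IsRegularDegrees.even_sum {n : ℕ} {D : Fin n → ℕ} (h : IsRegularDegrees d n D) (hn : 0 < n) :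
    Even (∑ i, D i) := by
  obtain ⟨e, -, r, -, hr, -⟩ := h.exists_prod_sum_eq hn
  rw [hr]; exact even_two_mul r

variable {D : (n : ℕ) → Fin n → ℕ}

/-- The pressure converges at positive inverse temperature. At zero field, where the maximizer may
be degenerate or not unique, this follows from nearby fields because the pressures are
`1`-Lipschitz in the field. -/
lemma tendsto_pressure_of_pos (hβ : 0 < β) (hd : d ≠ 0) (hD : ∀ n, IsRegularDegrees d n (D n))
    (B : ℝ) : Tendsto (fun n => pressure (D n) β B) atTop (𝓝 (limitPressure d β B)) := by
  have hne : ∀ B, B ≠ 0 →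
      Tendsto (fun n => pressure (D n) β B) atTop (𝓝 (limitPressure d β B)) := by
    intro B hB
    obtain ⟨x, hx⟩ := exists_isRegularMax_of_ne_zero (Real.exp_pos (-2 * β))
      (exp_neg_two_mul_lt_one hβ) hd hB
    rw [limitPressure_eq hβ hd hx]
    exact hx.tendsto_pressure hβ hd hD
  rcases eq_or_ne B 0 with rfl | hB
  · rw [Metric.tendsto_nhds]
    intro ε hε
    have hε4 : 0 < ε / 4 := by positivity
    filter_upwards [(Metric.tendsto_nhds.1 (hne (ε / 4) hε4.ne')) (ε / 4) hε4,
      eventually_gt_atTop 0] with n hn hn0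
    have he := (hD n).even_sum hn0
    have a1 := pressure_le hn0 he β 0 (ε / 4)
    have a2 := pressure_le hn0 he β (ε / 4) 0
    have a3 := limitPressure_le d β 0 (ε / 4)
    have a4 := limitPressure_le d β (ε / 4) 0
    rw [zero_sub, abs_neg, abs_of_pos hε4] at a2 a4
    rw [sub_zero, abs_of_pos hε4] at a1 a3
    rw [Real.dist_eq, abs_lt] at hn ⊢
    constructor <;> linarith [hn.1, hn.2]
  · exact hne B hB

/-! ### Infinite temperature -/

lemma graphExpect_partitionFunction_zero {n : ℕ} {D : Fin n → ℕ} (hD : Even (∑ i, D i)) (B : ℝ) :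
    graphExpect D (fun π => partitionFunction 0 B π) = spinSum D B (fun _ => 1) 1 := by
  rw [graphExpect_partitionFunction, spinSum]
  exact Finset.sum_congr rfl fun σ _ => by
    rw [graphExpect_exp_neg_hamiltonian_zero B hD, one_pow, one_mul, mul_one]

lemma annealedExpect_zero {n : ℕ} {D : Fin n → ℕ} (hD : Even (∑ i, D i)) (B : ℝ)
    (X : Spins n → ℝ) :
    annealedExpect D 0 B X = spinSum D B X 1 / spinSum D B (fun _ => 1) 1 := by
  rw [annealedExpect, spinSum.eq_1 D B X, Finset.sum_div]
  refine Finset.sum_congr rfl fun σ _ => ?_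
  rw [annealedWeight, graphExpect_partitionFunction_zero hD,
    graphExpect_exp_neg_hamiltonian_zero B hD, one_pow]
  ring

/-- At infinite temperature the degrees are irrelevant; `0` serves as the standard one below. -/
lemma siteWeight_at_one (B : ℝ) (k l : ℕ) : siteWeight B k 1 = siteWeight B l 1 := by
  simp [siteWeight]

lemma siteMean_at_one (B : ℝ) (k l : ℕ) : siteMean B k 1 = siteMean B l 1 := by
  simp [siteMean, siteWeight]

lemma pressure_zero {n : ℕ} (hn : 0 < n) {D : Fin n → ℕ} (hD : Even (∑ i, D i)) (d : ℕ) (B : ℝ) :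
    pressure D 0 B = limitPressure d 0 B := by
  have hn0 : (n : ℝ) ≠ 0 := by positivity
  rw [pressure, graphExpect_partitionFunction_zero hD, spinSum_one,
    Finset.prod_congr rfl fun i _ => siteWeight_at_one B (D i) 0, Finset.prod_const,
    Finset.card_univ, Fintype.card_fin, Real.log_pow, limitPressure_zero]
  simp only [siteWeight, pow_zero, mul_one]
  field_simp

lemma magnetization_susceptibility_zero {n : ℕ} (hn : 0 < n) {D : Fin n → ℕ}
    (hD : Even (∑ i, D i)) (B : ℝ) :
    magnetization D 0 B = siteMean B 0 1 ∧ susceptibility D 0 B = 1 - siteMean B 0 1 ^ 2 := by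
  have hn0 : (0 : ℝ) < n := by exact_mod_cast hn
  have hs : √(n : ℝ) ≠ 0 := (Real.sqrt_pos.2 hn0).ne'
  have hp : 0 < ∏ i, siteWeight B (D i) 1 :=
    Finset.prod_pos fun i _ => siteWeight_pos B (D i) zero_le_one
  have hone : annealedExpect D 0 B (fun _ => 1) = 1 := by
    rw [annealedExpect_zero hD, spinSum_one, div_self hp.ne']
  have hm : ∑ i, siteMean B (D i) 1 = n * siteMean B 0 1 := by
    rw [Finset.sum_congr rfl fun i _ => siteMean_at_one B (D i) 0]; simp
  have hv : ∑ i, (1 - siteMean B (D i) 1 ^ 2) = n * (1 - siteMean B 0 1 ^ 2) := by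
    rw [Finset.sum_congr rfl fun i _ => by rw [siteMean_at_one B (D i) 0]]
    simp only [Finset.sum_const, Finset.card_univ, Fintype.card_fin, nsmul_eq_mul]
  have hE1 : annealedExpect D 0 B (fun σ => (totalSpin σ - n * siteMean B 0 1) / √n) = 0 := by
    have := spinSum_div_pow (D := D) (B := B) (fun σ => totalSpin σ - n * siteMean B 0 1) (√n) 1 1
    simp only [pow_one] at this
    rw [annealedExpect_zero hD, this, spinSum_sub D B _ zero_le_one, hm, sub_self, mul_zero,
      zero_div, zero_div]
  have hE2 : annealedExpect D 0 B (fun σ => ((totalSpin σ - n * siteMean B 0 1) / √n) ^ 2) =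
      1 - siteMean B 0 1 ^ 2 := by
    rw [annealedExpect_zero hD, spinSum_div_pow, spinSum_sub_sq D B _ zero_le_one, hm, hv,
      spinSum_one, sub_self, Real.sq_sqrt hn0.le]
    field_simp
    ring
  refine ⟨?_, ?_⟩
  · rw [magnetization_eq hn 0 B (siteMean B 0 1) hone, hE1, mul_zero, add_zero]
  · rw [susceptibility_eq hn 0 B (siteMean B 0 1) hone, hE1, hE2]; ring

lemma hasDerivAt_limitPressure_zero (d : ℕ) (B : ℝ) :
    HasDerivAt (limitPressure d 0) (siteMean B 0 1) B := by
  have hw := siteWeight_pos B 0 zero_le_one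
  have := (hasDerivAt_siteWeight B 0 zero_le_one).log hw.ne'
  rw [mul_div_cancel_left₀ _ hw.ne'] at this
  refine this.congr_of_eventuallyEq (.of_forall fun B' => ?_)
  simp only [limitPressure_zero, siteWeight, pow_zero, mul_one]

lemma deriv_limitPressure_zero (d : ℕ) : deriv (limitPressure d 0) = fun B => siteMean B 0 1 :=
  funext fun B => (hasDerivAt_limitPressure_zero d B).deriv

end Field

end

end AnnealedIsing

open AnnealedIsing in
theorem theorem1p1 (d : ℕ) (hd : 2 ≤ d) (D : (n : ℕ) → Fin n → ℕ)
    (hD : ∀ n, IsRegularDegrees d n (D n)) :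
    -- (i) the pressure; the supremum defining the limit is a maximum
    (∀ β B : ℝ, 0 ≤ β →
      IsGreatest (objective d β B '' Icc 0 1) (sSup (objective d β B '' Icc 0 1)) ∧
      Tendsto (fun n => pressure (D n) β B) atTop (𝓝 (limitPressure d β B))) ∧
    -- (ii) the magnetization
    (∀ β B : ℝ, (β, B) ∈ region D →
      DifferentiableAt ℝ (limitPressure d β) B ∧
      Tendsto (fun n => magnetization (D n) β B) atTop (𝓝 (deriv (limitPressure d β) B))) ∧
    -- (ii) the critical inverse temperature
    (∀ β : ℝ, 0 < β → ∃ m, IsSpontaneousMagnetization D β m) ∧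
    (3 ≤ d →
      criticalBeta D = ((Real.artanh (1 / ((d : ℝ) - 1)) : ℝ) : EReal) ∧
      Real.artanh (1 / ((d : ℝ) - 1)) = 1 / 2 * Real.log ((d : ℝ) / ((d : ℝ) - 2))) ∧
    (d = 2 → criticalBeta D = ⊤) ∧
    -- (iii) the susceptibility
    (∀ β B : ℝ, (β, B) ∈ region D →
      DifferentiableAt ℝ (deriv (limitPressure d β)) B ∧
      Tendsto (fun n => susceptibility (D n) β B) atTop
        (𝓝 (deriv (deriv (limitPressure d β)) B))) := by
  have hd0 : d ≠ 0 := by omega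
  have hregular : ∀ β B : ℝ, (β, B) ∈ region D → 0 < β →
      ∀ᶠ B' in 𝓝 B, ∃ x, IsRegularMax (Real.exp (-2 * β)) d B' x := by
    intro β B h hβ
    refine eventually_exists_isRegularMax (Real.exp_pos _) (exp_neg_two_mul_lt_one hβ) hd0 ?_
    rcases h with ⟨-, hB⟩ | ⟨-, hc, -⟩
    · exact Or.inl hB
    · exact Or.inr (critSlope_one_pos_of_lt_criticalBeta hd hβ hD hc)
  have hnonneg : ∀ β B : ℝ, (β, B) ∈ region D → β = 0 ∨ 0 < β := by
    rintro β B (⟨h, -⟩ | ⟨h, -⟩)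
    · exact h.eq_or_lt.imp_left Eq.symm
    · exact Or.inr h
  refine ⟨fun β B hβ => ⟨isGreatest_objective d β B, ?_⟩, fun β B h => ?_, fun β hβ => ?_,
    fun hd3 => ?_, ?_, fun β B h => ?_⟩
  · rcases hβ.eq_or_lt with rfl | hβ
    · refine tendsto_const_nhds.congr' ?_
      filter_upwards [eventually_gt_atTop 0] with n hn
      exact (pressure_zero hn ((hD n).even_sum hn) d B).symm
    · exact tendsto_pressure_of_pos hβ hd0 hD B
  · rcases hnonneg β B h with rfl | hβ
    · refine ⟨(hasDerivAt_limitPressure_zero d B).differentiableAt, ?_⟩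
      rw [deriv_limitPressure_zero]
      refine tendsto_const_nhds.congr' ?_
      filter_upwards [eventually_gt_atTop 0] with n hn
      exact (magnetization_susceptibility_zero hn ((hD n).even_sum hn) B).1.symm
    · have hev := hregular β B h hβ
      obtain ⟨x, hx⟩ := hev.self_of_nhds
      have hder := limitPressure_hasDerivAt hβ hd0 hx hev
      refine ⟨hder.differentiableAt, ?_⟩
      rw [hder.deriv]
      exact (hx.tendsto_magnetization_susceptibility hβ hd0 hD).1
  · obtain ⟨m, hm, -⟩ := exists_isSpontaneousMagnetization hβ hd0 hD
    exact ⟨m, hm⟩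
  · rw [artanh_eq_critBeta hd3]
    exact ⟨criticalBeta_eq hd3 hD, rfl⟩
  · rintro rfl
    exact criticalBeta_two hD
  · rcases hnonneg β B h with rfl | hβ
    · rw [deriv_limitPressure_zero]
      have hder := hasDerivAt_siteMean B 0 zero_le_one
      refine ⟨hder.differentiableAt, ?_⟩
      rw [hder.deriv]
      refine tendsto_const_nhds.congr' ?_
      filter_upwards [eventually_gt_atTop 0] with n hn
      exact (magnetization_susceptibility_zero hn ((hD n).even_sum hn) B).2.symm
    · have hev := hregular β B h hβ
      obtain ⟨x, hx⟩ := hev.self_of_nhds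
      have hder := deriv_limitPressure_hasDerivAt hβ hd0 hx hev
      refine ⟨hder.differentiableAt, ?_⟩
      rw [hder.deriv]
      exact (hx.tendsto_magnetization_susceptibility hβ hd0 hD).2
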